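/- Let $\mathbb{H}$ be the quaternions with their euclidean structure, let $\zeta=\frac{1+i+j+k}{2}$ and $\omega=\zeta^2=\frac{-1+i+j+k}{2}$, and identify $\mathbb{C}$ with the subalgebra $\mathbb{R}+\mathbb{R}\omega$ of $\mathbb{H}$. With right multiplication by $\mathbb{C}$ and the hermitian product whose real part is the euclidean inner product, $\mathbb{H}$ is a complex euclidean plane $\cong\mathbb{C}^2$. Let $\mathrm{Refl}(\widetilde G_4)$ be the group of isometries generated by the complex reflections $x\mapsto\zeta x\zeta$, $x\mapsto(-i\zeta i)x\zeta$ and $x\mapsto\zeta x\zeta+2$. Its hyperplanes are the fixed sets (affine complex lines) of the non-trivial finite-order complex reflections it contains, and its hyperplane complement $M$ is the complement in $\mathbb{C}^2$ of their union. Let $S$ be the set of points that are intersections of families of these hyperplanes. Consider the Voronoi cell structure of $S$, whose closed cells are all faces of the Voronoi cells $\{x : |x-s|\le|x-t|\ \text{for all } t\in S\}$, $s\in S$, and let $K$ be the collection of those closed cells that are disjoint from all hyperplanes. **Theorem A.** $K$ is a locally finite piecewise euclidean cell complex of dimension exactly $2$ (its cells are convex polytopes, faces of cells are cells, and cells that meet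 do so in a common face), and the union of its cells is contained in $M$ and is a strong deformation retract of $M$. Every $2$-cell of $K$ is an equilateral triangle. For every vertex $v$ of $K$ the link of $v$ (the graph whose vertices are the directions of the edges of $K$ at $v$, two of them being joined by an arc when they are the sides of the corner at $v$ of some $2$-cell, with the angle of that corner as the length of the arc) is isomorphic to the Möbius–Kantor graph, that is, the generalized Petersen graph $GP(8,3)$; it has girth $6$, and all its arcs have length $\pi/3$. Finally, $K$ is non-positively curved: no vertex link contains a simple loop of length strictly less than $2\pi$. -/

import Mathlib

open scoped Quaternion

noncomputable section

namespace ElegantComplex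

/-! ### The complex euclidean plane `ℍ_ω` -/

/-- The unit quaternion `ζ = (1 + i + j + k) / 2`. -/
def ζ : ℍ := ⟨1 / 2, 1 / 2, 1 / 2, 1 / 2⟩

/-- The cube root of unity `ω = (-1 + i + j + k) / 2`. -/
def ω : ℍ := ⟨-1 / 2, 1 / 2, 1 / 2, 1 / 2⟩

/-- The quaternion unit `i`. -/
def qi : ℍ := ⟨0, 1, 0, 0⟩

/-- The distinguished copy of the complex numbers: the real span of `1` and `ω` in `ℍ`.
Right multiplication by its elements makes `ℍ` a two-dimensional complex vector space; the
complex line through `v ≠ 0` is `{v * c | c ∈ Cω}`. -/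
def Cω : Submodule ℝ ℍ := Submodule.span ℝ {1, ω}

/-- Hermitian orthogonality: as the real part of the hermitian product is the real inner
product, `w` is hermitian-orthogonal to `v` iff it is real-orthogonal to every point of the
complex line through `v`. -/
def HermOrthogonal (v w : ℍ) : Prop := ∀ c ∈ Cω, inner ℝ (v * c) w = 0

/-- The euclidean map `x ↦ q x z + v`, for unit quaternions `q` and `z`, as an isometry. -/
def euclideanMap (q z v : ℍ) (hq : ‖q‖ = 1) (hz : ‖z‖ = 1) : ℍ ≃ᵢ ℍ where
  toFun x := q * x * z + v
  invFun y := q⁻¹ * (y - v) * z⁻¹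
  left_inv x := by
    have hq0 : q ≠ 0 := by rintro rfl; simp at hq
    have hz0 : z ≠ 0 := by rintro rfl; simp at hz
    simp [mul_assoc, hq0, hz0]
  right_inv y := by
    have hq0 : q ≠ 0 := by rintro rfl; simp at hq
    have hz0 : z ≠ 0 := by rintro rfl; simp at hz
    simp [mul_assoc, hq0, hz0]
  isometry_toFun := Isometry.of_dist_eq fun x y => by
    rw [dist_add_right, dist_eq_norm, ← sub_mul, ← mul_sub, norm_mul, norm_mul, hq, hz,
      one_mul, mul_one, dist_eq_norm]

theorem norm_ζ : ‖ζ‖ = 1 := by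
  have h : ‖ζ‖ * ‖ζ‖ = 1 := by
    rw [← Quaternion.normSq_eq_norm_mul_self, Quaternion.normSq_def']
    norm_num [ζ]
  nlinarith [norm_nonneg ζ]

theorem norm_qi : ‖qi‖ = 1 := by
  have h : ‖qi‖ * ‖qi‖ = 1 := by
    rw [← Quaternion.normSq_eq_norm_mul_self, Quaternion.normSq_def']
    norm_num [qi]
  nlinarith [norm_nonneg qi]

/-- The order three reflection `x ↦ ζ x ζ`. -/
def r₁ : ℍ ≃ᵢ ℍ := euclideanMap ζ ζ 0 norm_ζ norm_ζ

/-- The order three reflection `x ↦ (-i ζ i) x ζ`. -/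
def rᵢ : ℍ ≃ᵢ ℍ :=
  euclideanMap (-qi * ζ * qi) ζ 0 (by simp [norm_qi, norm_ζ]) norm_ζ

/-- The order three reflection `x ↦ ζ x ζ + 2`. -/
def r₁' : ℍ ≃ᵢ ℍ := euclideanMap ζ ζ 2 norm_ζ norm_ζ

/-- The complex euclidean reflection group of type `G̃₄`, acting on `ℍ_ω ≅ ℂ²`. -/
def reflG4 : Subgroup (ℍ ≃ᵢ ℍ) := Subgroup.closure {r₁, rᵢ, r₁'}

/-- A (proper, non-trivial) complex reflection of `ℍ_ω`: after moving the origin to `p`, it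
multiplies the unit vector `v` by the unit complex number `z ≠ 1` of finite order, and fixes
the hermitian-orthogonal complement of `v` pointwise. -/
def IsComplexReflection (f : ℍ → ℍ) : Prop :=
  ∃ p v z : ℍ, ‖v‖ = 1 ∧ z ∈ Cω ∧ ‖z‖ = 1 ∧ z ≠ 1 ∧ (∃ n : ℕ, 0 < n ∧ z ^ n = 1) ∧
    ∀ c ∈ Cω, ∀ w, HermOrthogonal v w → f (p + (v * c + w)) = p + (v * (c * z) + w)

/-- The fixed hyperplanes (affine complex lines) of the complex reflections in a group. -/
def hyperplanes (G : Subgroup (ℍ ≃ᵢ ℍ)) : Set (Set ℍ) :=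
  {H | ∃ g ∈ G, IsComplexReflection g ∧ H = {x | g x = x}}

/-- The hyperplane complement. -/
def hyperplaneComplement (G : Subgroup (ℍ ≃ᵢ ℍ)) : Set ℍ := (⋃₀ hyperplanes G)ᶜ

/-- The `0`-dimensional intersections of the fixed hyperplanes. -/
def zeroDimIntersections (G : Subgroup (ℍ ≃ᵢ ℍ)) : Set ℍ :=
  {p | ∃ A ⊆ hyperplanes G, ⋂₀ A = {p}}

/-! ### Euclidean polyhedral complexes, Voronoi cell structures, links -/

section Euclidean

variable {E : Type*} [NormedAddCommGroup E] [InnerProductSpace ℝ E]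

/-- `F` is a (non-empty, possibly improper) face of the polytope `P`. -/
def IsFace (P F : Set E) : Prop := F.Nonempty ∧ IsExposed ℝ P F

/-- The Voronoi cell around `s` of a set `S` of points. -/
def voronoiCell (S : Set E) (s : E) : Set E := {x | ∀ t ∈ S, dist x s ≤ dist x t}

/-- The closed cells of the Voronoi cell structure of `S`: all faces of all Voronoi cells. -/
def voronoiStructure (S : Set E) : Set (Set E) :=
  {F | ∃ s ∈ S, IsFace (voronoiCell S s) F}

/-- The dimension of a convex set. -/
def cellDim (F : Set E) : ℕ := Module.finrank ℝ (vectorSpan ℝ F)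

/-- A set of closed cells in a euclidean space is a (locally finite) piecewise euclidean cell
complex: the cells are convex polytopes, faces of cells are cells, two cells that meet do so
in a common face, and the family of cells is locally finite. -/
structure IsPolyhedralComplex (K : Set (Set E)) : Prop where
  polytope : ∀ F ∈ K, F.Nonempty ∧ ∃ V : Finset E, F = convexHull ℝ (V : Set E)
  face_mem : ∀ F ∈ K, ∀ F', IsFace F F' → F' ∈ K
  inter : ∀ F ∈ K, ∀ F' ∈ K, (F ∩ F').Nonempty → IsFace F (F ∩ F') ∧ IsFace F' (F ∩ F')
  locallyFinite : ∀ x : E, ∃ U ∈ nhds x, {F ∈ K | (F ∩ U).Nonempty}.Finite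

/-- The complex has dimension exactly two. -/
def IsTwoDimensional (K : Set (Set E)) : Prop :=
  (∀ F ∈ K, cellDim F ≤ 2) ∧ ∃ F ∈ K, cellDim F = 2

/-- `F` is a non-degenerate equilateral triangle. -/
def IsEquilateralTriangle (F : Set E) : Prop :=
  ∃ a b c : E, a ≠ b ∧ dist a b = dist b c ∧ dist b c = dist c a ∧
    F = convexHull ℝ {a, b, c}

/-- Starting at its point `v`, the convex set `F` contains a short segment in direction `u`. -/
def HasDirection (F : Set E) (v u : E) : Prop := v ∈ F ∧ ∃ ε : ℝ, 0 < ε ∧ v + ε • u ∈ F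

/-- The vertices of the link of `v`: the unit directions of the edges of `K` at `v`. -/
def LinkVertex (K : Set (Set E)) (v : E) : Type _ :=
  {u : E // ‖u‖ = 1 ∧ ∃ e ∈ K, cellDim e = 1 ∧ HasDirection e v u}

/-- The link of the vertex `v` in `K`, as a graph: two edge directions are joined when they
are the two sides of the corner at `v` of some `2`-cell. -/
def link (K : Set (Set E)) (v : E) : SimpleGraph (LinkVertex K v) where
  Adj u w := u ≠ w ∧ ∃ F ∈ K, cellDim F = 2 ∧ HasDirection F v u.1 ∧ HasDirection F v w.1
  symm := ⟨fun _ _ ⟨h, F, hF, hd, h₁, h₂⟩ => ⟨h.symm, F, hF, hd, h₂, h₁⟩⟩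
  loopless := ⟨fun _ h => h.1 rfl⟩

/-- The length of the arc of the link between two adjacent link vertices: the angle of the
corner of the corresponding polygon. -/
def linkLength (K : Set (Set E)) (v : E) (u w : LinkVertex K v) : ℝ :=
  InnerProductGeometry.angle u.1 w.1

/-- A metric graph (a graph with edge lengths `ℓ`) is `CAT(1)` when it contains no simple loop
of length strictly less than `2π`. -/
def IsCATOneGraph {V : Type*} (Γ : SimpleGraph V) (ℓ : V → V → ℝ) : Prop :=
  ∀ (u : V) (c : Γ.Walk u u), c.IsCycle →
    2 * Real.pi ≤ (c.darts.map fun d => ℓ d.fst d.snd).sum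

/-- A piecewise euclidean `2`-complex is non-positively curved when every vertex link is
`CAT(1)`. -/
def IsNonPositivelyCurved (K : Set (Set E)) : Prop :=
  ∀ v : E, {v} ∈ K → IsCATOneGraph (link K v) (linkLength K v)

end Euclidean

/-- The Möbius–Kantor graph, that is the generalized Petersen graph `GP(8, 3)`: an outer
`8`-cycle, an inner star polygon with step `3`, and eight spokes. -/
def moebiusKantor : SimpleGraph (ZMod 8 ⊕ ZMod 8) :=
  SimpleGraph.fromRel fun a b =>
    (∃ n, a = Sum.inl n ∧ b = Sum.inl (n + 1)) ∨
    (∃ n, a = Sum.inr n ∧ b = Sum.inr (n + 3)) ∨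
    (∃ n, a = Sum.inl n ∧ b = Sum.inr n)

/-- `A` is a (strong) deformation retract of the space `X`. -/
def DeformationRetractsOnto {T : Type*} [TopologicalSpace T] (X A : Set T) : Prop :=
  A ⊆ X ∧ ∃ H : C(unitInterval × X, X),
    (∀ x, H (0, x) = x) ∧ (∀ x, (H (1, x) : T) ∈ A) ∧
    ∀ t, ∀ x : X, (x : T) ∈ A → H (t, x) = x

/-- The complement complex of a group: the cells of the Voronoi cell structure around the
`0`-dimensional hyperplane intersections that are disjoint from all fixed hyperplanes. -/
def complementComplex (G : Subgroup (ℍ ≃ᵢ ℍ)) : Set (Set ℍ) :=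
  {F ∈ voronoiStructure (zeroDimIntersections G) | F ⊆ hyperplaneComplement G}

/-- The complement complex `K` of the group of type `G̃₄`. -/
def K : Set (Set ℍ) := complementComplex reflG4

end ElegantComplex

end

noncomputable section

namespace ElegantComplex

open Quaternion

/-! ### Hurwitz quaternions -/

/-! Everything happens in the honeycomb of 24-cells. Let H be the Hurwitz order and D4 its ideal of
elements of even norm; H/D4 has four classes. Every group element has the form x ↦ qxz + 2t with q a
Hurwitz unit, z a cube root of unity in `Cω`, q ≡ z modulo D4 and t in H. For a reflection this
forces z ≠ 1 and q = u z ū with u among 1, i, j, k. Hence the mirrors form four families of parallel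
complex lines, all of which occur (`mem_hyperplanes`), and their zero-dimensional intersections are
exactly the points of D4 (`zeroDimIntersections_eq`).

The Voronoi cell around s is the 24-cell with vertices s + u, u a Hurwitz unit; its facets are
octahedra with centres s + t/2, t a vector of norm 2. It is cut into pyramids over its facets.
Writing x = s + tz turns a pyramid into |z_i| + |z_j| + |z_k| ≤ re z ≤ 1/2, and the mirrors meet it
precisely where z_i = z_j = z_k (`onMirror_iff`). So in each octahedron the mirrors cut out the
diameter through the barycentres of two opposite triangles. What survives are the vertices, the
edges and the other six triangles of each octahedron. Such cells are hulls of at most three vertices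
at mutual distance one (`Clique`, `mem_K_iff`), and cliques are exposed by the sum of their vectors.

On a pyramid the retraction drops the real part, removes from the imaginary part the multiple of i +
j + k common to its coordinates, and rescales onto the boundary of the octahedron (`retr`). The
image has imaginary coordinates that are neither all positive nor all negative, hence lies on a
surviving triangle. These maps agree where pyramids overlap (`retr_eq`): either the two pyramids
share a base, or a common point may be moved to the boundary of a base, where the retraction is
radial projection away from the barycentre of a triangle and so does not depend on the pyramid. The
pyramids form a locally finite closed cover, so the glued map is continuous, and the straight
homotopy stays off the mirrors.

The edges at a vertex v point in the directions of the units u with v + u outside D4. Two directions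
bound a triangle of the complex iff they are at distance one and do not span the same complex line
(`link_adj_iff`), for otherwise the barycentre lies on a mirror. Right multiplication by a cube root
of unity reduces to v ≡ 1, where the directions are the sixteen units (±1 ± i ± j ± k)/2; a finite
check identifies the graph. It is bipartite without 4-cycles, so its girth is 6, and six arcs of
length π/3 give the curvature bound. -/

/-- The quaternion with given coordinates. -/
def mkq (a b c d : ℝ) : ℍ := ⟨a, b, c, d⟩

@[simp] theorem re_mkq (a b c d : ℝ) : (mkq a b c d).re = a := rfl
@[simp] theorem imI_mkq (a b c d : ℝ) : (mkq a b c d).imI = b := rfl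
@[simp] theorem imJ_mkq (a b c d : ℝ) : (mkq a b c d).imJ = c := rfl
@[simp] theorem imK_mkq (a b c d : ℝ) : (mkq a b c d).imK = d := rfl

theorem inner_coord (x y : ℍ) :
    inner ℝ x y = x.re * y.re + x.imI * y.imI + x.imJ * y.imJ + x.imK * y.imK := by
  rw [Quaternion.inner_def, Quaternion.re_mul]
  simp only [re_star, imI_star, imJ_star, imK_star]
  ring

theorem normSq_coord (x : ℍ) :
    normSq x = x.re ^ 2 + x.imI ^ 2 + x.imJ ^ 2 + x.imK ^ 2 := normSq_def' x

theorem normSq_eq_sq (x : ℍ) : normSq x = ‖x‖ ^ 2 := by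
  rw [normSq_eq_norm_mul_self, sq]

theorem normSq_eq_one_iff (x : ℍ) : normSq x = 1 ↔ ‖x‖ = 1 := by
  rw [normSq_eq_sq, pow_eq_one_iff_of_nonneg (norm_nonneg x) two_ne_zero]

theorem dist_le_iff (x y z : ℍ) : dist x y ≤ dist x z ↔ normSq (x - y) ≤ normSq (x - z) := by
  rw [dist_eq_norm, dist_eq_norm, normSq_eq_sq, normSq_eq_sq]
  exact (pow_le_pow_iff_left₀ (norm_nonneg _) (norm_nonneg _) two_ne_zero).symm

/-- The ring of Hurwitz quaternions. -/
def hurwitz : Subring ℍ where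
  carrier := {x | ∃ a b c d : ℤ, x = mkq (a / 2) (a / 2 + b) (a / 2 + c) (a / 2 + d)}
  mul_mem' := by
    rintro _ _ ⟨a, b, c, d, rfl⟩ ⟨a', b', c', d', rfl⟩
    refine ⟨-a * a' - (a * b' + a' * b + a * c' + a' * c + a * d' + a' * d)
      - 2 * (b * b' + c * c' + d * d'),
      a * a' + a * b' + a' * b + a * d' + a' * c + b * b' + c * c' + d * d' + c * d' - d * c',
      a * a' + a * c' + a' * c + a * b' + a' * d + b * b' + c * c' + d * d' + d * b' - b * d',
      a * a' + a * d' + a' * d + a * c' + a' * b + b * b' + c * c' + d * d' + b * c' - c * b',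
      ?_⟩
    ext <;> simp <;> ring
  one_mem' := ⟨2, -1, -1, -1, by ext <;> simp⟩
  add_mem' := by
    rintro _ _ ⟨a, b, c, d, rfl⟩ ⟨a', b', c', d', rfl⟩
    refine ⟨a + a', b + b', c + c', d + d', ?_⟩
    ext <;> simp <;> ring
  zero_mem' := ⟨0, 0, 0, 0, by ext <;> simp⟩
  neg_mem' := by
    rintro _ ⟨a, b, c, d, rfl⟩
    refine ⟨-a, -b, -c, -d, ?_⟩
    ext <;> simp <;> ring

theorem star_mem_hurwitz {x : ℍ} (hx : x ∈ hurwitz) : star x ∈ hurwitz := by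
  obtain ⟨a, b, c, d, rfl⟩ := hx
  refine ⟨a, -a - b, -a - c, -a - d, ?_⟩
  ext <;> simp <;> ring

/-- The lattice of integral quaternions with even coordinate sum. -/
def D4 : AddSubgroup ℍ where
  carrier := {x | ∃ a b c d : ℤ, x = mkq a b c d ∧ Even (a + b + c + d)}
  add_mem' := by
    rintro _ _ ⟨a, b, c, d, rfl, h⟩ ⟨a', b', c', d', rfl, h'⟩
    refine ⟨a + a', b + b', c + c', d + d', by ext <;> simp, ?_⟩
    obtain ⟨k, hk⟩ := h
    obtain ⟨l, hl⟩ := h'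
    exact ⟨k + l, by omega⟩
  zero_mem' := ⟨0, 0, 0, 0, by ext <;> simp, by simp⟩
  neg_mem' := by
    rintro _ ⟨a, b, c, d, rfl, h⟩
    refine ⟨-a, -b, -c, -d, by ext <;> simp, ?_⟩
    obtain ⟨k, hk⟩ := h
    exact ⟨-k, by omega⟩

theorem D4_subset {x : ℍ} (hx : x ∈ D4) : x ∈ hurwitz := by
  obtain ⟨a, b, c, d, rfl, h⟩ := hx
  refine ⟨2 * a, b - a, c - a, d - a, ?_⟩
  ext <;> simp

/-- In the coordinates of the Hurwitz quaternions, the sublattice `D4`. -/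
theorem hurwitz_mem_D4 (a b c d : ℤ) :
    mkq (a / 2) (a / 2 + b) (a / 2 + c) (a / 2 + d) ∈ D4 ↔ Even a ∧ Even (b + c + d) := by
  constructor
  · rintro ⟨a', b', c', d', h, k, hk⟩
    have h0 := congrArg QuaternionAlgebra.re h
    have h1 := congrArg QuaternionAlgebra.imI h
    have h2 := congrArg QuaternionAlgebra.imJ h
    have h3 := congrArg QuaternionAlgebra.imK h
    simp only [re_mkq, imI_mkq, imJ_mkq, imK_mkq] at h0 h1 h2 h3
    have e0 : a = 2 * a' := by exact_mod_cast (by linarith : (a : ℝ) = 2 * a')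
    have e1 : b' = a' + b := by exact_mod_cast (by linarith : (b' : ℝ) = a' + b)
    have e2 : c' = a' + c := by exact_mod_cast (by linarith : (c' : ℝ) = a' + c)
    have e3 : d' = a' + d := by exact_mod_cast (by linarith : (d' : ℝ) = a' + d)
    exact ⟨⟨a', by omega⟩, ⟨k - 2 * a', by omega⟩⟩
  · rintro ⟨⟨k, rfl⟩, ⟨l, hl⟩⟩
    refine ⟨k, k + b, k + c, k + d, ?_, ⟨2 * k + l, by omega⟩⟩
    ext <;> simp

/-- Modulo 2 the norm is the anisotropic form X² + XY + Y² in X = a and Y = b + c + d, so it is even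
only if both are. This description of `D4` makes it an ideal and excludes units from it. -/
theorem exists_normSq {x : ℍ} (hx : x ∈ hurwitz) :
    ∃ n : ℤ, normSq x = n ∧ (x ∈ D4 ↔ Even n) := by
  obtain ⟨a, b, c, d, rfl⟩ := hx
  refine ⟨a ^ 2 + a * (b + c + d) + b ^ 2 + c ^ 2 + d ^ 2, ?_, ?_⟩
  · rw [normSq_coord]
    simp only [re_mkq, imI_mkq, imJ_mkq, imK_mkq]
    push_cast
    ring
  · rw [hurwitz_mem_D4]
    simp only [Int.even_add, Int.even_mul, Int.even_pow]
    tauto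

theorem mem_D4_of_normSq {x : ℍ} (hx : x ∈ hurwitz) (n : ℤ) (h : normSq x = 2 * n) : x ∈ D4 := by
  obtain ⟨m, hm, hD⟩ := exists_normSq hx
  rw [hD]
  have : m = 2 * n := by exact_mod_cast (hm.symm.trans h)
  exact ⟨n, by omega⟩

theorem notMem_D4_of_normSq_one {x : ℍ} (hx : x ∈ hurwitz) (h : normSq x = 1) : x ∉ D4 := by
  obtain ⟨m, hm, hD⟩ := exists_normSq hx
  rw [hD]
  have : m = 1 := by exact_mod_cast (hm.symm.trans h)
  subst this
  decide

theorem mul_mem_D4_left {h x : ℍ} (hh : h ∈ hurwitz) (hx : x ∈ D4) : h * x ∈ D4 := by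
  obtain ⟨m, hm, -⟩ := exists_normSq hh
  obtain ⟨n, hn, hD⟩ := exists_normSq (D4_subset hx)
  obtain ⟨k, rfl⟩ := hD.1 hx
  refine mem_D4_of_normSq (hurwitz.mul_mem hh (D4_subset hx)) (m * k) ?_
  rw [map_mul, hm, hn]
  push_cast
  ring

theorem mul_mem_D4_right {h x : ℍ} (hh : h ∈ hurwitz) (hx : x ∈ D4) : x * h ∈ D4 := by
  obtain ⟨m, hm, -⟩ := exists_normSq hh
  obtain ⟨n, hn, hD⟩ := exists_normSq (D4_subset hx)
  obtain ⟨k, rfl⟩ := hD.1 hx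
  refine mem_D4_of_normSq (hurwitz.mul_mem (D4_subset hx) hh) (m * k) ?_
  rw [map_mul, hm, hn]
  push_cast
  ring

theorem star_mem_D4 {x : ℍ} (hx : x ∈ D4) : star x ∈ D4 := by
  obtain ⟨n, hn, hD⟩ := exists_normSq (D4_subset hx)
  obtain ⟨k, rfl⟩ := hD.1 hx
  refine mem_D4_of_normSq (star_mem_hurwitz (D4_subset hx)) k ?_
  rw [normSq_star, hn]
  push_cast
  ring

/-- `D4` is the two-sided ideal generated by 1 + i, whose square is the ideal generated by 2. The
proof verifies this in coordinates, eliminating the first coordinates by parity. -/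
theorem half_mul_mem_hurwitz {x y : ℍ} (hx : x ∈ D4) (hy : y ∈ D4) :
    (1 / 2 : ℝ) • (x * y) ∈ hurwitz := by
  obtain ⟨a, b, c, d, rfl, k, hk⟩ := hx
  obtain ⟨a', b', c', d', rfl, k', hk'⟩ := hy
  obtain rfl : a = k + k - b - c - d := by omega
  obtain rfl : a' = k' + k' - b' - c' - d' := by omega
  refine ⟨(k + k - b - c - d) * (k' + k' - b' - c' - d') - b * b' - c * c' - d * d',
    2 * k * k' - k * (c' + d') - k' * (c + d) + (c + d) * (c' + d')
      - (k + k - b - c - d) * (k' + k' - b' - c' - d') - d * c',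
    2 * k * k' - k * (b' + d') - k' * (b + d) + (b + d) * (b' + d')
      - (k + k - b - c - d) * (k' + k' - b' - c' - d') - b * d',
    2 * k * k' - k * (b' + c') - k' * (b + c) + (b + c) * (b' + c')
      - (k + k - b - c - d) * (k' + k' - b' - c' - d') - c * b', ?_⟩
  ext <;> simp <;> ring

/-- Two distinct Hurwitz quaternions have distance at least one. -/
theorem one_le_normSq {x : ℍ} (hx : x ∈ hurwitz) (h0 : x ≠ 0) : 1 ≤ normSq x := by
  obtain ⟨m, hm, -⟩ := exists_normSq hx
  have : 0 < normSq x := lt_of_le_of_ne normSq_nonneg (Ne.symm (by simpa using h0))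
  rw [hm] at this ⊢
  have : 0 < m := by exact_mod_cast this
  exact_mod_cast this

theorem inner_units_le_half {u v : ℍ} (hu : u ∈ hurwitz) (hv : v ∈ hurwitz) (h : u ≠ v)
    (nu : normSq u = 1) (nv : normSq v = 1) : inner ℝ u v ≤ 1 / 2 := by
  have := one_le_normSq (hurwitz.sub_mem hu hv) (sub_ne_zero.2 h)
  rw [normSq_coord] at this nu nv
  simp only [re_sub, imI_sub, imJ_sub, imK_sub] at this
  rw [inner_coord]
  nlinarith

theorem finite_hurwitz_ball (C : ℝ) : {x : ℍ | x ∈ hurwitz ∧ ‖x‖ ≤ C}.Finite := by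
  -- Twice the coordinates of a Hurwitz quaternion are integers, here of absolute value at most 2C.
  obtain ⟨N, hN⟩ := exists_nat_ge (2 * C)
  have hf := ((((Finset.Icc (-N : ℤ) N) ×ˢ (Finset.Icc (-N : ℤ) N)) ×ˢ
      ((Finset.Icc (-N : ℤ) N) ×ˢ (Finset.Icc (-N : ℤ) N)) : Finset _)).finite_toSet
  refine (hf.image fun p : (ℤ × ℤ) × (ℤ × ℤ) =>
    mkq (p.1.1 / 2) (p.1.2 / 2) (p.2.1 / 2) (p.2.2 / 2)).subset ?_
  rintro _ ⟨⟨a, b, c, d, rfl⟩, hx⟩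
  set x : ℍ := mkq (a / 2) (a / 2 + b) (a / 2 + c) (a / 2 + d) with hxd
  have h2 : normSq x ≤ C ^ 2 := by
    rw [normSq_eq_sq]
    exact pow_le_pow_left₀ (norm_nonneg _) hx 2
  have hC : 0 ≤ C := (norm_nonneg _).trans hx
  rw [normSq_coord, hxd] at h2
  simp only [re_mkq, imI_mkq, imJ_mkq, imK_mkq] at h2
  have key : ∀ m : ℤ, ((m : ℝ) / 2) ^ 2 ≤ C ^ 2 → m ∈ Finset.Icc (-N : ℤ) N := by
    intro m hm
    have := abs_le_of_sq_le_sq' hm hC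
    rw [Finset.mem_Icc]
    constructor
    · have : (-N : ℝ) ≤ m := by linarith
      exact_mod_cast this
    · have : (m : ℝ) ≤ N := by linarith
      exact_mod_cast this
  refine ⟨((a, a + 2 * b), (a + 2 * c, a + 2 * d)), ?_, ?_⟩
  · simp only [Finset.mem_coe, Finset.mem_product]
    refine ⟨⟨key _ ?_, key _ ?_⟩, key _ ?_, key _ ?_⟩ <;> push_cast <;>
      nlinarith [sq_nonneg ((a : ℝ) / 2), sq_nonneg ((a : ℝ) / 2 + b), sq_nonneg ((a : ℝ) / 2 + c),
        sq_nonneg ((a : ℝ) / 2 + d)]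
  · simp only [hxd]
    ext <;> simp <;> ring

/-! ### The group and its mirrors -/

theorem ω_eq : ω = mkq (-1 / 2) (1 / 2) (1 / 2) (1 / 2) := rfl
theorem ζ_eq : ζ = mkq (1 / 2) (1 / 2) (1 / 2) (1 / 2) := rfl
theorem qi_eq : qi = mkq 0 1 0 0 := rfl

theorem mem_Cω {c : ℍ} : c ∈ Cω ↔ c.imI = c.imJ ∧ c.imJ = c.imK := by
  rw [Cω, Submodule.mem_span_pair]
  constructor
  · rintro ⟨a, b, rfl⟩
    simp [ω_eq]
  · rintro ⟨h₁, h₂⟩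
    refine ⟨c.re + c.imI, 2 * c.imI, ?_⟩
    ext <;> simp [ω_eq] <;> linarith

theorem inner_mul_left (v c d : ℍ) : inner ℝ (v * c) (v * d) = normSq v * inner ℝ c d := by
  rw [inner_coord, inner_coord, normSq_coord]
  simp
  ring

theorem star_mul_self_of_unit {u : ℍ} (hu : normSq u = 1) : star u * u = 1 := by
  rw [star_mul_self, hu]; simp

theorem self_mul_star_of_unit {u : ℍ} (hu : normSq u = 1) : u * star u = 1 := by
  rw [self_mul_star, hu]; simp

/-- The basic quaternion units. -/
def Q4 : Set ℍ := {mkq 1 0 0 0, mkq 0 1 0 0, mkq 0 0 1 0, mkq 0 0 0 1}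

theorem Q4_induction {p : ℍ → Prop} (h0 : p (mkq 1 0 0 0)) (h1 : p (mkq 0 1 0 0))
    (h2 : p (mkq 0 0 1 0)) (h3 : p (mkq 0 0 0 1)) : ∀ u ∈ Q4, p u := by
  rintro u (rfl | rfl | rfl | rfl) <;> assumption

theorem Q4_normSq : ∀ u ∈ Q4, normSq u = 1 := by
  apply Q4_induction <;> simp [normSq_coord]

theorem Q4_hurwitz : ∀ u ∈ Q4, u ∈ hurwitz := by
  apply Q4_induction
  · exact ⟨2, -1, -1, -1, by ext <;> simp⟩
  · exact ⟨0, 1, 0, 0, by ext <;> simp⟩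
  · exact ⟨0, 0, 1, 0, by ext <;> simp⟩
  · exact ⟨0, 0, 0, 1, by ext <;> simp⟩

/-- The mirrors with root `u`, indexed by pairs of integers. -/
def mir (u : ℍ) (m n : ℤ) : Set ℍ :=
  {x | (star u * x).re = m ∧
    (star u * x).re + (star u * x).imI + (star u * x).imJ + (star u * x).imK = 2 * n}

/-- The points on some mirror. -/
def OnMirror (x : ℍ) : Prop := ∃ u ∈ Q4, ∃ m n : ℤ, x ∈ mir u m n

/-- The set of cube roots of unity in `Cω`. -/
def cubeRoots : Set ℍ := {1, ω, star ω}

theorem ω_mem_hurwitz : ω ∈ hurwitz := ⟨-1, 1, 1, 1, by ext <;> norm_num [ω_eq]⟩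

theorem ω_mul_ω : ω * ω = star ω := by ext <;> norm_num [ω_eq]
theorem star_ω_mul : star ω * star ω = ω := by ext <;> norm_num [ω_eq]
theorem normSq_ω : normSq ω = 1 := by norm_num [normSq_coord, ω_eq]
theorem ω_mul_star : ω * star ω = 1 := self_mul_star_of_unit normSq_ω
theorem star_mul_ω : star ω * ω = 1 := star_mul_self_of_unit normSq_ω

theorem cubeRoots_facts {z : ℍ} (hz : z ∈ cubeRoots) :
    z ∈ hurwitz ∧ normSq z = 1 ∧ star z ∈ cubeRoots := by
  rcases hz with rfl | rfl | rfl
  · exact ⟨hurwitz.one_mem, by simp, by simp [cubeRoots]⟩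
  · exact ⟨ω_mem_hurwitz, normSq_ω, by simp [cubeRoots]⟩
  · exact ⟨star_mem_hurwitz ω_mem_hurwitz, by simp [normSq_ω], by simp [cubeRoots]⟩

theorem cubeRoots_mul {z z' : ℍ} (hz : z ∈ cubeRoots) (hz' : z' ∈ cubeRoots) :
    z' * z ∈ cubeRoots ∧ z' * z = z * z' := by
  rcases hz with rfl | rfl | rfl <;> rcases hz' with rfl | rfl | rfl <;>
    simp [cubeRoots, ω_mul_ω, star_ω_mul, ω_mul_star, star_mul_ω]

/-! ### The shape of the group elements and of their fixed sets -/

/-- The form of the elements of the reflection group. -/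
def IsG4Map (g : ℍ → ℍ) : Prop :=
  ∃ q z t : ℍ, q ∈ hurwitz ∧ normSq q = 1 ∧ z ∈ cubeRoots ∧ q - z ∈ D4 ∧ t ∈ hurwitz ∧
    ∀ x, g x = q * x * z + (t + t)

theorem isG4Map_mul {g g' : ℍ ≃ᵢ ℍ} (hg : IsG4Map g) (hg' : IsG4Map g') :
    IsG4Map (g * g' : ℍ ≃ᵢ ℍ) := by
  obtain ⟨q, z, t, hq, nq, hz, hqz, ht, h⟩ := hg
  obtain ⟨q', z', t', hq', nq', hz', hqz', ht', h'⟩ := hg'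
  obtain ⟨hm, hc⟩ := cubeRoots_mul hz hz'
  refine ⟨q * q', z' * z, q * t' * z + t, hurwitz.mul_mem hq hq', by simp [nq, nq'], hm, ?_,
    hurwitz.add_mem (hurwitz.mul_mem (hurwitz.mul_mem hq ht') (cubeRoots_facts hz).1) ht, ?_⟩
  · have : q * q' - z' * z = q * (q' - z') + (q - z) * z' := by
      rw [hc]; noncomm_ring
    rw [this]
    exact D4.add_mem (mul_mem_D4_left hq hqz') (mul_mem_D4_right (cubeRoots_facts hz').1 hqz)
  · intro x
    rw [IsometryEquiv.mul_apply, h', h]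
    noncomm_ring

theorem isG4Map_inv {g : ℍ ≃ᵢ ℍ} (hg : IsG4Map g) : IsG4Map (g⁻¹ : ℍ ≃ᵢ ℍ) := by
  obtain ⟨q, z, t, hq, nq, hz, hqz, ht, h⟩ := hg
  obtain ⟨hzh, nz, hz'⟩ := cubeRoots_facts hz
  refine ⟨star q, star z, -(star q * t * star z), star_mem_hurwitz hq, by simpa using nq, hz',
    ?_, hurwitz.neg_mem (hurwitz.mul_mem (hurwitz.mul_mem (star_mem_hurwitz hq) ht)
      (star_mem_hurwitz hzh)), ?_⟩
  · rw [← star_sub]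
    exact star_mem_D4 hqz
  · intro x
    apply g.injective
    have e : g (g⁻¹ x) = x := IsometryEquiv.apply_inv_self g x
    rw [e, h]
    have e1 := self_mul_star_of_unit nq
    have e2 := star_mul_self_of_unit nz
    have : q * (star q * x * star z + (-(star q * t * star z) + -(star q * t * star z))) * z
        = (q * star q) * x * (star z * z) - (q * star q) * t * (star z * z)
          - (q * star q) * t * (star z * z) := by noncomm_ring
    rw [this, e1, e2]
    simp

theorem isG4Map_of_mem {g : ℍ ≃ᵢ ℍ} (hg : g ∈ reflG4) : IsG4Map g := by
  rw [reflG4] at hg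
  induction hg using Subgroup.closure_induction with
  | mem x hx =>
    rcases hx with rfl | rfl | rfl
    -- Since ζ = -`star ω`, changing the sign of both factors leaves the map unchanged and makes the
    -- right factor a cube root of unity.
    · refine ⟨star ω, star ω, 0, star_mem_hurwitz ω_mem_hurwitz, by simp [normSq_ω],
        by simp [cubeRoots], by simp, hurwitz.zero_mem, fun x => ?_⟩
      change ζ * x * ζ + 0 = _
      ext <;> simp [ζ_eq, ω_eq] <;> ring
    · refine ⟨mkq (-1 / 2) (-1 / 2) (1 / 2) (1 / 2), star ω, 0,
        ⟨-1, 0, 1, 1, by ext <;> norm_num⟩, by norm_num [normSq_coord],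
        by simp [cubeRoots], ⟨0, 0, 1, 1, by ext <;> norm_num [ω_eq], by decide⟩,
        hurwitz.zero_mem, fun x => ?_⟩
      change (-qi * ζ * qi) * x * ζ + 0 = _
      ext <;> simp [ζ_eq, ω_eq, qi_eq] <;> ring
    · refine ⟨star ω, star ω, 1, star_mem_hurwitz ω_mem_hurwitz, by simp [normSq_ω],
        by simp [cubeRoots], by simp, hurwitz.one_mem, fun x => ?_⟩
      change ζ * x * ζ + 2 = _
      rw [← one_add_one_eq_two]
      ext <;> simp [ζ_eq, ω_eq] <;> ring
  | one => exact ⟨1, 1, 0, hurwitz.one_mem, by simp, by simp [cubeRoots], by simp,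
      hurwitz.zero_mem, fun x => by simp⟩
  | mul x y _ _ hx hy => exact isG4Map_mul hx hy
  | inv x _ hx => exact isG4Map_inv hx

/-- The map y ↦ ωyω is multiplication by ω² on `Cω` and the identity on its orthogonal complement,
so the equation restricts y only through its real part and the sum of its imaginary coordinates. -/
theorem rotate_ω_iff (y τ : ℍ) : ω * y * ω + (τ + τ) = y ↔
    4 * τ.re = 3 * y.re - (y.imI + y.imJ + y.imK) ∧
    4 * τ.imI = y.re + (y.imI + y.imJ + y.imK) ∧
    4 * τ.imJ = y.re + (y.imI + y.imJ + y.imK) ∧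
    4 * τ.imK = y.re + (y.imI + y.imJ + y.imK) := by
  rw [Quaternion.ext_iff]
  simp [ω_eq]
  refine and_congr ?_ (and_congr ?_ (and_congr ?_ ?_)) <;> constructor <;> intro h <;> linarith

theorem rotate_star_ω_iff (y τ : ℍ) : star ω * y * star ω + (τ + τ) = y ↔
    4 * τ.re = 3 * y.re + (y.imI + y.imJ + y.imK) ∧
    4 * τ.imI = (y.imI + y.imJ + y.imK) - y.re ∧
    4 * τ.imJ = (y.imI + y.imJ + y.imK) - y.re ∧
    4 * τ.imK = (y.imI + y.imJ + y.imK) - y.re := by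
  rw [Quaternion.ext_iff]
  simp [ω_eq]
  refine and_congr ?_ (and_congr ?_ (and_congr ?_ ?_)) <;> constructor <;> intro h <;> linarith

/-- The fixed set of a rotation of order three, if nonempty, is a mirror. -/
theorem fixed_eq_mir {g : ℍ → ℍ} {u z t p : ℍ} (hu : u ∈ Q4) (hz : z = ω ∨ z = star ω)
    (ht : t ∈ hurwitz) (hg : ∀ x, g x = u * z * star u * x * z + (t + t)) (hp : g p = p) :
    ∃ m n : ℤ, {x | g x = x} = mir u m n := by
  have key : ∀ x, g x = x ↔
      z * (star u * x) * z + (star u * t + star u * t) = star u * x := by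
    intro x
    have e1 := self_mul_star_of_unit (Q4_normSq u hu)
    have e2 := star_mul_self_of_unit (Q4_normSq u hu)
    rw [hg]
    constructor
    · intro h
      conv_rhs => rw [← h]
      have : star u * (u * z * star u * x * z + (t + t)) =
        (star u * u) * (z * (star u * x) * z) + (star u * t + star u * t) := by noncomm_ring
      rw [this, e2, one_mul]
    · intro h
      have := congrArg (u * ·) h
      simp only [mul_add, ← mul_assoc, e1, one_mul] at this
      exact this
  obtain ⟨a, b, c, d, hτ⟩ := hurwitz.mul_mem (star_mem_hurwitz (Q4_hurwitz u hu)) ht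
  have hp' := (key p).1 hp
  rcases hz with rfl | rfl
  · rw [rotate_ω_iff, hτ] at hp'
    simp only [re_mkq, imI_mkq, imJ_mkq, imK_mkq] at hp'
    obtain ⟨h0, h1, h2, h3⟩ := hp'
    -- The first two equations add up to re y = re τ + τ_i = a + b, and the second alone gives the
    -- coordinate sum 4τ_i = 2(a + 2b).
    refine ⟨a + b, a + 2 * b, ?_⟩
    ext x
    rw [Set.mem_ofPred_eq, key, rotate_ω_iff, hτ]
    simp only [re_mkq, imI_mkq, imJ_mkq, imK_mkq, mir, Set.mem_ofPred_eq]
    push_cast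
    constructor
    · rintro ⟨k0, k1, k2, k3⟩
      constructor <;> linarith
    · rintro ⟨k0, k1⟩
      refine ⟨?_, ?_, ?_, ?_⟩ <;> linarith
  · rw [rotate_star_ω_iff, hτ] at hp'
    simp only [re_mkq, imI_mkq, imJ_mkq, imK_mkq] at hp'
    obtain ⟨h0, h1, h2, h3⟩ := hp'
    refine ⟨-b, a + b, ?_⟩
    ext x
    rw [Set.mem_ofPred_eq, key, rotate_star_ω_iff, hτ]
    simp only [re_mkq, imI_mkq, imJ_mkq, imK_mkq, mir, Set.mem_ofPred_eq]
    push_cast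
    constructor
    · rintro ⟨k0, k1, k2, k3⟩
      constructor <;> linarith
    · rintro ⟨k0, k1⟩
      refine ⟨?_, ?_, ?_, ?_⟩ <;> linarith

theorem zero_or_one_of_sum {b c d : ℤ} (h : b * (b - 1) + c * (c - 1) + d * (d - 1) = 0) :
    (b = 0 ∨ b = 1) ∧ (c = 0 ∨ c = 1) ∧ (d = 0 ∨ d = 1) := by
  have key : ∀ m : ℤ, 0 ≤ m * (m - 1) := fun m => by
    rcases le_or_gt m 0 with h | h
    · nlinarith
    · exact mul_nonneg h.le (by omega)
  have hb := key b
  have hc := key c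
  have hd := key d
  have fin : ∀ m : ℤ, m * (m - 1) = 0 → m = 0 ∨ m = 1 := fun m hm => by
    rcases mul_eq_zero.1 hm with h | h <;> omega
  exact ⟨fin b (by linarith), fin c (by linarith), fin d (by linarith)⟩

/-- The Hurwitz units of real part `-1 / 2` in the coset of `ω` or its conjugate. -/
theorem conj_of_re {q z : ℍ} (hq : q ∈ hurwitz) (nq : normSq q = 1) (hz : z = ω ∨ z = star ω)
    (hqz : q - z ∈ D4) (hre : q.re = -1 / 2) : ∃ u ∈ Q4, q = u * z * star u := by
  obtain ⟨a, b, c, d, rfl⟩ := hq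
  simp only [re_mkq] at hre
  obtain rfl : a = -1 := by exact_mod_cast (by linarith : (a : ℝ) = -1)
  rw [normSq_coord] at nq
  simp only [re_mkq, imI_mkq, imJ_mkq, imK_mkq] at nq
  have h : b * (b - 1) + c * (c - 1) + d * (d - 1) = 0 := by
    have : (b * (b - 1) + c * (c - 1) + d * (d - 1) : ℝ) = 0 := by push_cast at nq; linarith
    exact_mod_cast this
  obtain ⟨hb, hc, hd⟩ := zero_or_one_of_sum h
  rcases hz with rfl | rfl
  · have e : mkq ((-1 : ℤ) / 2) ((-1 : ℤ) / 2 + b) ((-1 : ℤ) / 2 + c) ((-1 : ℤ) / 2 + d) - ω =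
        mkq ((0 : ℤ) / 2) ((0 : ℤ) / 2 + (b - 1 : ℤ)) ((0 : ℤ) / 2 + (c - 1 : ℤ))
          ((0 : ℤ) / 2 + (d - 1 : ℤ)) := by
      ext <;> simp [ω_eq] <;> ring
    rw [e, hurwitz_mem_D4] at hqz
    obtain ⟨-, k, hk⟩ := hqz
    -- Eight units have real part -1/2; the coset condition keeps four, which are the conjugates of
    -- ω by 1, i, j, k.
    rcases hb with rfl | rfl <;> rcases hc with rfl | rfl <;> rcases hd with rfl | rfl <;>
      first
      | (exfalso; omega)
      | (refine ⟨mkq 1 0 0 0, by simp [Q4], ?_⟩; ext <;> norm_num [ω_eq]; done)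
      | (refine ⟨mkq 0 1 0 0, by simp [Q4], ?_⟩; ext <;> norm_num [ω_eq]; done)
      | (refine ⟨mkq 0 0 1 0, by simp [Q4], ?_⟩; ext <;> norm_num [ω_eq]; done)
      | (refine ⟨mkq 0 0 0 1, by simp [Q4], ?_⟩; ext <;> norm_num [ω_eq]; done)
  · have e : mkq ((-1 : ℤ) / 2) ((-1 : ℤ) / 2 + b) ((-1 : ℤ) / 2 + c) ((-1 : ℤ) / 2 + d) - star ω =
        mkq ((0 : ℤ) / 2) ((0 : ℤ) / 2 + b) ((0 : ℤ) / 2 + c) ((0 : ℤ) / 2 + d) := by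
      ext <;> simp [ω_eq] <;> ring
    rw [e, hurwitz_mem_D4] at hqz
    obtain ⟨-, k, hk⟩ := hqz
    rcases hb with rfl | rfl <;> rcases hc with rfl | rfl <;> rcases hd with rfl | rfl <;>
      first
      | (exfalso; omega)
      | (refine ⟨mkq 1 0 0 0, by simp [Q4], ?_⟩; ext <;> norm_num [ω_eq]; done)
      | (refine ⟨mkq 0 1 0 0, by simp [Q4], ?_⟩; ext <;> norm_num [ω_eq]; done)
      | (refine ⟨mkq 0 0 1 0, by simp [Q4], ?_⟩; ext <;> norm_num [ω_eq]; done)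
      | (refine ⟨mkq 0 0 0 1, by simp [Q4], ?_⟩; ext <;> norm_num [ω_eq]; done)

/-- A fixed direction w gives q = w z̄ w⁻¹, so q and z have the same real part. If z = 1, the map is
a translation with a fixed point, hence trivial; otherwise the real part is -1/2 and q is a
conjugate of z by one of 1, i, j, k. -/
theorem fixed_reflection_eq_mir {g : ℍ ≃ᵢ ℍ} (hg : g ∈ reflG4) (hr : IsComplexReflection g) :
    ∃ u ∈ Q4, ∃ m n : ℤ, {x | g x = x} = mir u m n := by
  obtain ⟨q, z, t, hq, nq, hz, hqz, ht, h⟩ := isG4Map_of_mem hg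
  obtain ⟨p, v, z', hv, -, -, hz1, -, key⟩ := hr
  rw [← normSq_eq_one_iff] at hv
  have hp : g p = p := by
    simpa using key 0 (zero_mem _) 0 fun c _ => by simp
  have hv0 : v ≠ 0 := by rintro rfl; simp at hv
  -- The quaternion i - j is orthogonal to `Cω`, so w is hermitian-orthogonal to v and is fixed by
  -- the linear part.
  set w : ℍ := v * mkq 0 1 (-1) 0 with hw
  have hw0 : w ≠ 0 := by
    refine mul_ne_zero hv0 fun h => ?_
    have := congrArg QuaternionAlgebra.imI h
    simp [-mul_eq_zero] at this
  have hwg : g (p + w) = p + w := by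
    simpa using key 0 (zero_mem _) w fun c hc => by
      obtain ⟨h1, h2⟩ := mem_Cω.1 hc
      rw [hw, inner_mul_left, inner_coord]
      simp [h1]
  have hqw : q * w * z = w := by
    have e : q * w * z = (q * (p + w) * z + (t + t)) - (q * p * z + (t + t)) := by noncomm_ring
    rw [e, ← h, ← h, hwg, hp]
    abel
  have hre : z ≠ 1 → q.re = z.re := by
    intro _
    have nz := (cubeRoots_facts hz).2.1
    have e1 : q * w = w * star z := by
      have := congrArg (· * star z) hqw
      simpa [mul_assoc, self_mul_star_of_unit nz] using this
    have e2 : (normSq w) * q.re = normSq w * z.re := by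
      have e3 : (q * w * star w).re = (w * star z * star w).re := by rw [e1]
      rw [mul_assoc, self_mul_star] at e3
      have e4 : (w * star z * star w).re = normSq w * z.re := by
        rw [normSq_coord]; simp; ring
      rw [e4] at e3
      simpa [mul_comm] using e3
    exact mul_left_cancel₀ (by simpa using hw0) e2
  rcases eq_or_ne z 1 with rfl | hz1'
  · exfalso
    have hq1 : q = 1 := by
      rw [mul_one] at hqw
      exact mul_right_cancel₀ hw0 (hqw.trans (one_mul w).symm)
    subst hq1
    have ht0 : t + t = 0 := by
      have := h p
      rw [hp] at this
      simpa using this.symm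
    have := key 1 (Submodule.subset_span (by simp)) 0 fun c _ => by simp
    rw [h, ht0] at this
    simp only [one_mul, mul_one, add_zero] at this
    have : v * 1 = v * z' := by simpa using this
    exact hz1 (mul_left_cancel₀ hv0 this).symm
  · have hz2 : z = ω ∨ z = star ω := by
      rcases hz with rfl | rfl | rfl
      · exact absurd rfl hz1'
      · exact Or.inl rfl
      · exact Or.inr rfl
    have hre' : q.re = -1 / 2 := by
      rw [hre hz1']
      rcases hz2 with rfl | rfl <;> simp [ω_eq]
    obtain ⟨u, hu, rfl⟩ := conj_of_re hq nq hz2 hqz hre'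
    obtain ⟨m, n, hmn⟩ := fixed_eq_mir hu hz2 ht h hp
    exact ⟨u, hu, m, n, hmn⟩

/-! ### Every candidate mirror is realised -/

theorem r₁_apply (x : ℍ) : r₁ x = ζ * x * ζ + 0 := rfl
theorem rᵢ_apply (x : ℍ) : rᵢ x = (-qi * ζ * qi) * x * ζ + 0 := rfl
theorem r₁'_apply (x : ℍ) : r₁' x = ζ * x * ζ + 2 := rfl

theorem r₁_inv_apply (x : ℍ) : r₁⁻¹ x = star ζ * x * star ζ := by
  apply r₁.injective
  have e : r₁ (r₁⁻¹ x) = x := IsometryEquiv.apply_inv_self r₁ x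
  rw [e, r₁_apply]
  have nz : normSq ζ = 1 := by norm_num [normSq_coord, ζ_eq]
  have : ζ * (star ζ * x * star ζ) * ζ + 0 = (ζ * star ζ) * x * (star ζ * ζ) := by noncomm_ring
  rw [this, self_mul_star_of_unit nz, star_mul_self_of_unit nz]
  simp

/-- The vectors by which the group contains a translation. -/
def translations : AddSubgroup ℍ where
  carrier := {v | ∃ g ∈ reflG4, ∀ x, g x = x + v}
  zero_mem' := ⟨1, one_mem _, fun x => by simp⟩
  add_mem' := by
    rintro v w ⟨g, hg, h⟩ ⟨g', hg', h'⟩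
    exact ⟨g * g', mul_mem hg hg', fun x => by
      rw [IsometryEquiv.mul_apply, h', h]; abel⟩
  neg_mem' := by
    rintro v ⟨g, hg, h⟩
    refine ⟨g⁻¹, inv_mem hg, fun x => ?_⟩
    apply g.injective
    have e : g (g⁻¹ x) = x := IsometryEquiv.apply_inv_self g x
    rw [e, h]
    abel

/-- The vector is 2a + 2bω: `r₁'` and `r₁` differ by the translation by 2, which `r₁` conjugates to
the one by 2ζ² = 2ω. -/
theorem translation_mem (a b : ℤ) : mkq (2 * a - b) b b b ∈ translations := by
  have h1 : r₁ ∈ reflG4 := Subgroup.subset_closure (by simp)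
  have h3 : r₁' ∈ reflG4 := Subgroup.subset_closure (by simp)
  have two : (2 : ℍ) ∈ translations := by
    refine ⟨r₁' * r₁⁻¹, mul_mem h3 (inv_mem h1), fun x => ?_⟩
    have e : r₁ (r₁⁻¹ x) = x := IsometryEquiv.apply_inv_self r₁ x
    rw [IsometryEquiv.mul_apply, r₁'_apply]
    rw [r₁_apply, add_zero] at e
    rw [e]
  have twoω : ζ * 2 * ζ ∈ translations := by
    obtain ⟨g, hg, h⟩ := two
    refine ⟨r₁ * g * r₁⁻¹, mul_mem (mul_mem h1 hg) (inv_mem h1), fun x => ?_⟩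
    have e : r₁ (r₁⁻¹ x) = x := IsometryEquiv.apply_inv_self r₁ x
    rw [IsometryEquiv.mul_apply, IsometryEquiv.mul_apply, h, r₁_apply]
    rw [r₁_apply, add_zero] at e
    rw [mul_add, add_mul, e, add_zero]
  have := translations.add_mem (translations.zsmul_mem two a) (translations.zsmul_mem twoω b)
  convert this using 1
  rw [← one_add_one_eq_two (R := ℍ)]
  ext <;> simp [ζ_eq] <;> ring

/-- In `r₁⁻¹ * rᵢ` the right factors cancel, which leaves left multiplication by -j. Conjugation by
`r₁` then permutes j, k, i cyclically. -/
theorem left_mul_mem : ∀ u ∈ Q4, ∃ g ∈ reflG4, ∀ x, g x = u * x := by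
  have h1 : r₁ ∈ reflG4 := Subgroup.subset_closure (by simp)
  have h2 : rᵢ ∈ reflG4 := Subgroup.subset_closure (by simp)
  have hJ : ∃ g ∈ reflG4, ∀ x, g x = mkq 0 0 (-1) 0 * x := by
    refine ⟨r₁⁻¹ * rᵢ, mul_mem (inv_mem h1) h2, fun x => ?_⟩
    rw [IsometryEquiv.mul_apply, r₁_inv_apply, rᵢ_apply]
    ext <;> simp [ζ_eq, qi_eq] <;> ring
  have conj : ∀ q, (∃ g ∈ reflG4, ∀ x, g x = q * x) →
      ∃ g ∈ reflG4, ∀ x, g x = (ζ * q * star ζ) * x := by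
    rintro q ⟨g, hg, h⟩
    refine ⟨r₁ * g * r₁⁻¹, mul_mem (mul_mem h1 hg) (inv_mem h1), fun x => ?_⟩
    rw [IsometryEquiv.mul_apply, IsometryEquiv.mul_apply, h, r₁_inv_apply, r₁_apply, add_zero]
    have nz : normSq ζ = 1 := by norm_num [normSq_coord, ζ_eq]
    have : ζ * (q * (star ζ * x * star ζ)) * ζ = (ζ * q * star ζ) * x * (star ζ * ζ) := by
      noncomm_ring
    rw [this, star_mul_self_of_unit nz, mul_one]
  have neg : ∀ q, (∃ g ∈ reflG4, ∀ x, g x = q * x) → q * q = -1 →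
      ∃ g ∈ reflG4, ∀ x, g x = -q * x := by
    rintro q ⟨g, hg, h⟩ hq
    refine ⟨g * g * g, mul_mem (mul_mem hg hg) hg, fun x => ?_⟩
    rw [IsometryEquiv.mul_apply, IsometryEquiv.mul_apply, h, h, h, ← mul_assoc, ← mul_assoc, hq]
    noncomm_ring
  have hJ' := neg _ hJ (by ext <;> simp)
  have hK' := conj _ hJ'
  have hI' := conj _ hK'
  apply Q4_induction
  · refine ⟨1, one_mem _, fun x => ?_⟩
    have : mkq 1 0 0 0 = 1 := by ext <;> simp
    rw [this]
    simp
  · convert hI' using 6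
    ext <;> norm_num [ζ_eq]
  · convert hJ' using 6
    ext <;> simp
  · convert hK' using 6
    ext <;> norm_num [ζ_eq]

theorem mir_mem_hyperplanes {u : ℍ} (hu : u ∈ Q4) (m n : ℤ) : mir u m n ∈ hyperplanes reflG4 := by
  obtain ⟨l, hl, hlx⟩ := left_mul_mem u hu
  obtain ⟨τ, hτ, hτx⟩ := translation_mem n (n - m)
  have h1 : r₁ ∈ reflG4 := Subgroup.subset_closure (by simp)
  have e1 := self_mul_star_of_unit (Q4_normSq u hu)
  have e2 := star_mul_self_of_unit (Q4_normSq u hu)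
  have hli : ∀ x, l⁻¹ x = star u * x := by
    intro x
    apply l.injective
    have e : l (l⁻¹ x) = x := IsometryEquiv.apply_inv_self l x
    rw [e, hlx, ← mul_assoc, e1, one_mul]
  have hg : ∀ x, (l * τ * r₁ * l⁻¹ : ℍ ≃ᵢ ℍ) x =
      u * (ζ * (star u * x) * ζ + mkq (2 * n - (n - m : ℤ)) (n - m : ℤ) (n - m : ℤ) (n - m : ℤ)) := by
    intro x
    rw [IsometryEquiv.mul_apply, IsometryEquiv.mul_apply, IsometryEquiv.mul_apply, hli, r₁_apply,
      hτx, hlx, add_zero]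
  refine ⟨l * τ * r₁ * l⁻¹, mul_mem (mul_mem (mul_mem hl hτ) h1) (inv_mem hl), ?_, ?_⟩
  -- The centre is u p with p the point of `Cω` of real part m and coordinate sum 2n; the
  -- translation used is by (1 - ω)p = 2n + 2(n - m)ω, which moves the fixed point of `r₁` in `Cω`
  -- to p.
  · refine ⟨u * mkq m ((2 * n - m) / 3) ((2 * n - m) / 3) ((2 * n - m) / 3), u, ω,
      (normSq_eq_one_iff u).1 (Q4_normSq u hu), mem_Cω.2 (by simp [ω_eq]),
      (normSq_eq_one_iff ω).1 normSq_ω, ?_, ⟨3, by norm_num, ?_⟩, ?_⟩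
    · intro h
      have := congrArg QuaternionAlgebra.imI h
      simp [ω_eq] at this
    · rw [pow_succ, pow_two, ω_mul_ω, star_mul_ω]
    · intro c hc w hw
      obtain ⟨y, rfl⟩ : ∃ y, w = u * y := ⟨star u * w, by rw [← mul_assoc, e1, one_mul]⟩
      have hw1 := hw 1 (mem_Cω.2 (by simp))
      have hw2 := hw ω (mem_Cω.2 (by simp [ω_eq]))
      rw [inner_mul_left, Q4_normSq u hu, inner_coord] at hw1 hw2
      simp [ω_eq] at hw1 hw2
      obtain ⟨c1, c2⟩ := mem_Cω.1 hc
      rw [hg]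
      have : star u * (u * mkq m ((2 * n - m) / 3) ((2 * n - m) / 3) ((2 * n - m) / 3)
          + (u * c + u * y)) = mkq m ((2 * n - m) / 3) ((2 * n - m) / 3) ((2 * n - m) / 3)
            + (c + y) := by
        rw [← mul_add, ← mul_add, ← mul_assoc, e2, one_mul]
      rw [this, ← mul_add, ← mul_add]
      congr 1
      ext <;> simp [ζ_eq, ω_eq, c1, c2, hw1] <;> linarith
  · ext x
    have : (l * τ * r₁ * l⁻¹ : ℍ ≃ᵢ ℍ) x = x ↔ ζ * (star u * x) * ζ +
        mkq (2 * n - (n - m : ℤ)) (n - m : ℤ) (n - m : ℤ) (n - m : ℤ) = star u * x := by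
      rw [hg]
      constructor
      · intro h
        have := congrArg (star u * ·) h
        simpa only [← mul_assoc, e2, one_mul] using this
      · intro h
        rw [h, ← mul_assoc, e1, one_mul]
    rw [Set.mem_ofPred_eq, this, mir, Set.mem_ofPred_eq, Quaternion.ext_iff]
    generalize star u * x = y
    simp [ζ_eq]
    constructor
    · rintro ⟨k0, k1⟩
      refine ⟨?_, ?_, ?_, ?_⟩ <;> linarith
    · rintro ⟨k0, k1, k2, k3⟩
      constructor <;> linarith

theorem mem_hyperplanes {H : Set ℍ} :
    H ∈ hyperplanes reflG4 ↔ ∃ u ∈ Q4, ∃ m n : ℤ, H = mir u m n := by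
  constructor
  · rintro ⟨g, hg, hr, rfl⟩
    exact fixed_reflection_eq_mir hg hr
  · rintro ⟨u, hu, m, n, rfl⟩
    exact mir_mem_hyperplanes hu m n

theorem mem_complement {x : ℍ} : x ∈ hyperplaneComplement reflG4 ↔ ¬ OnMirror x := by
  rw [hyperplaneComplement, Set.mem_compl_iff, Set.mem_sUnion, OnMirror]
  refine not_congr ⟨?_, ?_⟩
  · rintro ⟨H, hH, hx⟩
    obtain ⟨u, hu, m, n, rfl⟩ := mem_hyperplanes.1 hH
    exact ⟨u, hu, m, n, hx⟩
  · rintro ⟨u, hu, m, n, hx⟩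
    exact ⟨_, mir_mem_hyperplanes hu m n, hx⟩

/-! ### Intersections of mirrors -/

theorem D4_mem_mir {x : ℍ} (hx : x ∈ D4) : ∀ u ∈ Q4, ∃ m n : ℤ, x ∈ mir u m n := by
  intro u hu
  obtain ⟨a, b, c, d, h, k, hk⟩ := mul_mem_D4_left (star_mem_hurwitz (Q4_hurwitz u hu)) hx
  have hk' := congrArg (Int.cast : ℤ → ℝ) hk
  push_cast at hk'
  refine ⟨a, k, ?_⟩
  rw [mir, Set.mem_ofPred_eq, h]
  simp only [re_mkq, imI_mkq, imJ_mkq, imK_mkq, true_and]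
  linarith

/-- Two mirrors from different families give four independent real equations; for each of the six
pairs of roots the solution is integral with even coordinate sum. -/
theorem mem_D4_of_two_mirs {x u u' : ℍ} (hu : u ∈ Q4) (hu' : u' ∈ Q4) (huu : u ≠ u')
    {m n m' n' : ℤ} (h : x ∈ mir u m n) (h' : x ∈ mir u' m' n') : x ∈ D4 := by
  have build : ∀ a b c d k : ℤ, x.re = a → x.imI = b → x.imJ = c → x.imK = d →
      a + b + c + d = k + k → x ∈ D4 := fun a b c d k ha hb hc hd hk =>
    ⟨a, b, c, d, by ext <;> simp [ha, hb, hc, hd], k, hk⟩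
  have cases : ∀ m n m' n' : ℤ, ∀ p q r s : ℍ, p = mkq 1 0 0 0 → q = mkq 0 1 0 0 →
      r = mkq 0 0 1 0 → s = mkq 0 0 0 1 →
      (x ∈ mir p m n → x ∈ mir q m' n' → x ∈ D4) ∧ (x ∈ mir p m n → x ∈ mir r m' n' → x ∈ D4) ∧
      (x ∈ mir p m n → x ∈ mir s m' n' → x ∈ D4) ∧ (x ∈ mir q m n → x ∈ mir r m' n' → x ∈ D4) ∧
      (x ∈ mir q m n → x ∈ mir s m' n' → x ∈ D4) ∧
      (x ∈ mir r m n → x ∈ mir s m' n' → x ∈ D4) := by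
    rintro m n m' n' p q r s rfl rfl rfl rfl
    simp only [mir, Set.mem_ofPred_eq]
    refine ⟨?_, ?_, ?_, ?_, ?_, ?_⟩ <;> rintro ⟨h1, h2⟩ ⟨h1', h2'⟩ <;> simp at h1 h2 h1' h2'
    · apply build m m' (n - m - n') (n + n' - m') n <;> push_cast <;> linarith
    · apply build m (n + n' - m') m' (n - n' - m) n <;> push_cast <;> linarith
    · apply build m (n - n' - m) (n + n' - m') m' n <;> push_cast <;> linarith
    · apply build (m - n - n') m m' (m' + n - n') (m + m' - n') <;> push_cast <;> linarith
    · apply build (m' - n - n') m (m - n + n') m' (m + m' - n) <;> push_cast <;> linarith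
    · apply build (m - n - n') (m' + n - n') m m' (m + m' - n') <;> push_cast <;> linarith
  obtain ⟨c1, c2, c3, c4, c5, c6⟩ := cases m n m' n' _ _ _ _ rfl rfl rfl rfl
  obtain ⟨d1, d2, d3, d4, d5, d6⟩ := cases m' n' m n _ _ _ _ rfl rfl rfl rfl
  rcases hu with rfl | rfl | rfl | rfl <;> rcases hu' with rfl | rfl | rfl | rfl <;>
    first
    | exact absurd rfl huu
    | exact c1 h h'
    | exact c2 h h'
    | exact c3 h h'
    | exact c4 h h'
    | exact c5 h h'
    | exact c6 h h'
    | exact d1 h' h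
    | exact d2 h' h
    | exact d3 h' h
    | exact d4 h' h
    | exact d5 h' h
    | exact d6 h' h

/-- The zero-dimensional intersections of mirrors are the points of the lattice `D4`. -/
theorem zeroDimIntersections_eq : zeroDimIntersections reflG4 = (D4 : Set ℍ) := by
  ext p
  constructor
  · rintro ⟨A, hA, hp⟩
    have hpA : ∀ H ∈ A, p ∈ H := fun H hH =>
      Set.mem_sInter.1 (hp ▸ Set.mem_singleton p : p ∈ ⋂₀ A) H hH
    by_contra hD
    have hall : ∀ u ∈ Q4, ∀ m n, mir u m n ∈ A → ∀ H ∈ A, H = mir u m n := by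
      intro u hu m n hH H' hH'
      obtain ⟨u', hu', m', n', rfl⟩ := mem_hyperplanes.1 (hA hH')
      have h := hpA _ hH
      have h' := hpA _ hH'
      by_cases huu : u = u'
      · subst huu
        obtain ⟨h1, h2⟩ := h
        obtain ⟨h1', h2'⟩ := h'
        have e1 : m = m' := by exact_mod_cast h1.symm.trans h1'
        have e2 : n = n' := by
          have := h2.symm.trans h2'
          exact_mod_cast (by linarith : (n : ℝ) = n')
        rw [e1, e2]
      · exact absurd (mem_D4_of_two_mirs hu hu' huu h h') hD
    -- Off `D4` all members of A are one and the same mirror, and u(i - j) is a direction along it;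
    -- an empty family intersects in the whole space.
    have hw : ∃ q ≠ p, q ∈ ⋂₀ A := by
      rcases A.eq_empty_or_nonempty with rfl | ⟨H, hH⟩
      · exact ⟨p + 1, by simp, by simp⟩
      · obtain ⟨u, hu, m, n, rfl⟩ := mem_hyperplanes.1 (hA hH)
        have e2 := star_mul_self_of_unit (Q4_normSq u hu)
        have hu0 : u ≠ 0 := by
          rintro rfl
          simpa using Q4_normSq 0 hu
        refine ⟨p + u * mkq 0 1 (-1) 0, ?_, ?_⟩
        · intro h
          have : u * mkq 0 1 (-1) 0 = 0 := by simpa using h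
          rcases mul_eq_zero.1 this with h | h
          · exact hu0 h
          · have := congrArg QuaternionAlgebra.imI h
            simp [-mul_eq_zero] at this
        · intro H' hH'
          rw [hall u hu m n hH H' hH', mir, Set.mem_ofPred_eq, mul_add, ← mul_assoc, e2, one_mul]
          obtain ⟨h1, h2⟩ := hpA _ hH
          simp only [re_add, imI_add, imJ_add, imK_add, re_mkq, imI_mkq, imJ_mkq, imK_mkq]
          constructor <;> linarith
    obtain ⟨q, hqp, hq⟩ := hw
    rw [hp] at hq
    exact hqp hq
  · intro hpD
    refine ⟨{H | H ∈ hyperplanes reflG4 ∧ p ∈ H}, fun H h => h.1, ?_⟩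
    ext q
    simp only [Set.mem_sInter, Set.mem_singleton_iff]
    constructor
    · intro h
      have mem : ∀ u ∈ Q4, ∃ m n : ℤ, p ∈ mir u m n ∧ q ∈ mir u m n := by
        intro u hu
        obtain ⟨m, n, hmn⟩ := D4_mem_mir hpD u hu
        exact ⟨m, n, hmn, h _ ⟨mir_mem_hyperplanes hu m n, hmn⟩⟩
      have key : ∀ u ∈ Q4, (star u * q).re = (star u * p).re := fun u hu => by
        obtain ⟨m, n, h1, h2⟩ := mem u hu
        exact h2.1.trans h1.1.symm
      have k0 := key (mkq 1 0 0 0) (by simp [Q4])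
      have k1 := key (mkq 0 1 0 0) (by simp [Q4])
      have k2 := key (mkq 0 0 1 0) (by simp [Q4])
      have k3 := key (mkq 0 0 0 1) (by simp [Q4])
      simp at k0 k1 k2 k3
      ext <;> assumption
    · rintro rfl H hH
      exact hH.2

/-! ### Exposed faces of convex hulls of finite sets -/

section Hull

variable {E : Type*} [NormedAddCommGroup E] [InnerProductSpace ℝ E]

/-- A point with positive weight in a convex combination lying in an exposed face of `P`
belongs to that face. -/
theorem mem_face_of_combination {P F : Set E} (hF : IsFace P F) {ι : Type*} (T : Finset ι)
    (c : ι → ℝ) (b : ι → E) (h0 : ∀ i ∈ T, 0 ≤ c i) (h1 : ∑ i ∈ T, c i = 1)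
    (hb : ∀ i ∈ T, 0 < c i → b i ∈ P) (hx : ∑ i ∈ T, c i • b i ∈ F) {j : ι} (hj : j ∈ T)
    (hcj : 0 < c j) : b j ∈ F := by
  obtain ⟨l, hl⟩ := hF.2 hF.1
  rw [hl] at hx ⊢
  obtain ⟨-, hmax⟩ := hx
  set x := ∑ i ∈ T, c i • b i with hxd
  have hlx : l x = ∑ i ∈ T, c i * l (b i) := by
    rw [hxd, map_sum]
    simp
  have hle : ∀ i ∈ T, c i * l (b i) ≤ c i * l x := by
    intro i hi
    rcases (h0 i hi).eq_or_lt with h | h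
    · simp [← h]
    · exact mul_le_mul_of_nonneg_left (hmax _ (hb i hi h)) h.le
  have hsum : ∑ i ∈ T, c i * l (b i) = ∑ i ∈ T, c i * l x := by
    rw [← hlx, ← Finset.sum_mul, h1, one_mul]
  have heq := (Finset.sum_eq_sum_iff_of_le hle).1 hsum j hj
  have : l (b j) = l x := mul_left_cancel₀ hcj.ne' heq
  exact ⟨hb j hj hcj, fun y hy => this ▸ hmax y hy⟩

-- In a convex combination lying in the face, positive weight falls only on vertices that lie in the
-- face.
open Classical in
theorem face_hull_eq {W : Finset E} {F : Set E} (hF : IsFace (convexHull ℝ (W : Set E)) F) :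
    F = convexHull ℝ ((W.filter (· ∈ F) : Finset E) : Set E) := by
  apply Set.Subset.antisymm
  · intro x hx
    obtain ⟨c, h0, h1, hs⟩ := Finset.mem_convexHull'.1 (hF.2.subset hx)
    rw [← hs] at hx
    refine Finset.mem_convexHull'.2 ⟨c, fun y hy => h0 y (Finset.mem_filter.1 hy).1, ?_, ?_⟩
    · rw [← h1]
      refine Finset.sum_subset (Finset.filter_subset _ _) fun y hy hy' => ?_
      by_contra hne
      exact hy' (Finset.mem_filter.2 ⟨hy, mem_face_of_combination hF W c id h0 h1
        (fun i hi _ => subset_convexHull ℝ _ hi) hx hy (lt_of_le_of_ne (h0 y hy) (Ne.symm hne))⟩)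
    · rw [← hs]
      refine Finset.sum_subset (Finset.filter_subset _ _) fun y hy hy' => ?_
      by_cases hne : c y = 0
      · simp [hne]
      · exact absurd (Finset.mem_filter.2 ⟨hy, mem_face_of_combination hF W c id h0 h1
          (fun i hi _ => subset_convexHull ℝ _ hi) hx hy
          (lt_of_le_of_ne (h0 y hy) (Ne.symm hne))⟩) hy'
  · refine convexHull_min (fun y hy => (Finset.mem_filter.1 hy).2) ?_
    exact hF.2.convex (convex_convexHull ℝ _)

theorem isFace_hull {W A : Finset E} (hA : A ⊆ W) (hne : A.Nonempty) (l : E →L[ℝ] ℝ) (M : ℝ)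
    (h1 : ∀ a ∈ A, l a = M) (h2 : ∀ w ∈ W, w ∉ A → l w < M) :
    IsFace (convexHull ℝ (W : Set E)) (convexHull ℝ (A : Set E)) := by
  have hAM : ∀ x ∈ convexHull ℝ (A : Set E), l x = M := fun x hx =>
    convexHull_min (t := {x | l x = M}) h1 (convex_hyperplane l.toLinearMap.isLinear M) hx
  have hWM : ∀ x ∈ convexHull ℝ (W : Set E), l x ≤ M := fun x hx =>
    convexHull_min (t := {x | l x ≤ M}) (fun w hw => by
      by_cases h : w ∈ A
      · exact (h1 w h).le
      · exact (h2 w hw h).le) (convex_halfSpace_le l.toLinearMap.isLinear M) hx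
  obtain ⟨a, ha⟩ := hne
  refine ⟨⟨a, subset_convexHull ℝ _ ha⟩, fun _ => ⟨l, ?_⟩⟩
  ext x
  constructor
  · intro hx
    exact ⟨convexHull_mono (by exact_mod_cast hA) hx, fun y hy => by
      rw [hAM x hx]; exact hWM y hy⟩
  · rintro ⟨hx, hmax⟩
    obtain ⟨c, h0, hc1, hs⟩ := Finset.mem_convexHull'.1 hx
    have hlx : ∑ w ∈ W, c w * l w = l x := by
      rw [← hs, map_sum]
      simp
    have hMx : M ≤ l x := by
      rw [← h1 a ha]
      exact hmax a (subset_convexHull ℝ _ (hA ha))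
    have hle : ∀ w ∈ W, c w * l w ≤ c w * M := fun w hw =>
      mul_le_mul_of_nonneg_left (hWM w (subset_convexHull ℝ _ hw)) (h0 w hw)
    have hsum : ∑ w ∈ W, c w * l w = ∑ w ∈ W, c w * M := by
      rw [hlx, ← Finset.sum_mul, hc1, one_mul]
      exact le_antisymm (hWM x hx) hMx
    have hz : ∀ w ∈ W, w ∉ A → c w = 0 := by
      intro w hw hwA
      have := (Finset.sum_eq_sum_iff_of_le hle).1 hsum w hw
      by_contra hne
      exact (h2 w hw hwA).ne (mul_left_cancel₀ hne this)
    refine Finset.mem_convexHull'.2 ⟨c, fun y hy => h0 y (hA hy), ?_, ?_⟩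
    · rw [← hc1]
      exact Finset.sum_subset hA hz
    · rw [← hs]
      exact Finset.sum_subset hA fun w hw hwA => by simp [hz w hw hwA]

end Hull

/-! ### The pyramids subdividing the Voronoi cells -/

/-- The units of the Hurwitz quaternions. -/
def units : Set ℍ := {u | u ∈ hurwitz ∧ normSq u = 1}

/-- The minimal vectors of the lattice `D4`. -/
def roots : Set ℍ := {t | t ∈ D4 ∧ normSq t = 2}

theorem finite_units : units.Finite := by
  refine (finite_hurwitz_ball 1).subset fun u hu => ⟨hu.1, ?_⟩
  rw [(normSq_eq_one_iff u).1 hu.2]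

theorem finite_roots : roots.Finite := by
  refine (finite_hurwitz_ball 2).subset fun t ht => ⟨D4_subset ht.1, ?_⟩
  have := ht.2
  rw [normSq_eq_sq] at this
  nlinarith [norm_nonneg t]

theorem star_mul_self_of_root {t : ℍ} (ht : t ∈ roots) : star t * t = 2 := by
  rw [star_mul_self, ht.2]; rfl

theorem self_mul_star_of_root {t : ℍ} (ht : t ∈ roots) : t * star t = 2 := by
  rw [self_mul_star, ht.2]; rfl

/-- The coordinates of `x` with respect to the origin `s` and the root `t`. -/
def coord (s t x : ℍ) : ℍ := (1 / 2 : ℝ) • (star t * (x - s))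

theorem two_eq_smul : (2 : ℍ) = (2 : ℝ) • (1 : ℍ) := by
  rw [two_smul, one_add_one_eq_two]

theorem coord_add_mul {t : ℍ} (ht : t ∈ roots) (s z : ℍ) : coord s t (s + t * z) = z := by
  rw [coord, add_sub_cancel_left, ← mul_assoc, star_mul_self_of_root ht, two_eq_smul,
    smul_mul_assoc, one_mul, smul_smul]
  norm_num

theorem add_mul_coord {t : ℍ} (ht : t ∈ roots) (s x : ℍ) : s + t * coord s t x = x := by
  rw [coord, mul_smul_comm, ← mul_assoc, self_mul_star_of_root ht, two_eq_smul,
    smul_mul_assoc, one_mul, smul_smul]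
  norm_num

theorem coord_mem_hurwitz {s t q : ℍ} (hs : s ∈ D4) (ht : t ∈ roots) (hq : q ∈ D4) :
    coord s t q ∈ hurwitz :=
  half_mul_mem_hurwitz (star_mem_D4 ht.1) (D4.sub_mem hq hs)

/-- The sum of the absolute values of the imaginary coordinates. -/
def im1 (z : ℍ) : ℝ := |z.imI| + |z.imJ| + |z.imK|

theorem im1_nonneg (z : ℍ) : 0 ≤ im1 z := by
  unfold im1; positivity

/-- The pyramid over a facet of the Voronoi cell around `s`, in the direction of the root `t`. -/
def pyr (s t : ℍ) : Set ℍ := {x | im1 (coord s t x) ≤ (coord s t x).re ∧ (coord s t x).re ≤ 1 / 2}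

theorem normSq_sub_coord {t : ℍ} (ht : t ∈ roots) (s x q : ℍ) :
    normSq (x - q) = 2 * normSq (coord s t x - coord s t q) := by
  have : x - q = t * (coord s t x - coord s t q) := by
    rw [mul_sub]
    conv_lhs => rw [← add_mul_coord ht s x, ← add_mul_coord ht s q]
    abel
  rw [this, map_mul, ht.2]

/-- The distance from a point of a pyramid to the lattice points other than the two closest. -/
theorem dist_estimate {z η : ℍ} (hη : η ∈ hurwitz) (h0 : η ≠ 0) (h1 : η ≠ 1)
    (hz : im1 z ≤ z.re) (hz' : z.re ≤ 1 / 2) :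
    1 - z.re - im1 z ≤ normSq η - 2 * inner ℝ z η := by
  have n1 := one_le_normSq hη h0
  have n2 := one_le_normSq (hurwitz.sub_mem hη hurwitz.one_mem) (sub_ne_zero.2 h1)
  -- Write z as re z - im1 z times 1 plus |z_i|(1 ± i), |z_j|(1 ± j) and |z_k|(1 ± k). Then ⟨1, η⟩ ≤
  -- N(η) - 1/2 and ⟨p, η⟩ ≤ N(η) for the norm 2 vectors p, because distinct Hurwitz quaternions are
  -- at distance at least one. The claim follows by adding up and using N(η) ≥ 1 and re z ≤ 1/2.
  have hb : 1 / 2 ≤ normSq η - η.re := by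
    rw [normSq_coord] at n1 n2 ⊢
    simp at n2
    nlinarith
  have hc : ∀ p ∈ D4, normSq p = 2 → 0 ≤ normSq η - inner ℝ p η := by
    intro p hp np
    have e : normSq (η - p) = normSq η - 2 * inner ℝ p η + normSq p := by
      rw [normSq_coord, normSq_coord, normSq_coord, inner_coord]
      simp only [re_sub, imI_sub, imJ_sub, imK_sub]
      ring
    rw [np] at e
    by_cases hηp : η = p
    · subst hηp
      rw [inner_coord]
      rw [normSq_coord] at np ⊢
      linarith
    · have n3 := one_le_normSq (hurwitz.sub_mem hη (D4_subset hp)) (sub_ne_zero.2 hηp)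
      linarith
  have hi1 := hc (mkq 1 1 0 0) ⟨1, 1, 0, 0, by ext <;> simp, by decide⟩
    (by norm_num [normSq_coord])
  have hi2 := hc (mkq 1 (-1) 0 0) ⟨1, -1, 0, 0, by ext <;> simp, by decide⟩
    (by norm_num [normSq_coord])
  have hj1 := hc (mkq 1 0 1 0) ⟨1, 0, 1, 0, by ext <;> simp, by decide⟩
    (by norm_num [normSq_coord])
  have hj2 := hc (mkq 1 0 (-1) 0) ⟨1, 0, -1, 0, by ext <;> simp, by decide⟩
    (by norm_num [normSq_coord])
  have hk1 := hc (mkq 1 0 0 1) ⟨1, 0, 0, 1, by ext <;> simp, by decide⟩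
    (by norm_num [normSq_coord])
  have hk2 := hc (mkq 1 0 0 (-1)) ⟨1, 0, 0, -1, by ext <;> simp, by decide⟩
    (by norm_num [normSq_coord])
  rw [inner_coord] at hi1 hi2 hj1 hj2 hk1 hk2
  simp only [re_mkq, imI_mkq, imJ_mkq, imK_mkq] at hi1 hi2 hj1 hj2 hk1 hk2
  have key : ∀ m w : ℝ, 0 ≤ normSq η - (1 * η.re + m) → 0 ≤ normSq η - (1 * η.re - m) →
      0 ≤ |w| * (normSq η - η.re) - w * m := by
    intro m w h h'
    rcases le_total 0 w with hw | hw
    · rw [abs_of_nonneg hw]; nlinarith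
    · rw [abs_of_nonpos hw]; nlinarith
  have kI := key η.imI z.imI (by linarith) (by linarith)
  have kJ := key η.imJ z.imJ (by linarith) (by linarith)
  have kK := key η.imK z.imK (by linarith) (by linarith)
  rw [inner_coord]
  unfold im1 at *
  nlinarith [mul_nonneg (sub_nonneg.2 hz') (sub_nonneg.2 n1), mul_nonneg (sub_nonneg.2 hz)
    (sub_nonneg.2 hb)]

theorem inner_one_right (z : ℍ) : inner ℝ z (1 : ℍ) = z.re := by
  rw [inner_coord]; simp

theorem normSq_sub_sub {s t : ℍ} (ht : t ∈ roots) (x q : ℍ) :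
    normSq (x - q) - normSq (x - s) =
      2 * (normSq (coord s t q) - 2 * inner ℝ (coord s t x) (coord s t q)) := by
  have hs0 : coord s t s = 0 := by simp [coord]
  rw [normSq_sub_coord ht s x q, normSq_sub_coord ht s x s, hs0, sub_zero, normSq_coord,
    normSq_coord, normSq_coord, inner_coord]
  simp only [re_sub, imI_sub, imJ_sub, imK_sub]
  ring

theorem coord_eq_zero_iff {s t q : ℍ} (ht : t ∈ roots) : coord s t q = 0 ↔ q = s := by
  constructor
  · intro h
    rw [← add_mul_coord ht s q, h, mul_zero, add_zero]
  · rintro rfl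
    simp [coord]

theorem coord_eq_one_iff {s t q : ℍ} (ht : t ∈ roots) : coord s t q = 1 ↔ q = s + t := by
  constructor
  · intro h
    rw [← add_mul_coord ht s q, h, mul_one]
  · rintro rfl
    simpa using coord_add_mul ht s 1

/-- On the pyramid the lower bound is nonnegative and vanishes only for re = im1 = 1/2, on the
boundary of the base. Equality is what locates the overlaps of pyramids in `retr_eq`. -/
theorem normSq_far {s t x q : ℍ} (hs : s ∈ D4) (ht : t ∈ roots) (hx : x ∈ pyr s t) (hq : q ∈ D4)
    (h0 : q ≠ s) (h1 : q ≠ s + t) :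
    2 - 2 * (coord s t x).re - 2 * im1 (coord s t x) ≤ normSq (x - q) - normSq (x - s) := by
  have := dist_estimate (coord_mem_hurwitz hs ht hq) (mt (coord_eq_zero_iff ht).1 h0)
    (mt (coord_eq_one_iff ht).1 h1) hx.1 hx.2
  rw [normSq_sub_sub ht]
  linarith

theorem normSq_near {s t : ℍ} (ht : t ∈ roots) (x : ℍ) :
    normSq (x - (s + t)) - normSq (x - s) = 2 - 4 * (coord s t x).re := by
  rw [normSq_sub_sub ht, (coord_eq_one_iff ht).2 rfl, inner_one_right]
  simp
  ring

/-- The Voronoi cell of the lattice `D4`. -/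
abbrev vor (s : ℍ) : Set ℍ := voronoiCell (D4 : Set ℍ) s

theorem mem_vor {s x : ℍ} : x ∈ vor s ↔ ∀ q ∈ D4, 0 ≤ normSq (x - q) - normSq (x - s) := by
  simp only [vor, voronoiCell, Set.mem_ofPred_eq, SetLike.mem_coe, dist_le_iff, sub_nonneg]

theorem pyr_subset_vor {s t : ℍ} (hs : s ∈ D4) (ht : t ∈ roots) : pyr s t ⊆ vor s := by
  intro x hx
  rw [mem_vor]
  intro q hq
  have hx' := hx
  obtain ⟨h1, h2⟩ := hx'
  by_cases h : q = s
  · subst h; simp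
  by_cases h' : q = s + t
  · subst h'
    rw [normSq_near ht]
    linarith
  · have := normSq_far hs ht hx hq h h'
    linarith

theorem add_root_mem_D4 {s t : ℍ} (hs : s ∈ D4) (ht : t ∈ roots) : s + t ∈ D4 :=
  D4.add_mem hs ht.1

theorem mul_unit_mem_roots {t u : ℍ} (ht : t ∈ roots) (hu : u ∈ units) : t * u ∈ roots :=
  ⟨mul_mem_D4_right hu.1 ht.1, by rw [map_mul, ht.2, hu.2, mul_one]⟩

/-- Choose t with the largest inner product with x - s. Comparing t with tu for units u gives ⟨z, u⟩
≤ re z, and the half-integral u with real part 1/2 and the signs of z turns this into im1 z ≤ re z.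
-/
theorem vor_subset_pyr {s x : ℍ} (hs : s ∈ D4) (hx : x ∈ vor s) : ∃ t ∈ roots, x ∈ pyr s t := by
  have hne : roots.Nonempty :=
    ⟨mkq 1 1 0 0, ⟨1, 1, 0, 0, by ext <;> simp, by decide⟩, by norm_num [normSq_coord]⟩
  obtain ⟨t, ht, hmax⟩ := Set.exists_max_image roots (fun t => inner ℝ (x - s) t) finite_roots hne
  refine ⟨t, ht, ?_⟩
  set z := coord s t x with hz
  have hxs : x - s = t * z := by rw [← add_mul_coord ht s x]; simp [hz]
  have key : ∀ u ∈ units, inner ℝ z u ≤ z.re := by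
    intro u hu
    have := hmax _ (mul_unit_mem_roots ht hu)
    simp only [hxs] at this
    have e : inner ℝ (t * z) t = normSq t * z.re := by
      rw [← inner_one_right, ← inner_mul_left, mul_one]
    rw [e, inner_mul_left, ht.2] at this
    linarith
  have hh : z.re ≤ 1 / 2 := by
    have := (mem_vor.1 hx) _ (add_root_mem_D4 hs ht)
    rw [normSq_near ht] at this
    linarith
  refine ⟨?_, hh⟩
  have sgn : ∀ w : ℝ, ∃ e : ℤ, (e = 0 ∨ e = -1) ∧ |w| = (1 + 2 * e) * w := by
    intro w
    rcases le_total 0 w with h | h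
    · exact ⟨0, Or.inl rfl, by rw [abs_of_nonneg h]; simp⟩
    · exact ⟨-1, Or.inr rfl, by rw [abs_of_nonpos h]; push_cast; ring⟩
  obtain ⟨a, ha, ha'⟩ := sgn z.imI
  obtain ⟨b, hb, hb'⟩ := sgn z.imJ
  obtain ⟨c, hc, hc'⟩ := sgn z.imK
  have hu : mkq ((1 : ℤ) / 2) ((1 : ℤ) / 2 + a) ((1 : ℤ) / 2 + b) ((1 : ℤ) / 2 + c) ∈ units := by
    refine ⟨⟨1, a, b, c, rfl⟩, ?_⟩
    rcases ha with rfl | rfl <;> rcases hb with rfl | rfl <;> rcases hc with rfl | rfl <;>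
      norm_num [normSq_coord]
  have := key _ hu
  rw [inner_coord] at this
  simp only [re_mkq, imI_mkq, imJ_mkq, imK_mkq] at this
  rw [← hz, im1, ha', hb', hc']
  push_cast at this
  linarith

theorem exists_vor (x : ℍ) : ∃ s ∈ D4, x ∈ vor s := by
  have hfin : {q : ℍ | q ∈ D4 ∧ ‖x - q‖ ≤ ‖x‖}.Finite := by
    refine (finite_hurwitz_ball (2 * ‖x‖)).subset fun q hq => ⟨D4_subset hq.1, ?_⟩
    have : ‖q‖ ≤ ‖x‖ + ‖x - q‖ := by
      calc ‖q‖ = ‖x - (x - q)‖ := by simp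
        _ ≤ _ := norm_sub_le _ _
    linarith [hq.2]
  obtain ⟨s, hs, hmin⟩ := Set.exists_min_image _ (fun q => dist x q) hfin
    ⟨0, D4.zero_mem, by simp⟩
  refine ⟨s, hs.1, fun q hq => ?_⟩
  by_cases h : ‖x - q‖ ≤ ‖x‖
  · exact hmin q ⟨hq, h⟩
  · rw [dist_eq_norm, dist_eq_norm]
    exact hs.2.trans (not_le.1 h).le

theorem exists_pyr (x : ℍ) : ∃ s ∈ D4, ∃ t ∈ roots, x ∈ pyr s t := by
  obtain ⟨s, hs, hx⟩ := exists_vor x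
  obtain ⟨t, ht, h⟩ := vor_subset_pyr hs hx
  exact ⟨s, hs, t, ht, h⟩

/-! ### Mirrors in a pyramid -/

theorem int_root_cases : ∀ a ∈ Finset.Icc (-1 : ℤ) 1, ∀ b ∈ Finset.Icc (-1 : ℤ) 1,
    ∀ c ∈ Finset.Icc (-1 : ℤ) 1, ∀ d ∈ Finset.Icc (-1 : ℤ) 1, a ^ 2 + b ^ 2 + c ^ 2 + d ^ 2 = 2 →
      ∃ e ∈ ({1, -1} : Finset ℤ), ∃ f ∈ ({1, -1} : Finset ℤ),
        (a = e ∧ b = f ∧ c = 0 ∧ d = 0) ∨ (a = e ∧ b = 0 ∧ c = f ∧ d = 0) ∨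
        (a = e ∧ b = 0 ∧ c = 0 ∧ d = f) ∨ (a = 0 ∧ b = e ∧ c = f ∧ d = 0) ∨
        (a = 0 ∧ b = e ∧ c = 0 ∧ d = f) ∨ (a = 0 ∧ b = 0 ∧ c = e ∧ d = f) := by
  decide

theorem roots_cases {t : ℍ} (ht : t ∈ roots) :
    ∃ e f : ℝ, (e = 1 ∨ e = -1) ∧ (f = 1 ∨ f = -1) ∧
      (t = mkq e f 0 0 ∨ t = mkq e 0 f 0 ∨ t = mkq e 0 0 f ∨ t = mkq 0 e f 0 ∨
        t = mkq 0 e 0 f ∨ t = mkq 0 0 e f) := by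
  obtain ⟨⟨a, b, c, d, rfl, -⟩, h⟩ := ht
  rw [normSq_coord] at h
  simp only [re_mkq, imI_mkq, imJ_mkq, imK_mkq] at h
  have h : a ^ 2 + b ^ 2 + c ^ 2 + d ^ 2 = 2 := by exact_mod_cast h
  have key : ∀ m : ℤ, m ^ 2 ≤ 2 → m ∈ Finset.Icc (-1 : ℤ) 1 := fun m hm => by
    rw [Finset.mem_Icc]; constructor <;> nlinarith
  have pa := sq_nonneg a
  have pb := sq_nonneg b
  have pc := sq_nonneg c
  have pd := sq_nonneg d
  obtain ⟨e, he, f, hf, hc⟩ := int_root_cases a (key a (by linarith)) b (key b (by linarith)) c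
    (key c (by linarith)) d (key d (by linarith)) h
  simp only [Finset.mem_insert, Finset.mem_singleton] at he hf
  refine ⟨e, f, ?_, ?_, ?_⟩
  · rcases he with rfl | rfl <;> simp
  · rcases hf with rfl | rfl <;> simp
  · rcases hc with ⟨rfl, rfl, rfl, rfl⟩ | ⟨rfl, rfl, rfl, rfl⟩ | ⟨rfl, rfl, rfl, rfl⟩ |
      ⟨rfl, rfl, rfl, rfl⟩ | ⟨rfl, rfl, rfl, rfl⟩ | ⟨rfl, rfl, rfl, rfl⟩ <;> simp

theorem star_unit_mul_root {u t : ℍ} (hu : u ∈ units) (ht : t ∈ roots) : star u * t ∈ roots :=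
  ⟨mul_mem_D4_left (star_mem_hurwitz hu.1) ht.1, by simp [hu.2, ht.2]⟩

theorem Q4_units {u : ℍ} (hu : u ∈ Q4) : u ∈ units := ⟨Q4_hurwitz u hu, Q4_normSq u hu⟩

/-- The hermitian projection of a nonzero point of the cone over a facet to a root line vanishes
only on the axis of the cone. -/
theorem axis_of_projection {τ z : ℍ} (hτ : τ ∈ roots) (hz : im1 z ≤ z.re)
    (h0 : (τ * z).re = 0)
    (h1 : (τ * z).re + (τ * z).imI + (τ * z).imJ + (τ * z).imK = 0) :
    z.imI = z.imJ ∧ z.imJ = z.imK := by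
  have a1 := le_abs_self z.imI
  have a2 := neg_le_abs z.imI
  have b1 := le_abs_self z.imJ
  have b2 := neg_le_abs z.imJ
  have c1 := le_abs_self z.imK
  have c2 := neg_le_abs z.imK
  unfold im1 at hz
  obtain ⟨e, f, he, hf, h⟩ := roots_cases hτ
  rcases h with rfl | rfl | rfl | rfl | rfl | rfl <;>
    simp only [re_mul, imI_mul, imJ_mul, imK_mul, re_mkq, imI_mkq, imJ_mkq, imK_mkq] at h0 h1 <;>
    rcases he with rfl | rfl <;> rcases hf with rfl | rfl <;> constructor <;> linarith

/-- For each norm 2 vector t one of the four units u makes ūt orthogonal to `Cω`, and that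
complement is stable under right multiplication by `Cω`. -/
theorem exists_mirror_of_axis {t : ℍ} (ht : t ∈ roots) : ∃ u ∈ Q4, ∀ c : ℍ, c.imI = c.imJ →
    c.imJ = c.imK → (star u * (t * c)).re = 0 ∧ (star u * (t * c)).re + (star u * (t * c)).imI +
      (star u * (t * c)).imJ + (star u * (t * c)).imK = 0 := by
  have red : ∀ u ∈ Q4, (star u * t).re = 0 →
      (star u * t).imI + (star u * t).imJ + (star u * t).imK = 0 →
      ∃ u ∈ Q4, ∀ c : ℍ, c.imI = c.imJ →
        c.imJ = c.imK → (star u * (t * c)).re = 0 ∧ (star u * (t * c)).re +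
          (star u * (t * c)).imI + (star u * (t * c)).imJ + (star u * (t * c)).imK = 0 := by
    intro u hu h0 h1
    refine ⟨u, hu, fun c c1 c2 => ?_⟩
    rw [← mul_assoc]
    generalize star u * t = y at *
    have hy : y.imI = -y.imJ - y.imK := by linarith
    simp only [re_mul, imI_mul, imJ_mul, imK_mul, h0, hy, c1, c2]
    constructor <;> ring
  obtain ⟨e, f, he, hf, h⟩ := roots_cases ht
  rcases h with rfl | rfl | rfl | rfl | rfl | rfl <;> rcases he with rfl | rfl <;>
    rcases hf with rfl | rfl <;>
    first
    | (refine red (mkq 1 0 0 0) (by simp [Q4]) ?_ ?_ <;> norm_num; done)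
    | (refine red (mkq 0 1 0 0) (by simp [Q4]) ?_ ?_ <;> norm_num; done)
    | (refine red (mkq 0 0 1 0) (by simp [Q4]) ?_ ?_ <;> norm_num; done)
    | (refine red (mkq 0 0 0 1) (by simp [Q4]) ?_ ?_ <;> norm_num; done)

/-- The form is three times the squared distance between two mirrors of the same family; its least
nonzero value is 4. -/
theorem int_form_eq_zero {a b : ℤ} (h : 3 * a ^ 2 + (2 * b - a) ^ 2 ≤ 3) : a = 0 ∧ b = 0 := by
  have ha : a ^ 2 ≤ 1 := by nlinarith [sq_nonneg (2 * b - a)]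
  have ha1 : -1 ≤ a := by nlinarith
  have ha2 : a ≤ 1 := by nlinarith
  have hb1 : -1 ≤ b := by nlinarith [sq_nonneg a]
  have hb2 : b ≤ 1 := by nlinarith [sq_nonneg a]
  interval_cases a <;> interval_cases b <;> simp_all

theorem normSq_sub_le_one {s t x : ℍ} (ht : t ∈ roots) (hx : x ∈ pyr s t) :
    normSq (x - s) ≤ 1 := by
  have hs0 : coord s t s = 0 := by simp [coord]
  obtain ⟨h1, h2⟩ := hx
  rw [normSq_sub_coord ht s x s, hs0, sub_zero, normSq_coord]
  have h3 : (coord s t x).imI ^ 2 + (coord s t x).imJ ^ 2 + (coord s t x).imK ^ 2 ≤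
      im1 (coord s t x) ^ 2 := by
    unfold im1
    rw [← sq_abs (coord s t x).imI, ← sq_abs (coord s t x).imJ, ← sq_abs (coord s t x).imK]
    have := abs_nonneg (coord s t x).imI
    have := abs_nonneg (coord s t x).imJ
    have := abs_nonneg (coord s t x).imK
    nlinarith [mul_nonneg (abs_nonneg (coord s t x).imI) (abs_nonneg (coord s t x).imJ),
      mul_nonneg (abs_nonneg (coord s t x).imI) (abs_nonneg (coord s t x).imK),
      mul_nonneg (abs_nonneg (coord s t x).imJ) (abs_nonneg (coord s t x).imK)]
  have := im1_nonneg (coord s t x)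
  nlinarith

/-- Parallel mirrors are more than one apart and each family has a mirror through s, so a mirror
with a point at distance at most one from s passes through s. -/
theorem projection_eq_zero {u s x : ℍ} (hu : u ∈ Q4) (hs : s ∈ D4) {m n : ℤ} (hx : x ∈ mir u m n)
    (hle : normSq (x - s) ≤ 1) : (star u * (x - s)).re = 0 ∧ (star u * (x - s)).re +
      (star u * (x - s)).imI + (star u * (x - s)).imJ + (star u * (x - s)).imK = 0 := by
  obtain ⟨m', n', h1', h2'⟩ := D4_mem_mir hs u hu
  obtain ⟨h1, h2⟩ := hx
  have e1 : (star u * (x - s)).re = (m - m' : ℤ) := by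
    rw [mul_sub, re_sub, h1, h1']; push_cast; ring
  have e2 : (star u * (x - s)).re + (star u * (x - s)).imI + (star u * (x - s)).imJ +
      (star u * (x - s)).imK = 2 * (n - n' : ℤ) := by
    rw [mul_sub]; simp only [re_sub, imI_sub, imJ_sub, imK_sub]; push_cast; linarith
  have hle' : normSq (star u * (x - s)) ≤ 1 := by
    simpa [Q4_normSq u hu] using hle
  rw [normSq_coord] at hle'
  generalize star u * (x - s) = y at *
  have hz : m - m' = 0 ∧ n - n' = 0 := by
    apply int_form_eq_zero
    have : (3 * (m - m' : ℤ) ^ 2 + (2 * (n - n' : ℤ) - (m - m' : ℤ)) ^ 2 : ℝ) ≤ 3 := by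
      rw [← e1, ← e2]
      nlinarith [sq_nonneg (y.imI - y.imJ), sq_nonneg (y.imI - y.imK), sq_nonneg (y.imJ - y.imK)]
    exact_mod_cast this
  rw [e2, e1, hz.1, hz.2]
  simp

/-- A pyramid lies in the unit ball around its apex, so only mirrors through the apex can meet it,
and over the cone each of these is confined to the plane z_i = z_j = z_k. Conversely one mirror
through the apex contains that whole plane. -/
theorem onMirror_iff {s t x : ℍ} (hs : s ∈ D4) (ht : t ∈ roots) (hx : x ∈ pyr s t) :
    OnMirror x ↔ (coord s t x).imI = (coord s t x).imJ ∧ (coord s t x).imJ = (coord s t x).imK := by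
  have hxs : x - s = t * coord s t x := by
    conv_lhs => rw [← add_mul_coord ht s x]
    abel
  constructor
  · rintro ⟨u, hu, m, n, hm⟩
    obtain ⟨h1, h2⟩ := projection_eq_zero hu hs hm (normSq_sub_le_one ht hx)
    rw [hxs, ← mul_assoc] at h1 h2
    exact axis_of_projection (star_unit_mul_root (Q4_units hu) ht) hx.1 h1 h2
  · rintro ⟨h1, h2⟩
    obtain ⟨u, hu, h⟩ := exists_mirror_of_axis ht
    obtain ⟨m, n, hm1, hm2⟩ := D4_mem_mir hs u hu
    obtain ⟨k1, k2⟩ := h _ h1 h2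
    rw [← hxs, mul_sub] at k1 k2
    simp only [re_sub, imI_sub, imJ_sub, imK_sub] at k1 k2
    exact ⟨u, hu, m, n, by linarith, by linarith⟩

theorem onMirror_of_mem_D4 {s : ℍ} (hs : s ∈ D4) : OnMirror s := by
  obtain ⟨m, n, h⟩ := D4_mem_mir hs (mkq 1 0 0 0) (by simp [Q4])
  exact ⟨_, by simp [Q4], m, n, h⟩

theorem onMirror_half_root {s t : ℍ} (hs : s ∈ D4) (ht : t ∈ roots) :
    OnMirror (s + t * mkq (1 / 2) 0 0 0) := by
  have e := coord_add_mul ht s (mkq (1 / 2) 0 0 0)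
  have : s + t * mkq (1 / 2) 0 0 0 ∈ pyr s t := by
    rw [pyr, Set.mem_ofPred_eq, e]
    simp [im1]
  rw [onMirror_iff hs ht this, e]
  simp

/-! ### The vertices of the Voronoi cells -/

theorem mul_half_root_mem_units {t p : ℍ} (ht : t ∈ roots) (hp : p ∈ roots) :
    (1 / 2 : ℝ) • (t * p) ∈ units := by
  refine ⟨half_mul_mem_hurwitz ht.1 hp.1, ?_⟩
  rw [Quaternion.normSq_smul, map_mul, ht.2, hp.2]
  norm_num

/-- The three vertices of the facet of the Voronoi cell around `s` in the direction of `t`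
selected by the signs `a`, `b` and `c`. -/
def vI (s t : ℍ) (e : ℝ) : ℍ := s + t * mkq (1 / 2) (e / 2) 0 0
/-- See `vI`. -/
def vJ (s t : ℍ) (e : ℝ) : ℍ := s + t * mkq (1 / 2) 0 (e / 2) 0
/-- See `vI`. -/
def vK (s t : ℍ) (e : ℝ) : ℍ := s + t * mkq (1 / 2) 0 0 (e / 2)

theorem vertex_mem {s t : ℍ} (ht : t ∈ roots) {e : ℝ} (he : e = 1 ∨ e = -1) :
    vI s t e - s ∈ units ∧ vJ s t e - s ∈ units ∧ vK s t e - s ∈ units := by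
  have hI : mkq 1 e 0 0 ∈ roots := by
    rcases he with rfl | rfl
    · exact ⟨⟨1, 1, 0, 0, by ext <;> simp, by decide⟩, by norm_num [normSq_coord]⟩
    · exact ⟨⟨1, -1, 0, 0, by ext <;> simp, by decide⟩, by norm_num [normSq_coord]⟩
  have hJ : mkq 1 0 e 0 ∈ roots := by
    rcases he with rfl | rfl
    · exact ⟨⟨1, 0, 1, 0, by ext <;> simp, by decide⟩, by norm_num [normSq_coord]⟩
    · exact ⟨⟨1, 0, -1, 0, by ext <;> simp, by decide⟩, by norm_num [normSq_coord]⟩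
  have hK : mkq 1 0 0 e ∈ roots := by
    rcases he with rfl | rfl
    · exact ⟨⟨1, 0, 0, 1, by ext <;> simp, by decide⟩, by norm_num [normSq_coord]⟩
    · exact ⟨⟨1, 0, 0, -1, by ext <;> simp, by decide⟩, by norm_num [normSq_coord]⟩
  refine ⟨?_, ?_, ?_⟩
  · convert mul_half_root_mem_units ht hI using 1
    rw [vI, add_sub_cancel_left, ← mul_smul_comm]
    congr 1
    ext <;> simp <;> ring
  · convert mul_half_root_mem_units ht hJ using 1
    rw [vJ, add_sub_cancel_left, ← mul_smul_comm]
    congr 1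
    ext <;> simp <;> ring
  · convert mul_half_root_mem_units ht hK using 1
    rw [vK, add_sub_cancel_left, ← mul_smul_comm]
    congr 1
    ext <;> simp <;> ring

/-- The coefficients of a point of a pyramid with respect to the apex, the centre of the base and
three vertices. -/
theorem pyr_decomposition {s t : ℍ} (ht : t ∈ roots) (x : ℍ) {a b c : ℝ}
    (ha : |(coord s t x).imI| = a * (coord s t x).imI) (ha' : a = 1 ∨ a = -1)
    (hb : |(coord s t x).imJ| = b * (coord s t x).imJ) (hb' : b = 1 ∨ b = -1)
    (hc : |(coord s t x).imK| = c * (coord s t x).imK) (hc' : c = 1 ∨ c = -1) :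
    x = (1 - 2 * (coord s t x).re) • s +
      (2 * ((coord s t x).re - im1 (coord s t x))) • (s + t * mkq (1 / 2) 0 0 0) +
      (2 * |(coord s t x).imI|) • vI s t a + (2 * |(coord s t x).imJ|) • vJ s t b +
      (2 * |(coord s t x).imK|) • vK s t c := by
  conv_lhs => rw [← add_mul_coord ht s x]
  generalize coord s t x = z at *
  have hz : z = (2 * (z.re - im1 z)) • mkq (1 / 2) 0 0 0 + (2 * |z.imI|) • mkq (1 / 2) (a / 2) 0 0
      + (2 * |z.imJ|) • mkq (1 / 2) 0 (b / 2) 0 + (2 * |z.imK|) • mkq (1 / 2) 0 0 (c / 2) := by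
    have sq : ∀ e : ℝ, (e = 1 ∨ e = -1) → e * e = 1 := by
      rintro e (rfl | rfl) <;> norm_num
    ext
    · simp [im1]; ring
    · simp [ha]; linear_combination (-z.imI) * sq a ha'
    · simp [hb]; linear_combination (-z.imJ) * sq b hb'
    · simp [hc]; linear_combination (-z.imK) * sq c hc'
  have htz := congrArg (t * ·) hz
  simp only [mul_add, mul_smul_comm] at htz
  have hi : im1 z = |z.imI| + |z.imJ| + |z.imK| := rfl
  rw [htz, hi, vI, vJ, vK]
  module

theorem exists_sign (w : ℝ) : ∃ e : ℝ, (e = 1 ∨ e = -1) ∧ |w| = e * w := by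
  rcases le_total 0 w with h | h
  · exact ⟨1, Or.inl rfl, by rw [abs_of_nonneg h, one_mul]⟩
  · exact ⟨-1, Or.inr rfl, by rw [abs_of_nonpos h]; ring⟩

/-! ### The cells of the complement complex -/

theorem normSq_diff (x q s : ℍ) :
    normSq (x - q) - normSq (x - s) = 2 * inner ℝ x (s - q) + normSq q - normSq s := by
  rw [normSq_coord, normSq_coord, normSq_coord, normSq_coord, inner_coord]
  simp only [re_sub, imI_sub, imJ_sub, imK_sub]
  ring

theorem normSq_sub_eq (x y : ℍ) :
    normSq (x - y) = normSq x + normSq y - 2 * inner ℝ x y := by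
  rw [normSq_coord, normSq_coord, normSq_coord, inner_coord]
  simp only [re_sub, imI_sub, imJ_sub, imK_sub]
  ring

theorem normSq_add_eq (x y : ℍ) :
    normSq (x + y) = normSq x + normSq y + 2 * inner ℝ x y := by
  rw [normSq_coord, normSq_coord, normSq_coord, inner_coord]
  simp only [re_add, imI_add, imJ_add, imK_add]
  ring

theorem convex_vor (s : ℍ) : Convex ℝ (vor s) := by
  intro x hx y hy a b ha hb hab
  rw [mem_vor] at hx hy ⊢
  intro q hq
  have h1 := hx q hq
  have h2 := hy q hq
  rw [normSq_diff] at h1 h2 ⊢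
  rw [inner_add_left, real_inner_smul_left, real_inner_smul_left]
  obtain rfl : b = 1 - a := by linarith
  nlinarith

/-- The vertices of the Voronoi cell around `s`. -/
def vert (s : ℍ) : Finset ℍ := (finite_units.image (s + ·)).toFinset

theorem mem_vert {s a : ℍ} : a ∈ vert s ↔ a - s ∈ units := by
  rw [vert, Set.Finite.mem_toFinset]
  constructor
  · rintro ⟨u, hu, rfl⟩
    simpa using hu
  · intro h
    exact ⟨a - s, h, by simp⟩

theorem vert_subset_vor {s a : ℍ} (hs : s ∈ D4) (ha : a ∈ vert s) : a ∈ vor s := by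
  rw [mem_vert] at ha
  rw [mem_vor]
  intro q hq
  rw [ha.2, sub_nonneg]
  have hm : a - q = (a - s) - (q - s) := by abel
  have hqs := D4.sub_mem hq hs
  rw [hm]
  refine one_le_normSq (hurwitz.sub_mem ha.1 (D4_subset hqs)) fun h => ?_
  exact notMem_D4_of_normSq_one ha.1 ha.2 (sub_eq_zero.1 h ▸ hqs)

theorem one_mem_units : (1 : ℍ) ∈ units := ⟨hurwitz.one_mem, by simp⟩

theorem neg_mem_units {u : ℍ} (hu : u ∈ units) : -u ∈ units :=
  ⟨hurwitz.neg_mem hu.1, by rw [normSq_neg, hu.2]⟩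

theorem convex_comb_five {C : Set ℍ} (hC : Convex ℝ C) {c₁ c₂ c₃ c₄ c₅ : ℝ} {p₁ p₂ p₃ p₄ p₅ : ℍ}
    (h₁ : 0 ≤ c₁) (h₂ : 0 ≤ c₂) (h₃ : 0 ≤ c₃) (h₄ : 0 ≤ c₄) (h₅ : 0 ≤ c₅)
    (h : c₁ + c₂ + c₃ + c₄ + c₅ = 1) (k₁ : p₁ ∈ C) (k₂ : p₂ ∈ C) (k₃ : p₃ ∈ C) (k₄ : p₄ ∈ C)
    (k₅ : p₅ ∈ C) : c₁ • p₁ + c₂ • p₂ + c₃ • p₃ + c₄ • p₄ + c₅ • p₅ ∈ C := by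
  have := hC.sum_mem (t := Finset.univ) (w := ![c₁, c₂, c₃, c₄, c₅]) (z := ![p₁, p₂, p₃, p₄, p₅])
    (by intro i _; fin_cases i <;> simpa) (by simpa [Fin.sum_univ_five] using h)
    (by intro i _; fin_cases i <;> simpa)
  simpa [Fin.sum_univ_five] using this

/-- A point of a pyramid is a convex combination of the apex, the centre of the base and three
vertices; the apex and the centre are themselves midpoints of opposite vertices. -/
theorem vor_eq_hull {s : ℍ} (hs : s ∈ D4) : vor s = convexHull ℝ (vert s : Set ℍ) := by
  apply Set.Subset.antisymm
  · intro x hx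
    obtain ⟨t, ht, hp⟩ := vor_subset_pyr hs hx
    obtain ⟨a, ha, ha'⟩ := exists_sign (coord s t x).imI
    obtain ⟨b, hb, hb'⟩ := exists_sign (coord s t x).imJ
    obtain ⟨c, hc, hc'⟩ := exists_sign (coord s t x).imK
    have hconv := convex_convexHull ℝ (vert s : Set ℍ)
    have sub : ∀ v, v - s ∈ units → v ∈ convexHull ℝ (vert s : Set ℍ) := fun v hv =>
      subset_convexHull ℝ _ (mem_vert.2 hv)
    have mid : ∀ v w : ℍ, v ∈ convexHull ℝ (vert s : Set ℍ) → w ∈ convexHull ℝ (vert s : Set ℍ) →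
        (1 / 2 : ℝ) • v + (1 / 2 : ℝ) • w ∈ convexHull ℝ (vert s : Set ℍ) := fun v w hv hw =>
      hconv hv hw (by norm_num) (by norm_num) (by norm_num)
    obtain ⟨h1, h2⟩ := hp
    rw [pyr_decomposition ht x ha' ha hb' hb hc' hc]
    refine convex_comb_five hconv (by linarith) (by linarith) (by positivity) (by positivity)
      (by positivity) (by unfold im1; ring) ?_ ?_ (sub _ (vertex_mem ht ha).1)
      (sub _ (vertex_mem ht hb).2.1) (sub _ (vertex_mem ht hc).2.2)
    · have := mid (s + 1) (s - 1) (sub _ (by simpa using one_mem_units))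
        (sub _ (by simpa using neg_mem_units one_mem_units))
      convert this using 1
      module
    · have := mid _ _ (sub _ (vertex_mem (s := s) ht (Or.inl rfl)).1)
        (sub _ (vertex_mem (s := s) ht (Or.inr rfl)).1)
      convert this using 1
      have e : mkq (1 / 2) 0 0 0 = (1 / 2 : ℝ) • mkq (1 / 2) (1 / 2) 0 0 +
          (1 / 2 : ℝ) • mkq (1 / 2) (-1 / 2) 0 0 := by ext <;> norm_num
      rw [e, mul_add, mul_smul_comm, mul_smul_comm, vI, vI]
      module
  · exact convexHull_min (fun a ha => vert_subset_vor hs ha) (convex_vor s)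

/-- A set of vertices of the Voronoi cell around `s` with pairwise distance one. -/
structure Clique (s : ℍ) (A : Finset ℍ) : Prop where
  nonempty : A.Nonempty
  mem_units : ∀ a ∈ A, a - s ∈ units
  normSq_sub : ∀ a ∈ A, ∀ b ∈ A, a ≠ b → normSq (a - b) = 1

namespace Clique

variable {s : ℍ} {A : Finset ℍ}

theorem mono (hA : Clique s A) {B : Finset ℍ} (hB : B ⊆ A) (hne : B.Nonempty) : Clique s B :=
  ⟨hne, fun a ha => hA.mem_units a (hB ha), fun a ha b hb => hA.normSq_sub a (hB ha) b (hB hb)⟩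

theorem subset_vert (hA : Clique s A) : A ⊆ vert s := fun a ha => mem_vert.2 (hA.mem_units a ha)

theorem inner_eq (hA : Clique s A) {a b : ℍ} (ha : a ∈ A) (hb : b ∈ A) (hab : a ≠ b) :
    inner ℝ (a - s) (b - s) = 1 / 2 := by
  have h := hA.normSq_sub a ha b hb hab
  have e : a - b = (a - s) - (b - s) := by abel
  rw [e, normSq_sub_eq, (hA.mem_units a ha).2, (hA.mem_units b hb).2] at h
  linarith

theorem inner_self (hA : Clique s A) {a : ℍ} (ha : a ∈ A) : inner ℝ (a - s) (a - s) = 1 := by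
  rw [real_inner_self_eq_norm_sq, ← normSq_eq_sq, (hA.mem_units a ha).2]

/-- The functional exposing a clique. -/
theorem exists_functional (hA : Clique s A) : ∃ (l : ℍ →L[ℝ] ℝ) (M : ℝ), (∀ a ∈ A, l a = M) ∧
    ∀ w ∈ vert s, w ∉ A → l w < M := by
  classical
  -- Measured from s, a member contributes 1 with itself and 1/2 with each other member; any other
  -- vertex has inner product at most 1/2 with each member, so it reaches at most card/2.
  refine ⟨innerSL ℝ (∑ a ∈ A, (a - s)), inner ℝ (∑ a ∈ A, (a - s)) s + (A.card + 1) / 2, ?_, ?_⟩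
  · intro b hb
    have e : b = s + (b - s) := by abel
    rw [innerSL_apply_apply]
    conv_lhs => rw [e]
    rw [inner_add_right, sum_inner (𝕜 := ℝ) A _ (b - s)]
    congr 1
    rw [← Finset.add_sum_erase A _ hb, hA.inner_self hb, Finset.sum_congr rfl fun a ha =>
        hA.inner_eq (Finset.mem_of_mem_erase ha) hb (Finset.ne_of_mem_erase ha)]
    have hc := Finset.card_erase_add_one hb
    have hc' : ((A.erase b).card : ℝ) + 1 = A.card := by exact_mod_cast hc
    simp only [Finset.sum_const, nsmul_eq_mul]
    linarith
  · intro w hw hwA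
    have e : w = s + (w - s) := by abel
    rw [innerSL_apply_apply]
    conv_lhs => rw [e]
    rw [inner_add_right, sum_inner (𝕜 := ℝ) A _ (w - s)]
    have hle : ∑ a ∈ A, inner ℝ (a - s) (w - s) ≤ ∑ a ∈ A, (1 / 2 : ℝ) := by
      refine Finset.sum_le_sum fun a ha => ?_
      rw [mem_vert] at hw
      refine inner_units_le_half (hA.mem_units a ha).1 hw.1 (fun h => hwA ?_)
        (hA.mem_units a ha).2 hw.2
      rwa [← sub_left_injective h]
    simp only [Finset.sum_const, nsmul_eq_mul] at hle
    linarith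

theorem isFace_vor (hs : s ∈ D4) (hA : Clique s A) :
    IsFace (vor s) (convexHull ℝ (A : Set ℍ)) := by
  obtain ⟨l, M, h1, h2⟩ := hA.exists_functional
  rw [vor_eq_hull hs]
  exact isFace_hull hA.subset_vert hA.nonempty l M h1 h2

theorem isFace_subset (hA : Clique s A) {B : Finset ℍ} (hB : B ⊆ A) (hne : B.Nonempty) :
    IsFace (convexHull ℝ (A : Set ℍ)) (convexHull ℝ (B : Set ℍ)) := by
  obtain ⟨l, M, h1, h2⟩ := (hA.mono hB hne).exists_functional
  exact isFace_hull hB hne l M h1 fun w hw => h2 w (hA.subset_vert hw)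

theorem mem_of_mem_hull (hA : Clique s A) {b : ℍ} (hb : b ∈ vert s)
    (hbA : b ∈ convexHull ℝ (A : Set ℍ)) : b ∈ A := by
  obtain ⟨l, M, h1, h2⟩ := hA.exists_functional
  by_contra h
  have : l b = M := convexHull_min (t := {x | l x = M}) h1
    (convex_hyperplane l.toLinearMap.isLinear M) hbA
  exact (h2 b hb h).ne this

theorem hull_subset_vor (hs : s ∈ D4) (hA : Clique s A) : convexHull ℝ (A : Set ℍ) ⊆ vor s :=
  (hA.isFace_vor hs).2.subset

/-- Cells are extreme in every Voronoi cell. -/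
theorem mem_hull_of_combination (hs : s ∈ D4) (hA : Clique s A) {s' : ℍ} (hs' : s' ∈ D4)
    {ι : Type*} (T : Finset ι) (c : ι → ℝ) (b : ι → ℍ) (h0 : ∀ i ∈ T, 0 ≤ c i)
    (h1 : ∑ i ∈ T, c i = 1) (hb : ∀ i ∈ T, b i ∈ vor s')
    (hx : ∑ i ∈ T, c i • b i ∈ convexHull ℝ (A : Set ℍ)) {j : ι} (hj : j ∈ T) (hcj : 0 < c j) :
    b j ∈ convexHull ℝ (A : Set ℍ) := by
  -- The difference of squared distances to s and s' is affine, nonnegative at every point of `vor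
  -- s'` and nonpositive at the combination. So it vanishes wherever the weight is positive, and
  -- such points lie in `vor s` as well.
  refine mem_face_of_combination (hA.isFace_vor hs) T c b h0 h1 (fun i hi hci => ?_) hx hj hcj
  have hxs := mem_vor.1 (hA.hull_subset_vor hs hx) s' hs'
  have hnn : ∀ i ∈ T, 0 ≤ c i * (normSq (b i - s) - normSq (b i - s')) := fun i hi =>
    mul_nonneg (h0 i hi) ((mem_vor.1 (hb i hi)) s hs)
  have hsum : ∑ i ∈ T, c i * (normSq (b i - s) - normSq (b i - s')) =
      normSq (∑ i ∈ T, c i • b i - s) - normSq (∑ i ∈ T, c i • b i - s') := by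
    rw [normSq_diff, sum_inner, Finset.sum_congr rfl fun i _ => by rw [normSq_diff]]
    simp only [real_inner_smul_left, mul_add, mul_sub, Finset.sum_add_distrib,
      Finset.sum_sub_distrib, ← Finset.sum_mul, h1, one_mul, Finset.mul_sum]
    congr 2
    exact Finset.sum_congr rfl fun i _ => by ring
  have hz : ∑ i ∈ T, c i * (normSq (b i - s) - normSq (b i - s')) = 0 :=
    le_antisymm (by rw [hsum]; linarith) (Finset.sum_nonneg hnn)
  have hi0 := (Finset.sum_eq_zero_iff_of_nonneg hnn).1 hz i hi
  have heq : normSq (b i - s) - normSq (b i - s') = 0 :=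
    (mul_eq_zero.1 hi0).resolve_left hci.ne'
  rw [mem_vor]
  intro q hq
  have := mem_vor.1 (hb i hi) q hq
  linarith

theorem vert_of_mem_hull (hs : s ∈ D4) (hA : Clique s A) {s' a : ℍ} (hs' : s' ∈ D4)
    (ha : a ∈ vert s') (haA : a ∈ convexHull ℝ (A : Set ℍ)) : a ∈ A := by
  refine hA.mem_of_mem_hull ?_ haA
  have h1 := mem_vor.1 (hA.hull_subset_vor hs haA) s' hs'
  have h2 := mem_vor.1 (vert_subset_vor hs' ha) s hs
  rw [mem_vert] at ha ⊢
  have hm : a - s = (a - s') + (s' - s) := by abel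
  refine ⟨hm ▸ hurwitz.add_mem ha.1 (D4_subset (D4.sub_mem hs' hs)), ?_⟩
  rw [← ha.2]
  linarith

theorem normSq_le_one (hA : Clique s A) {a b : ℍ} (ha : a ∈ A) (hb : b ∈ A) : ‖a - b‖ ≤ 1 := by
  by_cases h : a = b
  · simp [h]
  · rw [(normSq_eq_one_iff _).1 (hA.normSq_sub a ha b hb h)]

end Clique

-- Cells are extreme in every Voronoi cell, so a common point has positive weight only on vertices
-- of A that also lie in the other cell, and these are vertices of that cell.
open Classical in
theorem hull_inter_hull {s s' : ℍ} {A A' : Finset ℍ} (hs : s ∈ D4) (hs' : s' ∈ D4)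
    (hA : Clique s A) (hA' : Clique s' A') :
    convexHull ℝ (A : Set ℍ) ∩ convexHull ℝ (A' : Set ℍ) =
      convexHull ℝ ((A ∩ A' : Finset ℍ) : Set ℍ) := by
  apply Set.Subset.antisymm
  · rintro x ⟨hx, hx'⟩
    obtain ⟨c, h0, h1, hsum⟩ := Finset.mem_convexHull'.1 hx
    rw [← hsum] at hx'
    have key : ∀ a ∈ A, a ∉ A ∩ A' → c a = 0 := by
      intro a ha ha'
      by_contra hne
      refine ha' (Finset.mem_inter.2 ⟨ha, hA'.vert_of_mem_hull hs' hs (hA.subset_vert ha) ?_⟩)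
      exact hA'.mem_hull_of_combination hs' hs A c id h0 h1
        (fun i hi => vert_subset_vor hs (hA.subset_vert hi)) hx' ha
        (lt_of_le_of_ne (h0 a ha) (Ne.symm hne))
    refine Finset.mem_convexHull'.2 ⟨c, fun y hy => h0 y (Finset.mem_inter.1 hy).1, ?_, ?_⟩
    · rw [← h1]
      exact Finset.sum_subset Finset.inter_subset_left key
    · rw [← hsum]
      exact Finset.sum_subset Finset.inter_subset_left fun a ha ha' => by simp [key a ha ha']
  · refine Set.subset_inter (convexHull_mono ?_) (convexHull_mono ?_)
    · exact_mod_cast Finset.inter_subset_left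
    · exact_mod_cast Finset.inter_subset_right

theorem mem_K_iff {F : Set ℍ} : F ∈ K ↔ ∃ s ∈ D4, ∃ A : Finset ℍ, Clique s A ∧
    F = convexHull ℝ (A : Set ℍ) ∧ ∀ x ∈ F, ¬ OnMirror x := by
  classical
  rw [K, complementComplex, Set.mem_ofPred_eq, zeroDimIntersections_eq]
  have hM : F ⊆ hyperplaneComplement reflG4 ↔ ∀ x ∈ F, ¬ OnMirror x :=
    forall₂_congr fun x _ => mem_complement
  rw [hM]
  constructor
  · rintro ⟨⟨s, hs, hF⟩, hFM⟩
    have hs : s ∈ D4 := hs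
    have hF : IsFace (vor s) F := hF
    have hF' := hF
    rw [vor_eq_hull hs] at hF'
    have hFA := face_hull_eq hF'
    set A := (vert s).filter (· ∈ F) with hAd
    have hne : A.Nonempty := by
      have := hF.1
      rw [hFA] at this
      exact_mod_cast convexHull_nonempty_iff.1 this
    refine ⟨s, hs, A, ⟨hne, fun a ha => mem_vert.1 (Finset.mem_filter.1 ha).1, ?_⟩, hFA, hFM⟩
    intro a ha b hb hab
    obtain ⟨hav, haF⟩ := Finset.mem_filter.1 ha
    obtain ⟨hbv, hbF⟩ := Finset.mem_filter.1 hb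
    rw [mem_vert] at hav hbv
    have hmid : (1 / 2 : ℝ) • a + (1 / 2 : ℝ) • b ∈ F :=
      hF.2.convex (convex_vor s) haF hbF (by norm_num) (by norm_num) (by norm_num)
    have hsF : s ∉ F := fun h => hFM s h (onMirror_of_mem_D4 hs)
    have e : a - b = (a - s) - (b - s) := by abel
    have hne : (a - s) - (b - s) ≠ 0 := by rw [← e]; exact sub_ne_zero.2 hab
    have hsum : (1 / 2 : ℝ) • a + (1 / 2 : ℝ) • b =
        s + (1 / 2 : ℝ) • ((a - s) + (b - s)) := by module
    rw [hsum] at hmid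
    rw [e]
    generalize a - s = u at *
    generalize b - s = v at *
    obtain ⟨n, hn, -⟩ := exists_normSq (hurwitz.sub_mem hav.1 hbv.1)
    have h1 := one_le_normSq (hurwitz.sub_mem hav.1 hbv.1) hne
    have hadd := hurwitz.add_mem hav.1 hbv.1
    have h4 : normSq (u - v) + normSq (u + v) = 4 := by
      rw [normSq_sub_eq, normSq_add_eq, hav.2, hbv.2]; norm_num
    have hle := normSq_nonneg (a := u + v)
    have hn1 : 1 ≤ n := by rw [hn] at h1; exact_mod_cast h1
    have hn4 : n ≤ 4 := by exact_mod_cast (by linarith : (n : ℝ) ≤ 4)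
    rw [hn] at h4 ⊢
    -- By the parallelogram law |u + v|² = 4 - n. For n = 2 the midpoint is the centre of a facet,
    -- which lies on a mirror. For n = 3 the sum is a unit and the midpoint is also that of s and
    -- the vertex s + u + v, while for n = 4 it is s itself; either way the face would contain s.
    interval_cases n
    · norm_num
    · exfalso
      have ht : u + v ∈ roots :=
        ⟨mem_D4_of_normSq hadd 1 (by push_cast at *; linarith), by push_cast at h4; linarith⟩
      refine hFM _ hmid ?_
      convert onMirror_half_root hs ht using 2
      ext <;> simp <;> ring
    · exfalso
      have hu : u + v ∈ units := ⟨hadd, by push_cast at h4; linarith⟩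
      refine hsF (mem_face_of_combination hF Finset.univ ![1 / 2, 1 / 2] ![s, s + (u + v)]
        ?_ ?_ ?_ ?_ (j := 0) (Finset.mem_univ _) (by norm_num))
      · intro i _; fin_cases i <;> norm_num
      · norm_num [Fin.sum_univ_two]
      · intro i _ _
        fin_cases i
        · rw [vor, voronoiCell]
          intro q _
          simp
        · exact vert_subset_vor hs (mem_vert.2 (by simpa using hu))
      · convert hmid using 1
        simp only [Fin.sum_univ_two, Matrix.cons_val_zero, Matrix.cons_val_one]
        module
    · exfalso
      have hz : u + v = 0 := by
        rw [← normSq_eq_zero]; push_cast at h4; linarith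
      rw [hz, smul_zero, add_zero] at hmid
      exact hsF hmid
  · rintro ⟨s, hs, A, hA, rfl, hFM⟩
    exact ⟨⟨s, hs, hA.isFace_vor hs⟩, hFM⟩

theorem isPolyhedralComplex_K : IsPolyhedralComplex K where
  polytope F hF := by
    obtain ⟨s, hs, A, hA, rfl, -⟩ := mem_K_iff.1 hF
    exact ⟨(hA.isFace_vor hs).1, A, rfl⟩
  face_mem F hF F' hF' := by
    classical
    obtain ⟨s, hs, A, hA, rfl, hM⟩ := mem_K_iff.1 hF
    have e := face_hull_eq hF'
    refine mem_K_iff.2 ⟨s, hs, _, hA.mono (Finset.filter_subset _ _) ?_, e,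
      fun x hx => hM x (hF'.2.subset hx)⟩
    have := hF'.1
    rw [e] at this
    exact_mod_cast convexHull_nonempty_iff.1 this
  inter F hF F' hF' hne := by
    classical
    obtain ⟨s, hs, A, hA, rfl, hM⟩ := mem_K_iff.1 hF
    obtain ⟨s', hs', A', hA', rfl, hM'⟩ := mem_K_iff.1 hF'
    rw [hull_inter_hull hs hs' hA hA'] at hne ⊢
    have hne' : (A ∩ A').Nonempty := by exact_mod_cast convexHull_nonempty_iff.1 hne
    exact ⟨hA.isFace_subset Finset.inter_subset_left hne',
      hA'.isFace_subset Finset.inter_subset_right hne'⟩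
  locallyFinite x := by
    refine ⟨Metric.ball x 1, Metric.ball_mem_nhds x one_pos, ?_⟩
    -- A vertex of a cell is within distance 1 of every point of the cell, and one of these is
    -- within 1 of x.
    have hfin := finite_hurwitz_ball (‖x‖ + 2)
    refine (hfin.toFinset.powerset.finite_toSet.image
      fun A : Finset ℍ => convexHull ℝ (A : Set ℍ)).subset ?_
    rintro F ⟨hF, p, hpF, hpx⟩
    obtain ⟨s, hs, A, hA, rfl, -⟩ := mem_K_iff.1 hF
    refine ⟨A, ?_, rfl⟩
    rw [Finset.mem_coe, Finset.mem_powerset]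
    intro a ha
    rw [Set.Finite.mem_toFinset]
    have e : a = (a - s) + s := by abel
    refine ⟨e ▸ hurwitz.add_mem (hA.mem_units a ha).1 (D4_subset hs), ?_⟩
    have hpa : p ∈ Metric.closedBall a 1 := by
      refine convexHull_min (fun b hb => ?_) (convex_closedBall a 1) hpF
      rw [Metric.mem_closedBall, dist_eq_norm]
      exact hA.normSq_le_one hb ha
    rw [Metric.mem_closedBall, dist_eq_norm] at hpa
    rw [Metric.mem_ball, dist_eq_norm] at hpx
    have : a = x + ((p - x) - (p - a)) := by abel
    calc ‖a‖ = ‖x + ((p - x) - (p - a))‖ := by rw [← this]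
      _ ≤ ‖x‖ + (‖p - x‖ + ‖p - a‖) := (norm_add_le _ _).trans (by gcongr; exact norm_sub_le _ _)
      _ ≤ ‖x‖ + 2 := by linarith

/-! ### Dimensions of cells -/

/-- The class of a Hurwitz quaternion modulo `D4`. -/
def cls (x : ℍ) : ZMod 2 × ZMod 2 :=
  ((⌊2 * x.re⌋ : ℤ), (⌊x.imI + x.imJ + x.imK - 3 * x.re⌋ : ℤ))

theorem cls_mkq (a b c d : ℤ) :
    cls (mkq (a / 2) (a / 2 + b) (a / 2 + c) (a / 2 + d)) = ((a : ZMod 2), ((b + c + d : ℤ) : ZMod 2)) := by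
  have h1 : (2 * (a / 2) : ℝ) = a := by ring
  have h2 : ((a / 2 + b) + (a / 2 + c) + (a / 2 + d) - 3 * (a / 2) : ℝ) = (b + c + d : ℤ) := by
    push_cast; ring
  simp only [cls, re_mkq, imI_mkq, imJ_mkq, imK_mkq, h1, h2, Int.floor_intCast]

theorem cls_eq_iff {x y : ℍ} (hx : x ∈ hurwitz) (hy : y ∈ hurwitz) :
    cls x = cls y ↔ x - y ∈ D4 := by
  obtain ⟨a, b, c, d, rfl⟩ := hx
  obtain ⟨a', b', c', d', rfl⟩ := hy
  have e : mkq (a / 2) (a / 2 + b) (a / 2 + c) (a / 2 + d) -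
      mkq (a' / 2) (a' / 2 + b') (a' / 2 + c') (a' / 2 + d') =
      mkq ((a - a' : ℤ) / 2) ((a - a' : ℤ) / 2 + (b - b' : ℤ)) ((a - a' : ℤ) / 2 + (c - c' : ℤ))
        ((a - a' : ℤ) / 2 + (d - d' : ℤ)) := by
    ext <;> simp <;> ring
  rw [e, hurwitz_mem_D4, cls_mkq, cls_mkq, Prod.mk.injEq, eq_comm,
    ZMod.intCast_eq_intCast_iff_dvd_sub, eq_comm (b := ((b' + c' + d' : ℤ) : ZMod 2)),
    ZMod.intCast_eq_intCast_iff_dvd_sub, even_iff_two_dvd, even_iff_two_dvd]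
  have e2 : b + c + d - (b' + c' + d') = b - b' + (c - c') + (d - d') := by ring
  rw [e2]
  rfl

theorem cls_eq_zero_iff {x : ℍ} (hx : x ∈ hurwitz) : cls x = 0 ↔ x ∈ D4 := by
  have : cls 0 = 0 := by simp [cls]
  rw [← this, cls_eq_iff hx hurwitz.zero_mem, sub_zero]

namespace Clique

variable {s : ℍ} {A : Finset ℍ}

/-- The vectors a - s and their differences have norm 1, which is odd, so the members lie in
distinct nonzero classes modulo `D4`. -/
theorem card_le_three (hA : Clique s A) : A.card ≤ 3 := by
  have h : (Finset.univ.filter fun c : ZMod 2 × ZMod 2 => c ≠ 0).card = 3 := by decide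
  rw [← h]
  refine Finset.card_le_card_of_injOn (fun a => cls (a - s)) (fun a ha => ?_) ?_
  · have hu := hA.mem_units a ha
    simp only [Finset.coe_filter, Finset.mem_univ, true_and, Set.mem_ofPred_eq, ne_eq]
    rw [cls_eq_zero_iff hu.1]
    exact notMem_D4_of_normSq_one hu.1 hu.2
  · intro a ha b hb hab
    by_contra hne
    have h1 := hA.normSq_sub a ha b hb hne
    have h2 := (cls_eq_iff (hA.mem_units a ha).1 (hA.mem_units b hb).1).1 hab
    have e : a - s - (b - s) = a - b := by abel
    rw [e] at h2
    exact notMem_D4_of_normSq_one (D4_subset h2) h1 h2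

/-- The Gram matrix has 1 on the diagonal and 1/2 elsewhere; pairing a relation of total weight zero
with a - s leaves half the weight of a. -/
theorem affineIndependent (hA : Clique s A) : AffineIndependent ℝ ((↑) : A → ℍ) := by
  classical
  rw [affineIndependent_iff]
  intro T w hw hsum i hi
  have h1 : ∑ e ∈ T, w e • ((e : ℍ) - s) = 0 := by
    simp only [smul_sub, Finset.sum_sub_distrib, ← Finset.sum_smul, hw, hsum, zero_smul, sub_zero]
  have h2 := congrArg (fun y => inner ℝ y ((i : ℍ) - s)) h1
  simp only [sum_inner, real_inner_smul_left, inner_zero_left] at h2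
  rw [← Finset.add_sum_erase T _ hi, hA.inner_self i.2, Finset.sum_congr rfl fun e he => by
    rw [hA.inner_eq e.2 i.2 fun h => Finset.ne_of_mem_erase he (Subtype.ext h)],
    ← Finset.sum_mul] at h2
  rw [← Finset.add_sum_erase T _ hi] at hw
  linarith

theorem cellDim_add_one (hA : Clique s A) : cellDim (convexHull ℝ (A : Set ℍ)) + 1 = A.card := by
  have h1 : vectorSpan ℝ (convexHull ℝ (A : Set ℍ)) = vectorSpan ℝ (A : Set ℍ) := by
    rw [← direction_affineSpan, affineSpan_convexHull, direction_affineSpan]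
  have hc : Fintype.card A = (A.card - 1) + 1 := by
    rw [Fintype.card_coe]
    have := hA.nonempty.card_pos
    omega
  have := hA.affineIndependent.finrank_vectorSpan hc
  rw [Subtype.range_coe_subtype] at this
  rw [cellDim, h1]
  have e : {x | x ∈ A} = (A : Set ℍ) := rfl
  rw [e] at this
  rw [this]
  have := hA.nonempty.card_pos
  omega

end Clique

/-! ### The triangles of a facet -/

open Classical in
/-- The triangle with vertices selected by three signs in the facet in direction `t`. -/
def tri (s t : ℍ) (a b c : ℝ) : Finset ℍ := {vI s t a, vJ s t b, vK s t c}

theorem clique_tri {s t : ℍ} (ht : t ∈ roots) {a b c : ℝ} (ha : a = 1 ∨ a = -1)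
    (hb : b = 1 ∨ b = -1) (hc : c = 1 ∨ c = -1) : Clique s (tri s t a b c) := by
  have sq : ∀ e : ℝ, (e = 1 ∨ e = -1) → e ^ 2 = 1 := by
    rintro e (rfl | rfl) <;> norm_num
  have hIJ : normSq (vI s t a - vJ s t b) = 1 := by
    rw [vI, vJ, add_sub_add_left_eq_sub, ← mul_sub, map_mul, ht.2, normSq_coord]
    simp
    linarith [sq a ha, sq b hb]
  have hIK : normSq (vI s t a - vK s t c) = 1 := by
    rw [vI, vK, add_sub_add_left_eq_sub, ← mul_sub, map_mul, ht.2, normSq_coord]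
    simp
    linarith [sq a ha, sq c hc]
  have hJK : normSq (vJ s t b - vK s t c) = 1 := by
    rw [vJ, vK, add_sub_add_left_eq_sub, ← mul_sub, map_mul, ht.2, normSq_coord]
    simp
    linarith [sq b hb, sq c hc]
  refine ⟨⟨vI s t a, by simp [tri]⟩, ?_, ?_⟩
  · intro v hv
    simp only [tri, Finset.mem_insert, Finset.mem_singleton] at hv
    rcases hv with rfl | rfl | rfl
    · exact (vertex_mem ht ha).1
    · exact (vertex_mem ht hb).2.1
    · exact (vertex_mem ht hc).2.2
  · intro v hv w hw hvw
    simp only [tri, Finset.mem_insert, Finset.mem_singleton] at hv hw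
    rcases hv with rfl | rfl | rfl <;> rcases hw with rfl | rfl | rfl <;>
      first
      | exact absurd rfl hvw
      | assumption
      | (rw [← normSq_neg, neg_sub]; assumption)

theorem tri_ne {s t : ℍ} (ht : t ∈ roots) {a b c : ℝ} (ha : a = 1 ∨ a = -1)
    (hb : b = 1 ∨ b = -1) :
    vI s t a ≠ vJ s t b ∧ vI s t a ≠ vK s t c ∧ vJ s t b ≠ vK s t c := by
  have ne : ∀ p q : ℍ, p ≠ q → s + t * p ≠ s + t * q := by
    intro p q hpq h
    refine hpq ?_
    rw [← coord_add_mul ht s p, h, coord_add_mul ht s q]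
  have ha0 : a / 2 ≠ 0 := by rcases ha with rfl | rfl <;> norm_num
  have hb0 : b / 2 ≠ 0 := by rcases hb with rfl | rfl <;> norm_num
  exact ⟨ne _ _ fun h => ha0 (congrArg QuaternionAlgebra.imI h),
    ne _ _ fun h => ha0 (congrArg QuaternionAlgebra.imI h),
    ne _ _ fun h => hb0 (congrArg QuaternionAlgebra.imJ h)⟩

theorem card_tri {s t : ℍ} (ht : t ∈ roots) {a b c : ℝ} (ha : a = 1 ∨ a = -1)
    (hb : b = 1 ∨ b = -1) : (tri s t a b c).card = 3 := by
  classical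
  obtain ⟨hIJ, hIK, hJK⟩ := tri_ne (s := s) (c := c) ht ha hb
  rw [tri, Finset.card_insert_of_notMem (by simp [hIJ, hIK]),
    Finset.card_insert_of_notMem (by simp [hJK]), Finset.card_singleton]

theorem sum_tri {s t : ℍ} (ht : t ∈ roots) {a b c : ℝ} (ha : a = 1 ∨ a = -1)
    (hb : b = 1 ∨ b = -1) : ∑ v ∈ tri s t a b c, v = vI s t a + vJ s t b + vK s t c := by
  classical
  obtain ⟨hIJ, hIK, hJK⟩ := tri_ne (s := s) (c := c) ht ha hb
  rw [tri, Finset.sum_insert (by simp [hIJ, hIK]),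
    Finset.sum_insert (by simp [hJK]), Finset.sum_singleton, add_assoc]

/-- The points of a facet triangle in the coordinates of the facet. -/
theorem mem_hull_tri {s t x : ℍ} {a b c : ℝ} :
    x ∈ convexHull ℝ (tri s t a b c : Set ℍ) ↔ ∃ α β γ : ℝ, 0 ≤ α ∧ 0 ≤ β ∧ 0 ≤ γ ∧
      α + β + γ = 1 ∧ x = s + t * mkq (1 / 2) (α * a / 2) (β * b / 2) (γ * c / 2) := by
  have comb : ∀ α β γ : ℝ, α + β + γ = 1 → α • vI s t a + β • vJ s t b + γ • vK s t c =
      s + t * mkq (1 / 2) (α * a / 2) (β * b / 2) (γ * c / 2) := by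
    intro α β γ h
    have e : mkq (1 / 2) (α * a / 2) (β * b / 2) (γ * c / 2) = α • mkq (1 / 2) (a / 2) 0 0 +
        β • mkq (1 / 2) 0 (b / 2) 0 + γ • mkq (1 / 2) 0 0 (c / 2) := by
      ext <;> simp <;> linarith
    have hs : s = (α + β + γ) • s := by rw [h, one_smul]
    rw [e, mul_add, mul_add, mul_smul_comm, mul_smul_comm, mul_smul_comm]
    conv_rhs => rw [hs]
    rw [vI, vJ, vK]
    module
  constructor
  · intro hx
    rw [tri] at hx
    push_cast at hx
    rw [convexHull_insert (by simp), convexHull_pair] at hx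
    simp only [convexJoin_singleton_left, Set.mem_iUnion] at hx
    obtain ⟨y, ⟨p, q, hp, hq, hpq, rfl⟩, ⟨p', q', hp', hq', hpq', rfl⟩⟩ := hx
    refine ⟨p', q' * p, q' * q, hp', by positivity, by positivity, ?_, ?_⟩
    · rw [add_assoc, ← mul_add, hpq, mul_one, hpq']
    · rw [← comb _ _ _ (by rw [add_assoc, ← mul_add, hpq, mul_one, hpq'])]
      module
  · rintro ⟨α, β, γ, hα, hβ, hγ, h, rfl⟩
    rw [← comb _ _ _ h]
    have hconv := convex_convexHull ℝ (tri s t a b c : Set ℍ)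
    have := hconv.sum_mem (t := Finset.univ) (w := ![α, β, γ])
      (z := ![vI s t a, vJ s t b, vK s t c])
      (by intro i _; fin_cases i <;> simpa) (by simpa [Fin.sum_univ_three] using h)
      (by intro i _; fin_cases i <;> exact subset_convexHull ℝ _ (by simp [tri]))
    simpa [Fin.sum_univ_three] using this

theorem abs_sign_mul {e α : ℝ} (he : e = 1 ∨ e = -1) (hα : 0 ≤ α) : |α * e / 2| = α / 2 := by
  rcases he with rfl | rfl
  · rw [abs_of_nonneg] <;> linarith
  · rw [abs_of_nonpos] <;> linarith

/-- A facet triangle meets no mirror unless its three signs agree. -/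
theorem tri_mem_K {s t : ℍ} (hs : s ∈ D4) (ht : t ∈ roots) {a b c : ℝ} (ha : a = 1 ∨ a = -1)
    (hb : b = 1 ∨ b = -1) (hc : c = 1 ∨ c = -1) (hne : ¬ (a = b ∧ b = c)) :
    convexHull ℝ (tri s t a b c : Set ℍ) ∈ K := by
  refine mem_K_iff.2 ⟨s, hs, _, clique_tri ht ha hb hc, rfl, ?_⟩
  intro x hx
  obtain ⟨α, β, γ, hα, hβ, hγ, h, rfl⟩ := (mem_hull_tri).1 hx
  have e := coord_add_mul ht s (mkq (1 / 2) (α * a / 2) (β * b / 2) (γ * c / 2))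
  have hp : s + t * mkq (1 / 2) (α * a / 2) (β * b / 2) (γ * c / 2) ∈ pyr s t := by
    rw [pyr, Set.mem_ofPred_eq, e, im1]
    simp only [re_mkq, imI_mkq, imJ_mkq, imK_mkq, abs_sign_mul ha hα, abs_sign_mul hb hβ,
      abs_sign_mul hc hγ]
    constructor <;> linarith
  rw [onMirror_iff hs ht hp, e]
  simp only [imI_mkq, imJ_mkq, imK_mkq]
  rintro ⟨h1, h2⟩
  apply hne
  rcases ha with rfl | rfl <;> rcases hb with rfl | rfl <;> rcases hc with rfl | rfl <;>
    first
    | exact ⟨rfl, rfl⟩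
    | (exfalso; linarith)

theorem isTwoDimensional_K : IsTwoDimensional K := by
  constructor
  · intro F hF
    obtain ⟨s, hs, A, hA, rfl, -⟩ := mem_K_iff.1 hF
    have := hA.cellDim_add_one
    have := hA.card_le_three
    omega
  · have ht : mkq 1 1 0 0 ∈ roots :=
      ⟨⟨1, 1, 0, 0, by ext <;> simp, by decide⟩, by norm_num [normSq_coord]⟩
    refine ⟨_, tri_mem_K D4.zero_mem ht (a := 1) (b := 1) (c := -1) (Or.inl rfl) (Or.inl rfl)
      (Or.inr rfl) (by norm_num), ?_⟩
    have h1 := (clique_tri (s := 0) ht (a := 1) (b := 1) (c := -1) (Or.inl rfl) (Or.inl rfl)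
      (Or.inr rfl)).cellDim_add_one
    rw [card_tri ht (Or.inl rfl) (Or.inl rfl)] at h1
    omega

theorem Clique.dist_eq_one {s : ℍ} {A : Finset ℍ} (hA : Clique s A) {a b : ℍ} (ha : a ∈ A)
    (hb : b ∈ A) (hab : a ≠ b) : dist a b = 1 := by
  rw [dist_eq_norm, ← normSq_eq_one_iff, hA.normSq_sub a ha b hb hab]

theorem isEquilateralTriangle_of_mem_K {F : Set ℍ} (hF : F ∈ K) (h2 : cellDim F = 2) :
    IsEquilateralTriangle F := by
  classical
  obtain ⟨s, hs, A, hA, rfl, -⟩ := mem_K_iff.1 hF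
  have hc := hA.cellDim_add_one
  rw [h2] at hc
  obtain ⟨a, b, c, hab, hac, hbc, rfl⟩ := Finset.card_eq_three.1 hc.symm
  have h1 := hA.dist_eq_one (a := a) (b := b) (by simp) (by simp) hab
  have h2 := hA.dist_eq_one (a := b) (b := c) (by simp) (by simp) hbc
  have h3 := hA.dist_eq_one (a := c) (b := a) (by simp) (by simp) hac.symm
  exact ⟨a, b, c, hab, h1.trans h2.symm, h2.trans h3.symm, by push_cast; rfl⟩

/-! ### The retraction on a pyramid -/

/-- The part of the imaginary coordinates that is common to all three of them. -/
def common (z : ℍ) : ℝ :=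
  max (min z.imI (min z.imJ z.imK)) 0 + min (max z.imI (max z.imJ z.imK)) 0

/-- The imaginary part, reduced by the common part of its coordinates. -/
def red (z : ℍ) : ℍ := z - (z.re • mkq 1 0 0 0 + common z • mkq 0 1 1 1)

@[simp] theorem re_red (z : ℍ) : (red z).re = 0 := by simp [red]
@[simp] theorem imI_red (z : ℍ) : (red z).imI = z.imI - common z := by simp [red]
@[simp] theorem imJ_red (z : ℍ) : (red z).imJ = z.imJ - common z := by simp [red]
@[simp] theorem imK_red (z : ℍ) : (red z).imK = z.imK - common z := by simp [red]

/-- Removing the common part kills a coordinate when all three have the same strict sign. This keeps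
the retraction off the interiors of the two removed triangles. -/
theorem red_signs (z : ℍ) :
    ((red z).imI ≤ 0 ∨ (red z).imJ ≤ 0 ∨ (red z).imK ≤ 0) ∧
      (0 ≤ (red z).imI ∨ 0 ≤ (red z).imJ ∨ 0 ≤ (red z).imK) := by
  simp only [imI_red, imJ_red, imK_red, common]
  generalize z.imI = x
  generalize z.imJ = y
  generalize z.imK = w
  grind

theorem common_scale {z z' : ℍ} {c : ℝ} (hc : 0 ≤ c) (hI : z'.imI = c * z.imI)
    (hJ : z'.imJ = c * z.imJ) (hK : z'.imK = c * z.imK) : common z' = c * common z := by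
  rw [common, common, hI, hJ, hK, mul_add, mul_max_of_nonneg _ _ hc, mul_min_of_nonneg _ _ hc,
    mul_min_of_nonneg _ _ hc, mul_min_of_nonneg _ _ hc, mul_max_of_nonneg _ _ hc,
    mul_max_of_nonneg _ _ hc, mul_zero]

theorem im1_eq_zero_iff (z : ℍ) : im1 z = 0 ↔ z.imI = 0 ∧ z.imJ = 0 ∧ z.imK = 0 := by
  unfold im1
  constructor
  · intro h
    have h1 := abs_nonneg z.imI
    have h2 := abs_nonneg z.imJ
    have h3 := abs_nonneg z.imK
    exact ⟨abs_eq_zero.1 (by linarith), abs_eq_zero.1 (by linarith), abs_eq_zero.1 (by linarith)⟩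
  · rintro ⟨h1, h2, h3⟩
    simp [h1, h2, h3]

theorem im1_red_pos {z : ℍ} (h : ¬ (z.imI = z.imJ ∧ z.imJ = z.imK)) : 0 < im1 (red z) := by
  refine lt_of_le_of_ne (im1_nonneg _) fun h0 => h ?_
  obtain ⟨h1, h2, h3⟩ := (im1_eq_zero_iff _).1 h0.symm
  simp only [imI_red, imJ_red, imK_red] at h1 h2 h3
  constructor <;> linarith

/-- The retraction of the pyramid in direction `t` onto the part of the complex in its base. -/
def retr (s t x : ℍ) : ℍ :=
  s + t * (mkq (1 / 2) 0 0 0 + (1 / (2 * im1 (red (coord s t x)))) • red (coord s t x))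

theorem coord_retr {s t : ℍ} (ht : t ∈ roots) (x : ℍ) : coord s t (retr s t x) =
    mkq (1 / 2) 0 0 0 + (1 / (2 * im1 (red (coord s t x)))) • red (coord s t x) :=
  coord_add_mul ht _ _

/-- The retraction ignores the real coordinate and depends only on the ray of the imaginary part. -/
theorem retr_scale {s t p x : ℍ} {c : ℝ} (hc : 0 < c)
    (hI : (coord s t p).imI = c * (coord s t x).imI)
    (hJ : (coord s t p).imJ = c * (coord s t x).imJ)
    (hK : (coord s t p).imK = c * (coord s t x).imK) : retr s t p = retr s t x := by
  have e : red (coord s t p) = c • red (coord s t x) := by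
    have := common_scale hc.le hI hJ hK
    ext <;> simp [hI, hJ, hK, this, mul_sub]
  have e2 : im1 (c • red (coord s t x)) = c * im1 (red (coord s t x)) := by
    simp only [im1, imI_smul, imJ_smul, imK_smul, smul_eq_mul, abs_mul, abs_of_pos hc, mul_add]
  rw [retr, retr, e, e2, smul_smul]
  congr 4
  field_simp

/-- If the chosen signs all agree, the hypotheses force some coordinate to vanish, and the sign of a
zero coordinate may be flipped. -/
theorem exists_signs {x y z : ℝ} (h1 : x ≤ 0 ∨ y ≤ 0 ∨ z ≤ 0) (h2 : 0 ≤ x ∨ 0 ≤ y ∨ 0 ≤ z) :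
    ∃ a b c : ℝ, (a = 1 ∨ a = -1) ∧ (b = 1 ∨ b = -1) ∧ (c = 1 ∨ c = -1) ∧ |x| = a * x ∧
      |y| = b * y ∧ |z| = c * z ∧ ¬ (a = b ∧ b = c) := by
  obtain ⟨a, ha, hx⟩ := exists_sign x
  obtain ⟨b, hb, hy⟩ := exists_sign y
  obtain ⟨c, hc, hz⟩ := exists_sign z
  by_cases h : a = b ∧ b = c
  · obtain ⟨rfl, rfl⟩ := h
    have key : x = 0 ∨ y = 0 ∨ z = 0 := by
      have h3 := abs_nonneg x
      have h4 := abs_nonneg y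
      have h5 := abs_nonneg z
      rw [hx] at h3
      rw [hy] at h4
      rw [hz] at h5
      rcases ha with rfl | rfl
      · rcases h1 with h1 | h1 | h1
        · left; linarith
        · right; left; linarith
        · right; right; linarith
      · rcases h2 with h1 | h1 | h1
        · left; linarith
        · right; left; linarith
        · right; right; linarith
    have hn : -a = 1 ∨ -a = -1 := by rcases ha with rfl | rfl <;> norm_num
    have hne : -a ≠ a := by rcases ha with rfl | rfl <;> norm_num
    rcases key with rfl | rfl | rfl
    · exact ⟨-a, a, a, hn, ha, ha, by simp, hy, hz, fun h => hne h.1⟩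
    · exact ⟨a, -a, a, ha, hn, ha, hx, by simp, hz, fun h => hne h.2⟩
    · exact ⟨a, a, -a, ha, ha, hn, hx, hy, by simp, fun h => hne h.2.symm⟩
  · exact ⟨a, b, c, ha, hb, hc, hx, hy, hz, h⟩

theorem sign_mul_abs {e w : ℝ} (he : e = 1 ∨ e = -1) (hw : |w| = e * w) : |w| * e = w := by
  rw [hw]
  rcases he with rfl | rfl <;> ring

/-- Points of the base of a pyramid lie in the facet triangles given by their signs. -/
theorem mem_hull_tri_of_base {s t x : ℍ} (ht : t ∈ roots) {a b c : ℝ} (ha : a = 1 ∨ a = -1)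
    (hb : b = 1 ∨ b = -1) (hc : c = 1 ∨ c = -1) (ha' : |(coord s t x).imI| = a * (coord s t x).imI)
    (hb' : |(coord s t x).imJ| = b * (coord s t x).imJ)
    (hc' : |(coord s t x).imK| = c * (coord s t x).imK) (h1 : (coord s t x).re = 1 / 2)
    (h2 : im1 (coord s t x) = 1 / 2) : x ∈ convexHull ℝ (tri s t a b c : Set ℍ) := by
  refine mem_hull_tri.2 ⟨2 * |(coord s t x).imI|, 2 * |(coord s t x).imJ|,
    2 * |(coord s t x).imK|, by positivity, by positivity, by positivity, ?_, ?_⟩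
  · rw [im1] at h2
    linarith
  · conv_lhs => rw [← add_mul_coord ht s x]
    congr 2
    have e1 := sign_mul_abs ha ha'
    have e2 := sign_mul_abs hb hb'
    have e3 := sign_mul_abs hc hc'
    ext
    · simpa using h1
    · rw [imI_mkq]; linarith
    · rw [imJ_mkq]; linarith
    · rw [imK_mkq]; linarith

theorem base_coord_retr {s t : ℍ} (ht : t ∈ roots) {x : ℍ} (h : 0 < im1 (red (coord s t x))) :
    (coord s t (retr s t x)).re = 1 / 2 ∧ im1 (coord s t (retr s t x)) = 1 / 2 := by
  rw [coord_retr ht]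
  constructor
  · simp
  · rw [im1]
    simp only [imI_add, imI_mkq, imI_smul, imJ_add, imJ_mkq, imJ_smul, imK_add, imK_mkq, imK_smul,
      zero_add, smul_eq_mul, abs_mul]
    rw [← mul_add, ← mul_add, ← im1, abs_of_pos (by positivity)]
    field_simp

theorem retr_mem {s t x : ℍ} (hs : s ∈ D4) (ht : t ∈ roots)
    (h : 0 < im1 (red (coord s t x))) : retr s t x ∈ ⋃₀ K := by
  obtain ⟨a, b, c, ha, hb, hc, ha', hb', hc', hne⟩ :=
    exists_signs (red_signs (coord s t x)).1 (red_signs (coord s t x)).2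
  refine ⟨_, tri_mem_K hs ht ha hb hc hne, ?_⟩
  obtain ⟨h1, h2⟩ := base_coord_retr ht h
  have hpos : (0 : ℝ) ≤ 1 / (2 * im1 (red (coord s t x))) := by positivity
  refine mem_hull_tri_of_base ht ha hb hc ?_ ?_ ?_ h1 h2
  · rw [coord_retr ht, imI_add, imI_mkq, zero_add, imI_smul, smul_eq_mul, abs_mul,
      abs_of_nonneg hpos, ha']
    ring
  · rw [coord_retr ht, imJ_add, imJ_mkq, zero_add, imJ_smul, smul_eq_mul, abs_mul,
      abs_of_nonneg hpos, hb']
    ring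
  · rw [coord_retr ht, imK_add, imK_mkq, zero_add, imK_smul, smul_eq_mul, abs_mul,
      abs_of_nonneg hpos, hc']
    ring

theorem retr_mem_pyr {s t x : ℍ} (ht : t ∈ roots)
    (h : 0 < im1 (red (coord s t x))) : retr s t x ∈ pyr s t := by
  obtain ⟨h1, h2⟩ := base_coord_retr ht h
  exact ⟨by rw [h1, h2], h1.le⟩

theorem im1_red_coord_pos {s t x : ℍ} (hs : s ∈ D4) (ht : t ∈ roots) (hx : x ∈ pyr s t)
    (hM : ¬ OnMirror x) : 0 < im1 (red (coord s t x)) :=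
  im1_red_pos fun h => hM ((onMirror_iff hs ht hx).2 h)

/-- A cell meeting a pyramid in a point contains the vertices needed to express that point. -/
theorem pyr_extremal {s t x : ℍ} (hs : s ∈ D4) (ht : t ∈ roots) (hx : x ∈ pyr s t)
    {s' : ℍ} {A : Finset ℍ} (hs' : s' ∈ D4) (hA : Clique s' A)
    (hxA : x ∈ convexHull ℝ (A : Set ℍ)) {a b c : ℝ}
    (ha : |(coord s t x).imI| = a * (coord s t x).imI) (ha' : a = 1 ∨ a = -1)
    (hb : |(coord s t x).imJ| = b * (coord s t x).imJ) (hb' : b = 1 ∨ b = -1)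
    (hc : |(coord s t x).imK| = c * (coord s t x).imK) (hc' : c = 1 ∨ c = -1) :
    ((coord s t x).re < 1 / 2 → s ∈ convexHull ℝ (A : Set ℍ)) ∧
    (im1 (coord s t x) < (coord s t x).re →
      s + t * mkq (1 / 2) 0 0 0 ∈ convexHull ℝ (A : Set ℍ)) ∧
    ((coord s t x).imI ≠ 0 → vI s t a ∈ A) ∧ ((coord s t x).imJ ≠ 0 → vJ s t b ∈ A) ∧
    ((coord s t x).imK ≠ 0 → vK s t c ∈ A) := by
  have hdec := pyr_decomposition ht x ha ha' hb hb' hc hc'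
  have hI := mem_vert.2 (vertex_mem (s := s) ht ha').1
  have hJ := mem_vert.2 (vertex_mem (s := s) ht hb').2.1
  have hK := mem_vert.2 (vertex_mem (s := s) ht hc').2.2
  have hmid : s + t * mkq (1 / 2) 0 0 0 ∈ vor s := by
    refine pyr_subset_vor hs ht ?_
    rw [pyr, Set.mem_ofPred_eq, coord_add_mul ht]
    simp [im1]
  have hss : s ∈ vor s := by
    refine pyr_subset_vor hs ht ?_
    rw [pyr, Set.mem_ofPred_eq, coord]
    simp [im1]
  obtain ⟨hx1, hx2⟩ := hx
  have hsum : ∑ i, (![1 - 2 * (coord s t x).re, 2 * ((coord s t x).re - im1 (coord s t x)),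
      2 * |(coord s t x).imI|, 2 * |(coord s t x).imJ|, 2 * |(coord s t x).imK|] : Fin 5 → ℝ) i •
      (![s, s + t * mkq (1 / 2) 0 0 0, vI s t a, vJ s t b, vK s t c] : Fin 5 → ℍ) i = x := by
    rw [Fin.sum_univ_five]
    exact hdec.symm
  have key := fun j : Fin 5 => hA.mem_hull_of_combination hs' hs Finset.univ
    ![1 - 2 * (coord s t x).re, 2 * ((coord s t x).re - im1 (coord s t x)),
      2 * |(coord s t x).imI|, 2 * |(coord s t x).imJ|, 2 * |(coord s t x).imK|]
    ![s, s + t * mkq (1 / 2) 0 0 0, vI s t a, vJ s t b, vK s t c]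
    (by
      intro i _
      fin_cases i
      · change 0 ≤ 1 - 2 * (coord s t x).re; linarith
      · change 0 ≤ 2 * ((coord s t x).re - im1 (coord s t x)); linarith
      · change 0 ≤ 2 * |(coord s t x).imI|; positivity
      · change 0 ≤ 2 * |(coord s t x).imJ|; positivity
      · change 0 ≤ 2 * |(coord s t x).imK|; positivity)
    (by
      rw [Fin.sum_univ_five]
      change 1 - 2 * (coord s t x).re + 2 * ((coord s t x).re - im1 (coord s t x)) +
        2 * |(coord s t x).imI| + 2 * |(coord s t x).imJ| + 2 * |(coord s t x).imK| = 1
      rw [im1]; ring)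
    (by
      intro i _
      fin_cases i
      · exact hss
      · exact hmid
      · exact vert_subset_vor hs hI
      · exact vert_subset_vor hs hJ
      · exact vert_subset_vor hs hK)
    (by rw [hsum]; exact hxA) (Finset.mem_univ j)
  refine ⟨fun h => key 0 ?_, fun h => key 1 ?_, fun h => hA.vert_of_mem_hull hs' hs hI (key 2 ?_),
    fun h => hA.vert_of_mem_hull hs' hs hJ (key 3 ?_),
    fun h => hA.vert_of_mem_hull hs' hs hK (key 4 ?_)⟩
  · change 0 < 1 - 2 * (coord s t x).re; linarith
  · change 0 < 2 * ((coord s t x).re - im1 (coord s t x)); linarith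
  · change 0 < 2 * |(coord s t x).imI|; positivity
  · change 0 < 2 * |(coord s t x).imJ|; positivity
  · change 0 < 2 * |(coord s t x).imK|; positivity

/-- The barycentre of a facet triangle with constant sign. -/
theorem barycentre_eq (s t : ℍ) (e : ℝ) : (1 / 3 : ℝ) • (vI s t e + vJ s t e + vK s t e) =
    s + t * mkq (1 / 2) (e / 6) (e / 6) (e / 6) := by
  have h : mkq (1 / 2) (e / 6) (e / 6) (e / 6) = (1 / 3 : ℝ) • (mkq (1 / 2) (e / 2) 0 0 +
      mkq (1 / 2) 0 (e / 2) 0 + mkq (1 / 2) 0 0 (e / 2)) := by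
    ext <;> simp <;> ring
  rw [h, vI, vJ, vK, mul_smul_comm, mul_add, mul_add]
  module

theorem barycentre_mem_pyr {s t : ℍ} (ht : t ∈ roots) {e : ℝ} (he : e = 1 ∨ e = -1) :
    s + t * mkq (1 / 2) (e / 6) (e / 6) (e / 6) ∈ pyr s t := by
  rw [pyr, Set.mem_ofPred_eq, coord_add_mul ht, im1]
  simp only [imI_mkq, imJ_mkq, imK_mkq, re_mkq]
  rcases he with rfl | rfl <;> norm_num [abs_div]

theorem onMirror_barycentre {s t : ℍ} (hs : s ∈ D4) (ht : t ∈ roots) {e : ℝ}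
    (he : e = 1 ∨ e = -1) : OnMirror (s + t * mkq (1 / 2) (e / 6) (e / 6) (e / 6)) := by
  rw [onMirror_iff hs ht (barycentre_mem_pyr ht he), coord_add_mul ht]
  simp

theorem barycentre_mem_hull {s t : ℍ} {A : Finset ℍ} {e : ℝ} (h1 : vI s t e ∈ A)
    (h2 : vJ s t e ∈ A) (h3 : vK s t e ∈ A) :
    s + t * mkq (1 / 2) (e / 6) (e / 6) (e / 6) ∈ convexHull ℝ (A : Set ℍ) := by
  have := (convex_convexHull ℝ (A : Set ℍ)).sum_mem (t := Finset.univ)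
    (w := fun _ : Fin 3 => (1 / 3 : ℝ)) (z := ![vI s t e, vJ s t e, vK s t e])
    (fun _ _ => by norm_num) (by simp)
    (by intro i _; fin_cases i <;> exact subset_convexHull ℝ _ (by simpa))
  rw [← barycentre_eq]
  simpa [Fin.sum_univ_three, smul_add] using this

/-! ### Gluing the retractions -/

theorem common_eq_zero_or (z : ℍ) : common z = 0 ∨
    (0 < z.imI ∧ 0 < z.imJ ∧ 0 < z.imK) ∨ (z.imI < 0 ∧ z.imJ < 0 ∧ z.imK < 0) := by
  rw [common]
  generalize z.imI = x
  generalize z.imJ = y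
  generalize z.imK = w
  grind

theorem not_onMirror_of_mem {x : ℍ} (hx : x ∈ ⋃₀ K) : ¬ OnMirror x := by
  obtain ⟨F, hF, hxF⟩ := hx
  obtain ⟨s, hs, A, hA, rfl, hM⟩ := mem_K_iff.1 hF
  exact hM x hxF

/-- Points of the complex lie in the bases of the pyramids and are fixed by the retractions. -/
theorem retr_of_mem {s t x : ℍ} (hs : s ∈ D4) (ht : t ∈ roots) (hx : x ∈ pyr s t)
    (hxK : x ∈ ⋃₀ K) : retr s t x = x := by
  obtain ⟨F, hF, hxF⟩ := hxK
  obtain ⟨s', hs', A, hA, rfl, hM⟩ := mem_K_iff.1 hF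
  obtain ⟨a, ha, ha'⟩ := exists_sign (coord s t x).imI
  obtain ⟨b, hb, hb'⟩ := exists_sign (coord s t x).imJ
  obtain ⟨c, hc, hc'⟩ := exists_sign (coord s t x).imK
  obtain ⟨k1, k2, k3, k4, k5⟩ := pyr_extremal hs ht hx hs' hA hxF ha' ha hb' hb hc' hc
  have hre : (coord s t x).re = 1 / 2 :=
    le_antisymm hx.2 (not_lt.1 fun h => hM _ (k1 h) (onMirror_of_mem_D4 hs))
  have him : im1 (coord s t x) = 1 / 2 := by
    rw [← hre]
    exact le_antisymm hx.1 (not_lt.1 fun h => hM _ (k2 h) (onMirror_half_root hs ht))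
  have hcom : common (coord s t x) = 0 := by
    rcases common_eq_zero_or (coord s t x) with h | ⟨h1, h2, h3⟩ | ⟨h1, h2, h3⟩
    · exact h
    · exfalso
      have ea : a = 1 := by
        rw [abs_of_pos h1] at ha'
        exact mul_right_cancel₀ h1.ne' (by linarith)
      have eb : b = 1 := by
        rw [abs_of_pos h2] at hb'
        exact mul_right_cancel₀ h2.ne' (by linarith)
      have ec : c = 1 := by
        rw [abs_of_pos h3] at hc'
        exact mul_right_cancel₀ h3.ne' (by linarith)
      subst ea eb ec
      exact hM _ (barycentre_mem_hull (k3 h1.ne') (k4 h2.ne') (k5 h3.ne'))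
        (onMirror_barycentre hs ht ha)
    · exfalso
      have ea : a = -1 := by
        rw [abs_of_neg h1] at ha'
        exact mul_right_cancel₀ h1.ne (by linarith)
      have eb : b = -1 := by
        rw [abs_of_neg h2] at hb'
        exact mul_right_cancel₀ h2.ne (by linarith)
      have ec : c = -1 := by
        rw [abs_of_neg h3] at hc'
        exact mul_right_cancel₀ h3.ne (by linarith)
      subst ea eb ec
      exact hM _ (barycentre_mem_hull (k3 h1.ne) (k4 h2.ne) (k5 h3.ne))
        (onMirror_barycentre hs ht ha)
  have e : red (coord s t x) = mkq 0 (coord s t x).imI (coord s t x).imJ (coord s t x).imK := by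
    ext <;> simp [hcom]
  have e2 : im1 (mkq 0 (coord s t x).imI (coord s t x).imJ (coord s t x).imK) = 1 / 2 := him
  rw [retr, e, e2]
  conv_rhs => rw [← add_mul_coord ht s x]
  congr 2
  ext <;> simp [hre]

theorem im1_red_of_sign {z : ℍ} {e : ℝ} (he : e = 1 ∨ e = -1) (hI : 0 < e * z.imI)
    (hJ : 0 < e * z.imJ) (hK : 0 < e * z.imK) : im1 (red z) = im1 z - 3 * (e * common z) := by
  simp only [im1, imI_red, imJ_red, imK_red]
  rcases he with rfl | rfl
  · have h : common z = min z.imI (min z.imJ z.imK) := by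
      rw [common, max_eq_left (le_min (by linarith) (le_min (by linarith) (by linarith))),
        min_eq_right (le_max_of_le_left (by linarith)), add_zero]
    have h1 : common z ≤ z.imI := h ▸ min_le_left _ _
    have h2 : common z ≤ z.imJ := h ▸ (min_le_right _ _).trans (min_le_left _ _)
    have h3 : common z ≤ z.imK := h ▸ (min_le_right _ _).trans (min_le_right _ _)
    rw [abs_of_nonneg (by linarith : 0 ≤ z.imI - common z),
      abs_of_nonneg (by linarith : 0 ≤ z.imJ - common z),
      abs_of_nonneg (by linarith : 0 ≤ z.imK - common z), abs_of_nonneg (by linarith : 0 ≤ z.imI),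
      abs_of_nonneg (by linarith : 0 ≤ z.imJ), abs_of_nonneg (by linarith : 0 ≤ z.imK)]
    ring
  · have h : common z = max z.imI (max z.imJ z.imK) := by
      rw [common, max_eq_right (min_le_of_left_le (by linarith)),
        min_eq_left (max_le (by linarith) (max_le (by linarith) (by linarith))), zero_add]
    have h1 : z.imI ≤ common z := h ▸ le_max_left _ _
    have h2 : z.imJ ≤ common z := h ▸ (le_max_left _ _).trans (le_max_right _ _)
    have h3 : z.imK ≤ common z := h ▸ (le_max_right _ _).trans (le_max_right _ _)
    rw [abs_of_nonpos (by linarith : z.imI - common z ≤ 0),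
      abs_of_nonpos (by linarith : z.imJ - common z ≤ 0),
      abs_of_nonpos (by linarith : z.imK - common z ≤ 0), abs_of_nonpos (by linarith : z.imI ≤ 0),
      abs_of_nonpos (by linarith : z.imJ ≤ 0), abs_of_nonpos (by linarith : z.imK ≤ 0)]
    ring

/-- Points of the bases of the pyramids outside of the complex lie in the interior of a facet
triangle with constant sign, and are retracted away from its barycentre. -/
theorem exists_cone {s t x : ℍ} (hs : s ∈ D4) (ht : t ∈ roots) (hx : x ∈ pyr s t)
    (hre : (coord s t x).re = 1 / 2) (him : im1 (coord s t x) = 1 / 2) (hM : ¬ OnMirror x)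
    (hxK : x ∉ ⋃₀ K) : ∃ e θ : ℝ, (e = 1 ∨ e = -1) ∧ x ∈ convexHull ℝ (tri s t e e e : Set ℍ) ∧
      (∀ s' ∈ D4, ∀ A, Clique s' A → x ∈ convexHull ℝ (A : Set ℍ) → tri s t e e e ⊆ A) ∧
      θ < 1 ∧ x = (1 - θ) • retr s t x + θ • (s + t * mkq (1 / 2) (e / 6) (e / 6) (e / 6)) := by
  have hpos := im1_red_coord_pos hs ht hx hM
  have hcom : ∃ e : ℝ, (e = 1 ∨ e = -1) ∧ 0 < e * (coord s t x).imI ∧ 0 < e * (coord s t x).imJ ∧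
      0 < e * (coord s t x).imK := by
    have : ¬ (((coord s t x).imI ≤ 0 ∨ (coord s t x).imJ ≤ 0 ∨ (coord s t x).imK ≤ 0) ∧
        (0 ≤ (coord s t x).imI ∨ 0 ≤ (coord s t x).imJ ∨ 0 ≤ (coord s t x).imK)) := by
      rintro ⟨h1, h2⟩
      obtain ⟨a, b, c, ha, hb, hc, ha', hb', hc', hne⟩ := exists_signs h1 h2
      exact hxK ⟨_, tri_mem_K hs ht ha hb hc hne,
        mem_hull_tri_of_base ht ha hb hc ha' hb' hc' hre him⟩
    by_cases h : (coord s t x).imI ≤ 0 ∨ (coord s t x).imJ ≤ 0 ∨ (coord s t x).imK ≤ 0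
    · have h2 : ¬ (0 ≤ (coord s t x).imI ∨ 0 ≤ (coord s t x).imJ ∨ 0 ≤ (coord s t x).imK) :=
        fun h' => this ⟨h, h'⟩
      push Not at h2
      exact ⟨-1, Or.inr rfl, by linarith, by linarith, by linarith⟩
    · push Not at h
      exact ⟨1, Or.inl rfl, by linarith, by linarith, by linarith⟩
  obtain ⟨e, he, hI, hJ, hK⟩ := hcom
  have he2 : e * e = 1 := by rcases he with rfl | rfl <;> norm_num
  have abs_eq : ∀ w : ℝ, 0 < e * w → |w| = e * w := by
    intro w hw
    rcases he with rfl | rfl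
    · rw [abs_of_pos (by linarith)]; ring
    · rw [abs_of_neg (by linarith)]; ring
  have ne : ∀ w : ℝ, 0 < e * w → w ≠ 0 := by
    rintro w hw rfl
    simp at hw
  have hredabs : im1 (red (coord s t x)) = 1 / 2 - 3 * (e * common (coord s t x)) := by
    rw [← him, im1_red_of_sign he hI hJ hK]
  -- The parameter is fixed by θ · e/6 = `common`: the barycentre accounts for the common part, and
  -- what remains is `red`, with 2 · im1 = 1 - θ.
  refine ⟨e, 6 * (e * common (coord s t x)), he,
    mem_hull_tri_of_base ht he he he (abs_eq _ hI) (abs_eq _ hJ) (abs_eq _ hK) hre him, ?_,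
    by linarith, ?_⟩
  · intro s' hs' A hA hxA
    obtain ⟨-, -, k3, k4, k5⟩ :=
      pyr_extremal hs ht hx hs' hA hxA (abs_eq _ hI) he (abs_eq _ hJ) he (abs_eq _ hK) he
    intro v hv
    simp only [tri, Finset.mem_insert, Finset.mem_singleton] at hv
    rcases hv with rfl | rfl | rfl
    · exact k3 (ne _ hI)
    · exact k4 (ne _ hJ)
    · exact k5 (ne _ hK)
  · set m := common (coord s t x) with hm
    have h6 : 1 - 6 * (e * m) ≠ 0 := by intro h; linarith
    have hz : coord s t x = (1 - 6 * (e * m)) • (mkq (1 / 2) 0 0 0 +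
        (1 / (2 * im1 (red (coord s t x)))) • red (coord s t x)) +
        (6 * (e * m)) • mkq (1 / 2) (e / 6) (e / 6) (e / 6) := by
      have h2 : 2 * im1 (red (coord s t x)) = 1 - 6 * (e * m) := by rw [hredabs]; ring
      have h3 : 6 * (e * m) * (e / 6) = m := by linear_combination m * he2
      rw [h2]
      ext
      · simp [hre]
        ring
      · simp [← hm, h3, mul_inv_cancel_left₀ h6]
      · simp [← hm, h3, mul_inv_cancel_left₀ h6]
      · simp [← hm, h3, mul_inv_cancel_left₀ h6]
    have := add_mul_coord ht s x
    rw [hz, mul_add, mul_smul_comm, mul_smul_comm] at this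
    conv_lhs => rw [← this]
    rw [retr]
    module

/-- If θ < θ', then y is a convex combination of y' and c with positive weight on c. Both lie in one
Voronoi cell, where the cell of y is extreme, so that cell would contain the mirror point c. -/
theorem cone_unique {s' x y y' c : ℍ} {θ θ' : ℝ} (hs' : s' ∈ D4) (hy : y ∈ ⋃₀ K)
    (hy' : y' ∈ vor s') (hc : c ∈ vor s') (hcM : OnMirror c) (hθ' : θ' < 1)
    (h : x = (1 - θ) • y + θ • c) (h' : x = (1 - θ') • y' + θ' • c) : θ' ≤ θ := by
  by_contra hlt
  push Not at hlt
  obtain ⟨F, hF, hyF⟩ := hy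
  obtain ⟨s₁, hs₁, A, hA, rfl, hM⟩ := mem_K_iff.1 hF
  refine hM c ?_ hcM
  have h1 : 0 < 1 - θ := by linarith
  have hy2 : y = ((1 - θ') / (1 - θ)) • y' + ((θ' - θ) / (1 - θ)) • c := by
    have : (1 - θ) • y = (1 - θ') • y' + (θ' - θ) • c := by
      have := h.symm.trans h'
      rw [← eq_sub_iff_add_eq] at this
      rw [this]
      module
    rw [← inv_smul_smul₀ h1.ne' y, this, smul_add, smul_smul, smul_smul]
    congr 2 <;> field_simp
  have := hA.mem_hull_of_combination hs₁ hs' Finset.univ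
    ![(1 - θ') / (1 - θ), (θ' - θ) / (1 - θ)] ![y', c]
    (by
      intro i _
      fin_cases i
      · exact div_nonneg (by linarith) h1.le
      · exact div_nonneg (by linarith) h1.le)
    (by
      rw [Fin.sum_univ_two]
      change (1 - θ') / (1 - θ) + (θ' - θ) / (1 - θ) = 1
      field_simp
      ring)
    (by intro i _; fin_cases i <;> assumption)
    (by
      rw [Fin.sum_univ_two]
      change ((1 - θ') / (1 - θ)) • y' + ((θ' - θ) / (1 - θ)) • c ∈ _
      rwa [← hy2]) (Finset.mem_univ 1)
    (div_pos (by linarith) h1)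
  exact this

/-- The retractions agree on the common points of the bases of two pyramids. -/
theorem retr_eq_of_base {s t s' t' x : ℍ} (hs : s ∈ D4) (ht : t ∈ roots) (hs' : s' ∈ D4)
    (ht' : t' ∈ roots) (hx : x ∈ pyr s t) (hx' : x ∈ pyr s' t') (hM : ¬ OnMirror x)
    (hre : (coord s t x).re = 1 / 2) (him : im1 (coord s t x) = 1 / 2)
    (hre' : (coord s' t' x).re = 1 / 2) (him' : im1 (coord s' t' x) = 1 / 2) :
    retr s t x = retr s' t' x := by
  by_cases hxK : x ∈ ⋃₀ K
  · rw [retr_of_mem hs ht hx hxK, retr_of_mem hs' ht' hx' hxK]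
  obtain ⟨e, θ, he, hxA, hA, hθ, hcone⟩ := exists_cone hs ht hx hre him hM hxK
  obtain ⟨e', θ', he', hxA', hA', hθ', hcone'⟩ := exists_cone hs' ht' hx' hre' him' hM hxK
  -- Each triangle has x in its relative interior, so it is contained in every clique whose hull
  -- contains x; hence the two triangles and their barycentres coincide.
  have hAA : tri s t e e e = tri s' t' e' e' e' :=
    Finset.Subset.antisymm (hA _ hs' _ (clique_tri ht' he' he' he') hxA')
      (hA' _ hs _ (clique_tri ht he he he) hxA)
  have hc : s + t * mkq (1 / 2) (e / 6) (e / 6) (e / 6) =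
      s' + t' * mkq (1 / 2) (e' / 6) (e' / 6) (e' / 6) := by
    rw [← barycentre_eq, ← barycentre_eq, ← sum_tri ht he he, ← sum_tri ht' he' he', hAA]
  have hp := im1_red_coord_pos hs ht hx hM
  have hp' := im1_red_coord_pos hs' ht' hx' hM
  have hb := barycentre_mem_pyr (s := s) ht he
  have hb' := barycentre_mem_pyr (s := s') ht' he'
  have hbM := onMirror_barycentre hs ht he
  rw [← hc] at hb' hcone'
  have h1 := cone_unique hs' (retr_mem hs ht hp) (pyr_subset_vor hs' ht' (retr_mem_pyr ht' hp'))
    (pyr_subset_vor hs' ht' hb') hbM hθ' hcone hcone'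
  have h2 := cone_unique hs (retr_mem hs' ht' hp') (pyr_subset_vor hs ht (retr_mem_pyr ht hp))
    (pyr_subset_vor hs ht hb) hbM hθ hcone' hcone
  obtain rfl := le_antisymm h2 h1
  have h3 := hcone.symm.trans hcone'
  exact smul_right_injective ℍ (sub_pos.2 hθ).ne' (add_right_cancel h3)

theorem coord_opposite {s t : ℍ} (ht : t ∈ roots) (x : ℍ) :
    coord (s + t) (-t) x = 1 - coord s t x := by
  have h : star t * (x - (s + t)) = star t * (x - s) - star t * t := by noncomm_ring
  rw [coord, coord, star_neg, neg_mul, h, star_mul_self_of_root ht, two_eq_smul]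
  module

/-- The retractions agree on the common points of two pyramids. -/
theorem retr_eq {s t s' t' x : ℍ} (hs : s ∈ D4) (ht : t ∈ roots) (hs' : s' ∈ D4)
    (ht' : t' ∈ roots) (hx : x ∈ pyr s t) (hx' : x ∈ pyr s' t') (hM : ¬ OnMirror x) :
    retr s t x = retr s' t' x := by
  have hr0 : ∀ {t}, t ∈ roots → t ≠ 0 := by
    rintro _ h rfl
    have := h.2
    simp at this
  by_cases hss : s = s'
  · subst hss
    by_cases htt : t = t'
    · rw [htt]
    have hq : s + t' ≠ s + t := fun h => htt (add_left_cancel h).symm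
    have hqs : s + t' ≠ s := by simpa using hr0 ht'
    have hqs2 : s + t ≠ s := by simpa using hr0 ht
    -- Each pyramid bounds the distance to the other one's neighbouring lattice point; together the
    -- bounds force equal real parts and im1 = re, so x lies on the sides of both pyramids and can
    -- be moved radially to the bases.
    have f1 := normSq_far hs ht hx (add_root_mem_D4 hs ht') hqs hq
    have f2 := normSq_far hs ht' hx' (add_root_mem_D4 hs ht) hqs2 hq.symm
    rw [normSq_near ht'] at f1
    rw [normSq_near ht] at f2
    have g1 := hx.1
    have g2 := hx'.1
    have e1 : (coord s t x).re = (coord s t' x).re := by linarith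
    have e2 : im1 (coord s t x) = (coord s t x).re := by linarith
    have e3 : im1 (coord s t' x) = (coord s t' x).re := by linarith
    have hpos : 0 < (coord s t x).re := by
      refine lt_of_le_of_ne (by rw [← e2]; exact im1_nonneg _) fun h => hM ?_
      rw [← h] at e2
      obtain ⟨h1, h2, h3⟩ := (im1_eq_zero_iff _).1 e2
      rw [onMirror_iff hs ht hx, h1, h2, h3]
      simp
    -- Project to the bases from the apex.
    set k := 1 / (2 * (coord s t x).re) with hk
    have hkpos : 0 < k := by positivity
    have hkre : k * (coord s t x).re = 1 / 2 := by rw [hk]; field_simp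
    set p := s + k • (x - s) with hp
    have hc : ∀ t, coord s t p = k • coord s t x := by
      intro t
      rw [hp, coord, coord, add_sub_cancel_left, mul_smul_comm, smul_comm]
    have him : ∀ t, im1 (coord s t p) = k * im1 (coord s t x) := by
      intro t
      rw [hc, im1, im1]
      simp only [imI_smul, imJ_smul, imK_smul, smul_eq_mul, abs_mul, abs_of_pos hkpos, mul_add]
    have r1 : (coord s t p).re = 1 / 2 := by rw [hc, re_smul, smul_eq_mul, hkre]
    have r2 : (coord s t' p).re = 1 / 2 := by rw [hc, re_smul, smul_eq_mul, ← e1, hkre]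
    have i1 : im1 (coord s t p) = 1 / 2 := by rw [him, e2, hkre]
    have i2 : im1 (coord s t' p) = 1 / 2 := by rw [him, e3, ← e1, hkre]
    have p1 : p ∈ pyr s t := ⟨by rw [r1, i1], r1.le⟩
    have p2 : p ∈ pyr s t' := ⟨by rw [r2, i2], r2.le⟩
    have hpM : ¬ OnMirror p := by
      rw [onMirror_iff hs ht p1, hc]
      rw [onMirror_iff hs ht hx] at hM
      simpa [hkpos.ne'] using hM
    have s1 : retr s t p = retr s t x := retr_scale hkpos (by simp [hc]) (by simp [hc]) (by simp [hc])
    have s2 : retr s t' p = retr s t' x :=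
      retr_scale hkpos (by simp [hc]) (by simp [hc]) (by simp [hc])
    rw [← s1, ← s2]
    exact retr_eq_of_base hs ht hs ht' p1 p2 hpM r1 i1 r2 i2
  · have d : normSq (x - s) = normSq (x - s') := by
      have d1 := mem_vor.1 (pyr_subset_vor hs ht hx) s' hs'
      have d2 := mem_vor.1 (pyr_subset_vor hs' ht' hx') s hs
      linarith
    -- Now x is equidistant from s and s'. Unless the pyramids are the two halves over one facet,
    -- some lattice point other than s and s + t is also nearest to x, and equality in `normSq_far`
    -- puts x on the boundary of the base.
    have base : ∀ {s t s' t'}, s ∈ D4 → t ∈ roots → s' ∈ D4 → t' ∈ roots → x ∈ pyr s t →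
        x ∈ pyr s' t' → s ≠ s' → normSq (x - s) = normSq (x - s') →
        ¬ (s' = s + t ∧ s = s' + t') → (coord s t x).re = 1 / 2 ∧ im1 (coord s t x) = 1 / 2 := by
      intro s t s' t' hs ht hs' ht' hx hx' hss d hn
      have g1 := hx.1
      have g2 := hx.2
      have g3 := hx'.1
      have g4 := hx'.2
      by_cases h : s' = s + t
      · have n1 := normSq_near (s := s) ht x
        rw [← h] at n1
        have h' : s ≠ s' + t' := fun h' => hn ⟨h, h'⟩
        have f1 := normSq_far hs' ht' hx' hs hss h'
        have f2 := normSq_far hs ht hx (add_root_mem_D4 hs' ht') h'.symm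
          (by rw [← h]; simpa using hr0 ht')
        have n2 := normSq_near (s := s') ht' x
        constructor <;> linarith
      · have f := normSq_far hs ht hx hs' (Ne.symm hss) h
        constructor <;> linarith
    by_cases hopp : s' = s + t ∧ s = s' + t'
    · obtain ⟨rfl, h⟩ := hopp
      have : t' = -t := by
        rw [add_assoc, left_eq_add] at h
        exact eq_neg_of_add_eq_zero_right h
      subst this
      -- The two pyramids over one facet are related by z ↦ 1 - z, under which `red` is odd; as t
      -- changes sign too, both formulas give the same point.
      have hcom : common (1 - coord s t x) = -common (coord s t x) := by
        simp only [common, imI_sub, imJ_sub, imK_sub, imI_one, imJ_one, imK_one, zero_sub]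
        generalize (coord s t x).imI = x
        generalize (coord s t x).imJ = y
        generalize (coord s t x).imK = w
        grind
      have hred : red (1 - coord s t x) = -red (coord s t x) := by
        ext <;> simp [hcom] <;> ring
      have him : im1 (-red (coord s t x)) = im1 (red (coord s t x)) := by
        simp only [im1, imI_neg, imJ_neg, imK_neg, abs_neg]
      rw [retr, retr, coord_opposite ht, hred, him]
      have h2 : t = t * ((2 : ℝ) • mkq (1 / 2) 0 0 0) := by
        have : (2 : ℝ) • mkq (1 / 2) 0 0 0 = 1 := by ext <;> simp
        rw [this, mul_one]
      rw [smul_neg, neg_mul, mul_add, mul_add, mul_neg]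
      rw [mul_smul_comm] at h2
      nth_rw 5 [h2]
      module
    · obtain ⟨r1, i1⟩ := base hs ht hs' ht' hx hx' hss d hopp
      obtain ⟨r2, i2⟩ := base hs' ht' hs ht hx' hx (Ne.symm hss) d.symm fun h => hopp ⟨h.2, h.1⟩
      exact retr_eq_of_base hs ht hs' ht' hx hx' hM r1 i1 r2 i2

/-- The segment from a point to its image under the retraction avoids the mirrors. -/
theorem not_onMirror_segment {s t x : ℍ} (hs : s ∈ D4) (ht : t ∈ roots) (hx : x ∈ pyr s t)
    (hM : ¬ OnMirror x) {τ : ℝ} (h0 : 0 ≤ τ) (h1 : τ ≤ 1) :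
    ¬ OnMirror ((1 - τ) • x + τ • retr s t x) := by
  have hp := im1_red_coord_pos hs ht hx hM
  have hc : coord s t ((1 - τ) • x + τ • retr s t x) =
      (1 - τ) • coord s t x + τ • coord s t (retr s t x) := by
    have : (1 - τ) • x + τ • retr s t x - s = (1 - τ) • (x - s) + τ • (retr s t x - s) := by module
    rw [coord, this, mul_add, mul_smul_comm, mul_smul_comm, coord, coord]
    module
  have hr := retr_mem_pyr ht hp
  have hmem : (1 - τ) • x + τ • retr s t x ∈ pyr s t := by
    obtain ⟨a1, a2⟩ := hx
    obtain ⟨b1, b2⟩ := hr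
    have c0 : 0 ≤ 1 - τ := by linarith
    rw [pyr, Set.mem_ofPred_eq, hc]
    constructor
    · have : im1 ((1 - τ) • coord s t x + τ • coord s t (retr s t x)) ≤
          (1 - τ) * im1 (coord s t x) + τ * im1 (coord s t (retr s t x)) := by
        have key : ∀ a b : ℝ, |(1 - τ) * a + τ * b| ≤ (1 - τ) * |a| + τ * |b| := by
          intro a b
          refine (abs_add_le _ _).trans ?_
          rw [abs_mul, abs_mul, abs_of_nonneg c0, abs_of_nonneg h0]
        simp only [im1, imI_add, imJ_add, imK_add, imI_smul, imJ_smul, imK_smul, smul_eq_mul]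
        have k1 := key (coord s t x).imI (coord s t (retr s t x)).imI
        have k2 := key (coord s t x).imJ (coord s t (retr s t x)).imJ
        have k3 := key (coord s t x).imK (coord s t (retr s t x)).imK
        linarith
      simp only [re_add, re_smul, smul_eq_mul]
      have := mul_le_mul_of_nonneg_left a1 c0
      have := mul_le_mul_of_nonneg_left b1 h0
      linarith
    · simp only [re_add, re_smul, smul_eq_mul]
      have := mul_le_mul_of_nonneg_left a2 c0
      have := mul_le_mul_of_nonneg_left b2 h0
      linarith
  rw [onMirror_iff hs ht hmem, hc, coord_retr ht]
  rw [onMirror_iff hs ht hx] at hM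
  rintro ⟨e1, e2⟩
  set k := 1 / (2 * im1 (red (coord s t x))) with hk
  have hkpos : 0 < k := by positivity
  -- Along the segment the differences of the imaginary coordinates are those of x multiplied by
  -- this positive factor, so they cannot all vanish.
  have hpos : 0 < 1 - τ + τ * k := by
    rcases h0.eq_or_lt with rfl | h
    · norm_num
    · have := mul_pos h hkpos
      linarith
  simp only [imI_add, imJ_add, imK_add, imI_smul, imJ_smul, imK_smul, imI_mkq, imJ_mkq, imK_mkq,
    imI_red, imJ_red, imK_red, smul_eq_mul, zero_add] at e1 e2
  exact hM ⟨mul_left_cancel₀ hpos.ne' (by linarith), mul_left_cancel₀ hpos.ne' (by linarith)⟩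

/-! ### Continuity and the deformation -/

theorem continuous_coord (s t : ℍ) : Continuous (coord s t) := by
  unfold coord
  fun_prop

theorem continuous_im1 : Continuous im1 := by
  unfold im1
  have := continuous_imI
  have := continuous_imJ
  have := continuous_imK
  fun_prop

theorem continuous_red : Continuous red := by
  unfold red common
  have := continuous_re
  have := continuous_imI
  have := continuous_imJ
  have := continuous_imK
  fun_prop

theorem isClosed_pyr (s t : ℍ) : IsClosed (pyr s t) := by
  have h1 := continuous_im1.comp (continuous_coord s t)
  have h2 := continuous_re.comp (continuous_coord s t)
  exact (isClosed_le h1 h2).inter (isClosed_le h2 continuous_const)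

theorem locallyFinite_pyr :
    LocallyFinite fun i : {s : ℍ // s ∈ D4} × {t : ℍ // t ∈ roots} => pyr i.1 i.2 := by
  intro x
  refine ⟨Metric.ball x 1, Metric.ball_mem_nhds x one_pos, ?_⟩
  have f1 : {s : {s : ℍ // s ∈ D4} | ‖(s : ℍ)‖ ≤ ‖x‖ + 2}.Finite :=
    Set.Finite.of_finite_image (f := Subtype.val) ((finite_hurwitz_ball (‖x‖ + 2)).subset (by
      rintro _ ⟨s, hs, rfl⟩
      exact ⟨D4_subset s.2, hs⟩)) Subtype.val_injective.injOn
  have f2 : (Set.univ : Set {t : ℍ // t ∈ roots}).Finite := by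
    have := finite_roots.to_subtype
    exact Set.finite_univ
  refine (f1.prod f2).subset ?_
  rintro ⟨⟨s, hs⟩, ⟨t, ht⟩⟩ ⟨y, hy, hyx⟩
  refine ⟨?_, trivial⟩
  have h1 := normSq_sub_le_one ht hy
  rw [normSq_eq_sq] at h1
  have h2 : ‖y - s‖ ≤ 1 := by nlinarith [norm_nonneg (y - s)]
  rw [Metric.mem_ball, dist_eq_norm] at hyx
  change ‖s‖ ≤ ‖x‖ + 2
  have h3 : ‖s‖ ≤ ‖x‖ + ‖y - x‖ + ‖y - s‖ := by
    calc ‖s‖ = ‖x + (y - x) - (y - s)‖ := by congr 1; abel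
      _ ≤ ‖x + (y - x)‖ + ‖y - s‖ := norm_sub_le _ _
      _ ≤ _ := by gcongr; exact norm_add_le _ _
  linarith

/-- The retraction of the hyperplane complement onto the complex. -/
def retraction (x : ℍ) : ℍ :=
  retr (exists_pyr x).choose (exists_pyr x).choose_spec.2.choose x

theorem retraction_eq {s t x : ℍ} (hs : s ∈ D4) (ht : t ∈ roots) (hx : x ∈ pyr s t)
    (hM : ¬ OnMirror x) : retraction x = retr s t x := by
  obtain ⟨h1, h2, h3⟩ := (exists_pyr x).choose_spec.2.choose_spec |> fun h =>
    (⟨(exists_pyr x).choose_spec.1, h.1, h.2⟩ : _ ∧ _ ∧ _)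
  exact retr_eq h1 h2 hs ht h3 hx hM

theorem continuous_retraction :
    Continuous fun x : hyperplaneComplement reflG4 => retraction x := by
  refine (locallyFinite_pyr.preimage_continuous continuous_subtype_val).continuous ?_ ?_ ?_
  · refine Set.eq_univ_of_forall fun x => ?_
    obtain ⟨s, hs, t, ht, hx⟩ := exists_pyr (x : ℍ)
    exact Set.mem_iUnion.2 ⟨⟨⟨s, hs⟩, ⟨t, ht⟩⟩, hx⟩
  · rintro ⟨⟨s, hs⟩, ⟨t, ht⟩⟩
    exact (isClosed_pyr s t).preimage continuous_subtype_val
  · rintro ⟨⟨s, hs⟩, ⟨t, ht⟩⟩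
    have h : ContinuousOn (fun x : hyperplaneComplement reflG4 => retr s t x)
        (Subtype.val ⁻¹' pyr s t) := by
      unfold retr
      have c1 : Continuous fun x : hyperplaneComplement reflG4 => red (coord s t x) :=
        continuous_red.comp ((continuous_coord s t).comp continuous_subtype_val)
      have c2 := continuous_im1.comp c1
      refine continuousOn_const.add (continuousOn_const.mul (continuousOn_const.add
        (ContinuousOn.smul (continuousOn_const.div (continuousOn_const.mul c2.continuousOn) ?_)
          c1.continuousOn)))
      intro x hx
      have := im1_red_coord_pos hs ht hx (mem_complement.1 x.2)
      exact (mul_pos two_pos this).ne'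
    exact h.congr fun x hx => retraction_eq hs ht hx (mem_complement.1 x.2)

theorem deformationRetractsOnto_K :
    DeformationRetractsOnto (hyperplaneComplement reflG4) (⋃₀ K) := by
  refine ⟨fun x hx => mem_complement.2 (not_onMirror_of_mem hx), ⟨fun p =>
    ⟨(1 - (p.1 : ℝ)) • (p.2 : ℍ) + (p.1 : ℝ) • retraction p.2, ?_⟩, ?_⟩, ?_, ?_, ?_⟩
  · obtain ⟨s, hs, t, ht, hx⟩ := exists_pyr (p.2 : ℍ)
    have hM := mem_complement.1 p.2.2
    rw [mem_complement, retraction_eq hs ht hx hM]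
    exact not_onMirror_segment hs ht hx hM p.1.2.1 p.1.2.2
  · have := continuous_retraction.comp (continuous_snd (X := unitInterval))
    have h : Continuous fun p : unitInterval × hyperplaneComplement reflG4 =>
        retraction (p.2 : ℍ) := this
    fun_prop
  · intro x
    ext1
    simp
  · intro x
    obtain ⟨s, hs, t, ht, hx⟩ := exists_pyr (x : ℍ)
    have hM := mem_complement.1 x.2
    have := retr_mem hs ht (im1_red_coord_pos hs ht hx hM)
    rw [← retraction_eq hs ht hx hM] at this
    simpa using this
  · intro τ x hxK
    obtain ⟨s, hs, t, ht, hx⟩ := exists_pyr (x : ℍ)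
    have hM := mem_complement.1 x.2
    have := retr_of_mem hs ht hx hxK
    ext1
    simp only [ContinuousMap.coe_mk]
    rw [retraction_eq hs ht hx hM, this]
    module

/-! ### The cells around a vertex -/

/-- Convex combinations of a clique keep a distance from the centre. -/
theorem Clique.center_notMem {s : ℍ} {A : Finset ℍ} (hA : Clique s A) :
    s ∉ convexHull ℝ (A : Set ℍ) := by
  intro h
  obtain ⟨a, ha⟩ := hA.nonempty
  -- The half-space ⟨a - s, y - s⟩ ≥ 1/2 contains the clique but not s.
  have hc : Convex ℝ {y : ℍ | 1 / 2 + inner ℝ (a - s) s ≤ innerSL ℝ (a - s) y} :=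
    convex_halfSpace_ge (innerSL ℝ (a - s)).toLinearMap.isLinear _
  have := convexHull_min (s := (A : Set ℍ)) (t := {y : ℍ | 1 / 2 + inner ℝ (a - s) s ≤
    innerSL ℝ (a - s) y}) (fun b hb => ?_) hc h
  · rw [Set.mem_ofPred_eq, innerSL_apply_apply] at this
    linarith
  · rw [Set.mem_ofPred_eq, innerSL_apply_apply]
    have e : inner ℝ (a - s) b = inner ℝ (a - s) (b - s) + inner ℝ (a - s) s := by
      rw [← inner_add_right, sub_add_cancel]
    rw [e]
    by_cases hab : a = b
    · rw [← hab, hA.inner_self ha]; linarith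
    · rw [hA.inner_eq ha hb hab]

/-- The cells spanned by cliques that meet a mirror are the facet triangles of constant sign. -/
theorem Clique.eq_tri_of_onMirror {s x : ℍ} {A : Finset ℍ} (hs : s ∈ D4) (hA : Clique s A)
    (hx : x ∈ convexHull ℝ (A : Set ℍ)) (hM : OnMirror x) :
    ∃ t ∈ roots, ∃ e : ℝ, (e = 1 ∨ e = -1) ∧ A = tri s t e e e := by
  obtain ⟨t, ht, hp⟩ := vor_subset_pyr hs (hA.hull_subset_vor hs hx)
  obtain ⟨h1, h2⟩ := (onMirror_iff hs ht hp).1 hM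
  obtain ⟨e, he, he'⟩ := exists_sign (coord s t x).imI
  obtain ⟨k1, k2, k3, k4, k5⟩ := pyr_extremal hs ht hp hs hA hx he' he (h1 ▸ he') he
    (h2 ▸ h1 ▸ he') he
  have hre : (coord s t x).re = 1 / 2 :=
    le_antisymm hp.2 (not_lt.1 fun h => hA.center_notMem (k1 h))
  have him : im1 (coord s t x) = 1 / 2 := by
    rw [← hre]
    refine le_antisymm hp.1 (not_lt.1 fun h => ?_)
    -- The centre of the facet is the midpoint of two opposite vertices; by extremality both would
    -- be in A, but their squared distance is 2.
    have hmid := k2 h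
    have hpm : s + t * mkq (1 / 2) 0 0 0 =
        (1 / 2 : ℝ) • vI s t 1 + (1 / 2 : ℝ) • vI s t (-1) := by
      have : mkq (1 / 2) 0 0 0 = (1 / 2 : ℝ) • mkq (1 / 2) (1 / 2) 0 0 +
          (1 / 2 : ℝ) • mkq (1 / 2) (-1 / 2) 0 0 := by
        ext <;> simp <;> norm_num
      rw [this, vI, vI, mul_add, mul_smul_comm, mul_smul_comm]
      module
    have v1 := mem_vert.2 (vertex_mem (s := s) ht (e := 1) (Or.inl rfl)).1
    have v2 := mem_vert.2 (vertex_mem (s := s) ht (e := -1) (Or.inr rfl)).1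
    have key := fun j : Fin 2 => hA.mem_hull_of_combination hs hs Finset.univ
      (fun _ => (1 / 2 : ℝ)) ![vI s t 1, vI s t (-1)] (fun _ _ => by norm_num) (by simp)
      (by
        intro i _
        fin_cases i
        · exact vert_subset_vor hs v1
        · exact vert_subset_vor hs v2)
      (by rw [Fin.sum_univ_two]; rw [hpm] at hmid; exact hmid) (Finset.mem_univ j) (by norm_num)
    have m1 := hA.mem_of_mem_hull v1 (key 0)
    have m2 := hA.mem_of_mem_hull v2 (key 1)
    have hd : normSq (vI s t 1 - vI s t (-1)) = 2 := by
      rw [vI, vI, add_sub_add_left_eq_sub, ← mul_sub, map_mul, ht.2, normSq_coord]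
      simp
      norm_num
    have := hA.normSq_sub _ m1 _ m2 (by
      intro h
      rw [h, sub_self, map_zero] at hd
      norm_num at hd)
    linarith
  have hne : (coord s t x).imI ≠ 0 := by
    intro h
    rw [im1, ← h2, ← h1, h] at him
    norm_num at him
  have hsub : tri s t e e e ⊆ A := by
    intro v hv
    simp only [tri, Finset.mem_insert, Finset.mem_singleton] at hv
    rcases hv with rfl | rfl | rfl
    · exact k3 hne
    · exact k4 (h1 ▸ hne)
    · exact k5 (h2 ▸ h1 ▸ hne)
  refine ⟨t, ht, e, he, (Finset.eq_of_subset_of_card_le hsub ?_).symm⟩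
  rw [card_tri ht he he]
  exact hA.card_le_three

/-- The sides of a facet triangle of constant sign span the same complex line. -/
theorem tri_sides {s t : ℍ} (ht : t ∈ roots) {e : ℝ} (he : e = 1 ∨ e = -1) {x y z : ℍ}
    (h : ({x, y, z} : Set ℍ) = {vI s t e, vJ s t e, vK s t e}) (hxy : x ≠ y) (hxz : x ≠ z)
    (hyz : y ≠ z) : star (y - x) * (z - x) ∈ Cω := by
  have hx : x ∈ ({vI s t e, vJ s t e, vK s t e} : Set ℍ) := h ▸ by simp
  have hy : y ∈ ({vI s t e, vJ s t e, vK s t e} : Set ℍ) := h ▸ by simp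
  have hz : z ∈ ({vI s t e, vJ s t e, vK s t e} : Set ℍ) := h ▸ by simp
  have key : ∀ p q r : ℍ, star (p - q) * (r - q) ∈ Cω →
      star (s + t * p - (s + t * q)) * (s + t * r - (s + t * q)) ∈ Cω := by
    intro p q r hh
    rw [add_sub_add_left_eq_sub, add_sub_add_left_eq_sub, ← mul_sub, ← mul_sub, star_mul,
      mul_assoc, ← mul_assoc (star t), star_mul_self_of_root ht, two_eq_smul, smul_mul_assoc,
      one_mul, mul_smul_comm]
    exact Cω.smul_mem _ hh
  simp only [Set.mem_insert_iff, Set.mem_singleton_iff] at hx hy hz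
  rcases hx with rfl | rfl | rfl <;> rcases hy with rfl | rfl | rfl <;>
    rcases hz with rfl | rfl | rfl <;>
    first
    | exact absurd rfl hxy
    | exact absurd rfl hxz
    | exact absurd rfl hyz
    | (refine key _ _ _ ?_
       rw [mem_Cω]
       rcases he with rfl | rfl <;> norm_num)

theorem int_unit_cases {x y z w : ℤ} (h : x ^ 2 + y ^ 2 + z ^ 2 + w ^ 2 = 1) (hx : x ≠ 0) :
    (x = 1 ∨ x = -1) ∧ y = 0 ∧ z = 0 ∧ w = 0 := by
  have h1 : 1 ≤ x ^ 2 := by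
    have := sq_nonneg x
    have := pow_ne_zero 2 hx
    omega
  have hy := sq_nonneg y
  have hz := sq_nonneg z
  have hw := sq_nonneg w
  refine ⟨?_, (pow_eq_zero_iff two_ne_zero).1 (by linarith : y ^ 2 = 0),
    (pow_eq_zero_iff two_ne_zero).1 (by linarith : z ^ 2 = 0),
    (pow_eq_zero_iff two_ne_zero).1 (by linarith : w ^ 2 = 0)⟩
  have h2 : (x - 1) * (x + 1) = 0 := by linarith
  rcases mul_eq_zero.1 h2 with h3 | h3
  · left; linarith
  · right; linarith

/-- The doubled coordinates are four integers of equal parity whose squares sum to 4: one of them is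
±2, or all are ±1. -/
theorem units_cases {u : ℍ} (hu : u ∈ units) :
    (∃ e : ℝ, (e = 1 ∨ e = -1) ∧ ∃ q ∈ Q4, u = e • q) ∨
    ∃ a b c d : ℝ, (a = 1 ∨ a = -1) ∧ (b = 1 ∨ b = -1) ∧ (c = 1 ∨ c = -1) ∧ (d = 1 ∨ d = -1) ∧
      u = mkq (a / 2) (b / 2) (c / 2) (d / 2) := by
  obtain ⟨⟨a, b, c, d, rfl⟩, hn⟩ := hu
  rw [normSq_coord] at hn
  simp only [re_mkq, imI_mkq, imJ_mkq, imK_mkq] at hn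
  have h4 : a ^ 2 + (a + 2 * b) ^ 2 + (a + 2 * c) ^ 2 + (a + 2 * d) ^ 2 = 4 := by
    have : (a : ℝ) ^ 2 + (a + 2 * b) ^ 2 + (a + 2 * c) ^ 2 + (a + 2 * d) ^ 2 = 4 := by linarith
    exact_mod_cast this
  rcases Int.even_or_odd' a with ⟨k, rfl | rfl⟩
  · left
    have h1 : k ^ 2 + (k + b) ^ 2 + (k + c) ^ 2 + (k + d) ^ 2 = 1 := by nlinarith
    obtain ⟨p, hp⟩ : ∃ p, p = k + b := ⟨_, rfl⟩
    obtain ⟨q, hq⟩ : ∃ q, q = k + c := ⟨_, rfl⟩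
    obtain ⟨r, hr⟩ : ∃ r, r = k + d := ⟨_, rfl⟩
    rw [← hp, ← hq, ← hr] at h1
    have e : mkq ((2 * k : ℤ) / 2) ((2 * k : ℤ) / 2 + b) ((2 * k : ℤ) / 2 + c)
        ((2 * k : ℤ) / 2 + d) = mkq k p q r := by
      rw [hp, hq, hr]
      ext <;> simp
    rw [e]
    clear e hp hq hr hn h4
    have fin : ∀ (e : ℤ) (q : ℍ), (e = 1 ∨ e = -1) → q ∈ Q4 → ∀ u, u = (e : ℝ) • q →
        ∃ e : ℝ, (e = 1 ∨ e = -1) ∧ ∃ q ∈ Q4, u = e • q := fun e q he hq u hu =>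
      ⟨e, by rcases he with rfl | rfl <;> simp, q, hq, hu⟩
    by_cases hk : k = 0
    · by_cases hp : p = 0
      · by_cases hq : q = 0
        · obtain ⟨he, -⟩ := int_unit_cases (x := r) (y := k) (z := p) (w := q) (by linarith)
            (by rintro rfl; subst hk hp hq; norm_num at h1)
          exact fin r (mkq 0 0 0 1) he (by simp [Q4]) _ (by ext <;> simp [hk, hp, hq])
        · obtain ⟨he, -, -, hr⟩ := int_unit_cases (x := q) (y := k) (z := p) (w := r)
            (by linarith) hq
          exact fin q (mkq 0 0 1 0) he (by simp [Q4]) _ (by ext <;> simp [hk, hp, hr])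
      · obtain ⟨he, -, hq, hr⟩ := int_unit_cases (x := p) (y := k) (z := q) (w := r)
          (by linarith) hp
        exact fin p (mkq 0 1 0 0) he (by simp [Q4]) _ (by ext <;> simp [hk, hq, hr])
    · obtain ⟨he, hp, hq, hr⟩ := int_unit_cases h1 hk
      exact fin k (mkq 1 0 0 0) he (by simp [Q4]) _ (by ext <;> simp [hp, hq, hr])
  · right
    have one_le : ∀ x : ℤ, 1 ≤ (2 * x + 1) ^ 2 := fun x => by
      have : 0 ≤ x * (x + 1) := by
        rcases le_or_gt 0 x with h | h
        · positivity
        · nlinarith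
      nlinarith
    have o1 := one_le k
    have o2 := one_le (k + b)
    have o3 := one_le (k + c)
    have o4 := one_le (k + d)
    have sgn : ∀ x : ℤ, (2 * x + 1) ^ 2 ≤ 1 → ((2 * x + 1 : ℤ) : ℝ) = 1 ∨
        ((2 * x + 1 : ℤ) : ℝ) = -1 := by
      intro x hx
      have h1 : -1 ≤ x := by nlinarith
      have h2 : x ≤ 0 := by nlinarith
      obtain rfl | rfl : x = -1 ∨ x = 0 := by omega
      · right; norm_num
      · left; norm_num
    refine ⟨_, _, _, _, sgn k (by nlinarith), sgn (k + b) (by nlinarith), sgn (k + c) (by nlinarith),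
      sgn (k + d) (by nlinarith), ?_⟩
    ext <;> simp <;> ring

/-- Every unit lies on the complex line through one of `1`, `i`, `j`, `k`. -/
theorem exists_Q4_line {u : ℍ} (hu : u ∈ units) : ∃ q ∈ Q4, star q * u ∈ Cω := by
  rcases units_cases hu with ⟨e, -, q, hq, rfl⟩ | ⟨a, b, c, d, ha, hb, hc, hd, rfl⟩
  · refine ⟨q, hq, ?_⟩
    rw [mul_smul_comm, star_mul_self_of_unit (Q4_normSq q hq)]
    exact Cω.smul_mem _ (mem_Cω.2 (by simp))
  · have key : ∀ q ∈ Q4, star q * mkq (a / 2) (b / 2) (c / 2) (d / 2) ∈ Cω →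
      ∃ q ∈ Q4, star q * mkq (a / 2) (b / 2) (c / 2) (d / 2) ∈ Cω := fun q hq h => ⟨q, hq, h⟩
    rcases ha with rfl | rfl <;> rcases hb with rfl | rfl <;> rcases hc with rfl | rfl <;>
      rcases hd with rfl | rfl <;>
      first
      | (refine key (mkq 1 0 0 0) (by simp [Q4]) ?_; rw [mem_Cω]; norm_num; done)
      | (refine key (mkq 0 1 0 0) (by simp [Q4]) ?_; rw [mem_Cω]; norm_num; done)
      | (refine key (mkq 0 0 1 0) (by simp [Q4]) ?_; rw [mem_Cω]; norm_num; done)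
      | (refine key (mkq 0 0 0 1) (by simp [Q4]) ?_; rw [mem_Cω]; norm_num; done)

/-- A triangle of units whose sides span the same complex line meets a mirror. -/
theorem exists_onMirror_of_sides {s x y z : ℍ} {A : Finset ℍ} (hs : s ∈ D4) (hA : Clique s A)
    (hx : x ∈ A) (hy : y ∈ A) (hz : z ∈ A) (hxy : x ≠ y) (hxz : x ≠ z) (hyz : y ≠ z)
    (h : star (y - x) * (z - x) ∈ Cω) : ∃ p ∈ convexHull ℝ (A : Set ℍ), OnMirror p := by
  have hp := (convex_convexHull ℝ (A : Set ℍ)).sum_mem (t := Finset.univ)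
    (w := fun _ : Fin 3 => (1 / 3 : ℝ)) (z := ![x, y, z])
    (fun _ _ => by norm_num) (by simp)
    (by intro i _; fin_cases i <;> exact subset_convexHull ℝ _ (by simpa))
  refine ⟨_, hp, ?_⟩
  have ix := hA.inner_self hx
  have iy := hA.inner_self hy
  have iz := hA.inner_self hz
  have ixy := hA.inner_eq hx hy hxy
  have ixz := hA.inner_eq hx hz hxz
  have iyz := hA.inner_eq hy hz hyz
  have hu : y - x ∈ units := by
    refine ⟨?_, hA.normSq_sub y hy x hx hxy.symm⟩
    have : y - x = (y - s) - (x - s) := by abel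
    rw [this]
    exact hurwitz.sub_mem (hA.mem_units y hy).1 (hA.mem_units x hx).1
  obtain ⟨q, hq, hqu⟩ := exists_Q4_line hu
  -- The barycentre is s + P with P orthogonal to both sides. The sides span the complex line
  -- through q over ℝ, so P is hermitian-orthogonal to q and s + P lies on the mirror with root q
  -- through s.
  set P := (1 / 3 : ℝ) • ((x - s) + (y - s) + (z - s)) with hP
  have hsum : ∑ i : Fin 3, (1 / 3 : ℝ) • (![x, y, z] : Fin 3 → ℍ) i = s + P := by
    rw [Fin.sum_univ_three, hP]
    change (1 / 3 : ℝ) • x + (1 / 3 : ℝ) • y + (1 / 3 : ℝ) • z = _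
    module
  have p1 : inner ℝ (y - x) P = 0 := by
    have : y - x = (y - s) - (x - s) := by abel
    rw [this, hP, real_inner_smul_right, inner_sub_left, inner_add_right, inner_add_right,
      inner_add_right, inner_add_right, real_inner_comm (x - s) (y - s)]
    linarith
  have p2 : inner ℝ (z - x) P = 0 := by
    have : z - x = (z - s) - (x - s) := by abel
    rw [this, hP, real_inner_smul_right, inner_sub_left, inner_add_right, inner_add_right,
      inner_add_right, inner_add_right, real_inner_comm (x - s) (z - s),
      real_inner_comm (y - s) (z - s)]
    linarith
  have hzu : normSq (z - x - (y - x)) = 1 := by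
    rw [sub_sub_sub_cancel_right]
    exact hA.normSq_sub z hz y hy hyz.symm
  have hzx := hA.normSq_sub z hz x hx hxz.symm
  -- Express everything in terms of the root of the mirror.
  have hun : y - x = q * (star q * (y - x)) := by
    rw [← mul_assoc, self_mul_star_of_unit (Q4_normSq q hq), one_mul]
  have hzn : z - x = (y - x) * (star (y - x) * (z - x)) := by
    rw [← mul_assoc, self_mul_star_of_unit hu.2, one_mul]
  have hPn : P = q * (star q * P) := by
    rw [← mul_assoc, self_mul_star_of_unit (Q4_normSq q hq), one_mul]
  have nu : normSq (star q * (y - x)) = 1 := by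
    rw [map_mul, hu.2, mul_one, normSq_star, Q4_normSq q hq]
  obtain ⟨c1, c2⟩ := mem_Cω.1 hqu
  obtain ⟨d1, d2⟩ := mem_Cω.1 h
  have q1 : inner ℝ (star q * (y - x)) (star q * P) = 0 := by
    rw [inner_mul_left, p1, mul_zero]
  have q2 : inner ℝ (star q * (y - x) * (star (y - x) * (z - x))) (star q * P) = 0 := by
    rw [mul_assoc, ← hzn, inner_mul_left, p2, mul_zero]
  have r1 : inner ℝ (y - x) (z - x) = 1 / 2 := by
    rw [normSq_sub_eq, hu.2, hzx, real_inner_comm] at hzu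
    linarith
  have r2 : (star (y - x) * (z - x)).re = 1 / 2 := by
    rw [← r1, inner_coord]
    simp
    ring
  have r3 : normSq (star (y - x) * (z - x)) = 1 := by
    rw [map_mul, hzx, mul_one, normSq_star, hu.2]
  obtain ⟨m, n, hm, hn⟩ := D4_mem_mir hs q hq
  rw [hsum]
  generalize star q * (y - x) = α at *
  generalize star (y - x) * (z - x) = β at *
  have fin : (star q * P).re = 0 ∧
      (star q * P).re + (star q * P).imI + (star q * P).imJ + (star q * P).imK = 0 := by
    generalize star q * P = π at *
    rw [normSq_coord] at nu r3
    rw [inner_coord] at q1 q2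
    simp only [re_mul, imI_mul, imJ_mul, imK_mul, r2, ← d2, ← d1, ← c2, ← c1] at q1 q2 nu r3
    -- The quotient β of the sides has norm 1 and real part 1/2, so it is not real and the two
    -- orthogonality relations are independent.
    have hd : β.imI ^ 2 = 1 / 4 := by nlinarith
    have e1 : α.re * π.re + α.imI * (π.imI + π.imJ + π.imK) = 0 := by linarith
    have e2 : β.imI * (α.re * (π.imI + π.imJ + π.imK) - 3 * α.imI * π.re) = 0 := by nlinarith
    have hb : β.imI ≠ 0 := by
      intro h0
      rw [h0] at hd
      norm_num at hd
    have e3 := (mul_eq_zero.1 e2).resolve_left hb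
    have f1 : π.re = 0 := by
      linear_combination α.re * e1 - α.imI * e3 - π.re * nu
    have f2 : π.imI + π.imJ + π.imK = 0 := by
      linear_combination 3 * α.imI * e1 + α.re * e3 - (π.imI + π.imJ + π.imK) * nu
    exact ⟨f1, by linarith⟩
  refine ⟨q, hq, m, n, ?_, ?_⟩
  · rw [mul_add, re_add, hm, fin.1, add_zero]
  · rw [mul_add]
    simp only [re_add, imI_add, imJ_add, imK_add]
    linarith [fin.2]

/-! ### The edges and the corners at a vertex -/

theorem add_self_mem_D4 {x : ℍ} (hx : x ∈ hurwitz) : x + x ∈ D4 := by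
  have h2 : (2 : ℍ) ∈ D4 := ⟨2, 0, 0, 0, by rw [two_eq_smul]; ext <;> simp, by decide⟩
  have := mul_mem_D4_right hx h2
  rwa [two_mul] at this

theorem sub_mem_D4_iff {x y : ℍ} (hy : y ∈ hurwitz) : x - y ∈ D4 ↔ x + y ∈ D4 := by
  have h : x + y = x - y + (y + y) := by abel
  rw [h, D4.add_mem_cancel_right (add_self_mem_D4 hy)]

/-- The three non-trivial classes modulo `D4`. -/
theorem sub_mem_D4_of_classes {x y p q : ℍ} (hx : x ∈ hurwitz) (hy : y ∈ hurwitz)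
    (hp : p ∈ hurwitz) (hq : q ∈ hurwitz) (x0 : x ∉ D4) (y0 : y ∉ D4) (p0 : p ∉ D4) (q0 : q ∉ D4)
    (pq : p - q ∉ D4) (xp : x - p ∉ D4) (xq : x - q ∉ D4) (yp : y - p ∉ D4) (yq : y - q ∉ D4) :
    x - y ∈ D4 := by
  rw [← cls_eq_zero_iff hx] at x0
  rw [← cls_eq_zero_iff hy] at y0
  rw [← cls_eq_zero_iff hp] at p0
  rw [← cls_eq_zero_iff hq] at q0
  rw [← cls_eq_iff hp hq] at pq
  rw [← cls_eq_iff hx hp] at xp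
  rw [← cls_eq_iff hx hq] at xq
  rw [← cls_eq_iff hy hp] at yp
  rw [← cls_eq_iff hy hq] at yq
  rw [← cls_eq_iff hx hy]
  generalize cls x = a at *
  generalize cls y = b at *
  generalize cls p = c at *
  generalize cls q = d at *
  have key : ∀ a c d : ZMod 2 × ZMod 2,
      a ≠ 0 → c ≠ 0 → d ≠ 0 → c ≠ d → a ≠ c → a ≠ d → a = c + d := by decide
  rw [key a c d x0 p0 q0 pq xp xq, key b c d y0 p0 q0 pq yp yq]

theorem units_mul {u v : ℍ} (hu : u ∈ units) (hv : v ∈ units) : u * v ∈ units :=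
  ⟨hurwitz.mul_mem hu.1 hv.1, by rw [map_mul, hu.2, hv.2, mul_one]⟩

theorem units_star {u : ℍ} (hu : u ∈ units) : star u ∈ units :=
  ⟨star_mem_hurwitz hu.1, by rw [normSq_star, hu.2]⟩

theorem ω_mem_units : ω ∈ units := ⟨ω_mem_hurwitz, normSq_ω⟩

theorem notMem_D4_of_mem_units {u : ℍ} (hu : u ∈ units) : u ∉ D4 :=
  notMem_D4_of_normSq_one hu.1 hu.2

theorem mkq_half_mem_units {a b c d : ℝ} (ha : a = 1 ∨ a = -1) (hb : b = 1 ∨ b = -1)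
    (hc : c = 1 ∨ c = -1) (hd : d = 1 ∨ d = -1) : mkq (a / 2) (b / 2) (c / 2) (d / 2) ∈ units := by
  have sq : ∀ e : ℝ, (e = 1 ∨ e = -1) → e ^ 2 = 1 := by
    rintro e (rfl | rfl) <;> norm_num
  have hint : ∀ e f : ℝ, (e = 1 ∨ e = -1) → (f = 1 ∨ f = -1) → ∃ n : ℤ, e / 2 = f / 2 + n := by
    rintro e f (rfl | rfl) (rfl | rfl)
    · exact ⟨0, by norm_num⟩
    · exact ⟨1, by norm_num⟩
    · exact ⟨-1, by norm_num⟩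
    · exact ⟨0, by norm_num⟩
  obtain ⟨n, hn⟩ : ∃ n : ℤ, a = n := by
    rcases ha with rfl | rfl
    · exact ⟨1, by norm_num⟩
    · exact ⟨-1, by norm_num⟩
  obtain ⟨b', hb'⟩ := hint b a hb ha
  obtain ⟨c', hc'⟩ := hint c a hc ha
  obtain ⟨d', hd'⟩ := hint d a hd ha
  refine ⟨⟨n, b', c', d', by rw [hb', hc', hd', hn]⟩, ?_⟩
  rw [normSq_coord]
  simp only [re_mkq, imI_mkq, imJ_mkq, imK_mkq]
  linarith [sq a ha, sq b hb, sq c hc, sq d hd]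

-- The units u, uω and u`star ω` represent the three nonzero classes, and v is not in that of u. So
-- v ≡ uz with z one of ω, `star ω`; then s = v - uz lies in `D4`, and v - s = uz and v + u - s =
-- u(z + 1) are both units.
open Classical in
theorem exists_edge {v u : ℍ} (hv : v ∈ hurwitz) (hvD : v ∉ D4) (hu : u ∈ units)
    (hvu : v + u ∉ D4) : ∃ s ∈ D4, Clique s {v, v + u} := by
  rw [← sub_mem_D4_iff hu.1] at hvu
  have mk : ∀ z : ℍ, z ∈ units → z + 1 ∈ units → v - u * z ∈ D4 →
      ∃ s ∈ D4, Clique s {v, v + u} := by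
    intro z hz hz1 h
    refine ⟨_, h, ⟨v, by simp⟩, ?_, ?_⟩
    · intro a ha
      simp only [Finset.mem_insert, Finset.mem_singleton] at ha
      rcases ha with rfl | rfl
      · rw [sub_sub_cancel]
        exact units_mul hu hz
      · have : v + u - (v - u * z) = u * (z + 1) := by noncomm_ring
        rw [this]
        exact units_mul hu hz1
    · intro a ha b hb hab
      simp only [Finset.mem_insert, Finset.mem_singleton] at ha hb
      rcases ha with rfl | rfl <;> rcases hb with rfl | rfl
      · exact absurd rfl hab
      · rw [sub_add_cancel_left, normSq_neg, hu.2]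
      · rw [add_sub_cancel_left, hu.2]
      · exact absurd rfl hab
  have e1 : ω + 1 = -star ω := by ext <;> norm_num [ω_eq]
  have e2 : star ω + 1 = -ω := by ext <;> norm_num [ω_eq]
  have hω := ω_mem_units
  have hω' := units_star hω
  by_cases h : v - u * ω ∈ D4
  · exact mk ω hω (e1 ▸ neg_mem_units hω') h
  · refine mk (star ω) hω' (e2 ▸ neg_mem_units hω) ?_
    have n1 : ∀ z ∈ units, u * z ∉ D4 := fun z hz => notMem_D4_of_mem_units (units_mul hu hz)
    refine sub_mem_D4_of_classes hv (units_mul hu hω').1 hu.1 (units_mul hu hω).1 hvD (n1 _ hω')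
      (notMem_D4_of_mem_units hu) (n1 _ hω) ?_ hvu h ?_ ?_
    · rw [sub_mem_D4_iff (units_mul hu hω).1]
      have : u + u * ω = u * (ω + 1) := by noncomm_ring
      rw [this, e1]
      exact n1 _ (neg_mem_units hω')
    · rw [sub_mem_D4_iff hu.1]
      have : u * star ω + u = u * (star ω + 1) := by noncomm_ring
      rw [this, e2]
      exact n1 _ (neg_mem_units hω)
    · rw [sub_mem_D4_iff (units_mul hu hω).1, ← mul_add]
      have : star ω + ω = -1 := by ext <;> norm_num [ω_eq]
      rw [this]
      exact n1 _ (neg_mem_units one_mem_units)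

-- The classes of u and w are distinct and v lies in the third. It suffices to find y for which y, y
-- + 1 and y + ūw are all units: then uy is in the third class too, s = v - uy lies in `D4`, and all
-- three points are vertices around s.
open Classical in
theorem exists_corner {v u w : ℍ} (hv : v ∈ hurwitz) (hvD : v ∉ D4) (hu : u ∈ units)
    (hw : w ∈ units) (hvu : v + u ∉ D4) (hvw : v + w ∉ D4) (huw : normSq (u - w) = 1) :
    ∃ s ∈ D4, Clique s {v, v + u, v + w} := by
  rw [← sub_mem_D4_iff hu.1] at hvu
  rw [← sub_mem_D4_iff hw.1] at hvw
  have hwn : w = u * (star u * w) := by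
    rw [← mul_assoc, self_mul_star_of_unit hu.2, one_mul]
  have hre : (star u * w).re = 1 / 2 := by
    rw [normSq_sub_eq, hu.2, hw.2, inner_coord] at huw
    simp only [re_mul, re_star, imI_star, imJ_star, imK_star]
    linarith
  have hzu := units_mul (units_star hu) hw
  generalize star u * w = z at *
  obtain ⟨b, c, d, hb, hc, hd, rfl⟩ : ∃ b c d : ℝ, (b = 1 ∨ b = -1) ∧ (c = 1 ∨ c = -1) ∧
      (d = 1 ∨ d = -1) ∧ z = mkq (1 / 2) (b / 2) (c / 2) (d / 2) := by
    rcases units_cases hzu with ⟨e, he, q, hq, rfl⟩ | ⟨a, b, c, d, ha, hb, hc, hd, rfl⟩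
    · exfalso
      simp only [Q4, Set.mem_insert_iff, Set.mem_singleton_iff] at hq
      rcases he with rfl | rfl <;> rcases hq with rfl | rfl | rfl | rfl <;> norm_num at hre
    · refine ⟨b, c, d, hb, hc, hd, ?_⟩
      rw [re_mkq] at hre
      rw [hre]
  have hneg : ∀ {e : ℝ}, (e = 1 ∨ e = -1) → (-e = 1 ∨ -e = -1) := by
    rintro _ (rfl | rfl) <;> simp
  -- The vertex in direction `-(u + w) / 2`, rotated so that it is a unit.
  set y := mkq (-1 / 2) (b / 2) (-c / 2) (-d / 2) with hy
  have hyu : y ∈ units := mkq_half_mem_units (Or.inr rfl) hb (hneg hc) (hneg hd)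
  have hy1 : y + 1 ∈ units := by
    have : y + 1 = mkq (1 / 2) (b / 2) (-c / 2) (-d / 2) := by ext <;> norm_num [hy]
    rw [this]
    exact mkq_half_mem_units (Or.inl rfl) hb (hneg hc) (hneg hd)
  have hyz : y + mkq (1 / 2) (b / 2) (c / 2) (d / 2) ∈ units := by
    have : y + mkq (1 / 2) (b / 2) (c / 2) (d / 2) = mkq 0 b 0 0 := by
      ext <;> simp [hy] <;> ring
    rw [this]
    rcases hb with rfl | rfl
    · exact ⟨⟨0, 1, 0, 0, by ext <;> simp⟩, by norm_num [normSq_coord]⟩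
    · exact ⟨⟨0, -1, 0, 0, by ext <;> simp⟩, by norm_num [normSq_coord]⟩
  have n1 : ∀ z ∈ units, u * z ∉ D4 := fun z hz => notMem_D4_of_mem_units (units_mul hu hz)
  have hs : v - u * y ∈ D4 := by
    refine sub_mem_D4_of_classes hv (units_mul hu hyu).1 hu.1 hw.1 hvD (n1 _ hyu)
      (notMem_D4_of_mem_units hu) (notMem_D4_of_mem_units hw)
      (notMem_D4_of_normSq_one (hurwitz.sub_mem hu.1 hw.1) huw) hvu hvw ?_ ?_
    · rw [sub_mem_D4_iff hu.1]
      have : u * y + u = u * (y + 1) := by noncomm_ring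
      rw [this]
      exact n1 _ hy1
    · rw [sub_mem_D4_iff hw.1, hwn, ← mul_add]
      exact n1 _ hyz
  refine ⟨_, hs, ⟨v, by simp⟩, ?_, ?_⟩
  · intro a ha
    simp only [Finset.mem_insert, Finset.mem_singleton] at ha
    rcases ha with rfl | rfl | rfl
    · rw [sub_sub_cancel]
      exact units_mul hu hyu
    · have : v + u - (v - u * y) = u * (y + 1) := by noncomm_ring
      rw [this]
      exact units_mul hu hy1
    · have : v + w - (v - u * y) = u * y + w := by noncomm_ring
      rw [this, hwn, ← mul_add]
      exact units_mul hu hyz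
  · intro a ha b hb hab
    have huw' : normSq (w - u) = 1 := by rw [← normSq_neg, neg_sub, huw]
    simp only [Finset.mem_insert, Finset.mem_singleton] at ha hb
    rcases ha with rfl | rfl | rfl <;> rcases hb with rfl | rfl | rfl <;>
      first
      | exact absurd rfl hab
      | (rw [sub_add_cancel_left, normSq_neg]; first | exact hu.2 | exact hw.2)
      | (rw [add_sub_cancel_left]; first | exact hu.2 | exact hw.2)
      | (rw [add_sub_add_left_eq_sub]; assumption)

/-- The vertices of the complex are the Hurwitz quaternions outside of `D4`. -/
theorem vertex_of_singleton_mem_K {v : ℍ} (hv : {v} ∈ K) :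
    v ∈ hurwitz ∧ v ∉ D4 ∧ ∃ s ∈ D4, v ∈ vert s := by
  obtain ⟨s, hs, A, hA, he, -⟩ := mem_K_iff.1 hv
  obtain ⟨a, ha⟩ := hA.nonempty
  have hav : a = v := by
    have : a ∈ ({v} : Set ℍ) := he ▸ subset_convexHull ℝ _ ha
    simpa using this
  subst hav
  have hu := hA.mem_units a ha
  have e : a = a - s + s := by abel
  refine ⟨e ▸ hurwitz.add_mem hu.1 (D4_subset hs), fun h => ?_, s, hs, hA.subset_vert ha⟩
  exact notMem_D4_of_mem_units hu (D4.sub_mem h hs)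

/-- A cell containing a vertex `v` and a segment in the direction of an edge at `v` contains that
edge. -/
theorem Clique.mem_of_hasDirection {s s' v u : ℍ} {A : Finset ℍ} (hs : s ∈ D4) (hA : Clique s A)
    (hs' : s' ∈ D4) (hv : v ∈ vert s') (hvu : v + u ∈ vert s')
    (h : HasDirection (convexHull ℝ (A : Set ℍ)) v u) : v + u ∈ A := by
  obtain ⟨hvA, ε, hε, hεA⟩ := h
  -- Shortening the segment to length at most that of the edge makes its endpoint a convex
  -- combination of v and v + u.
  set δ := min ε 1 with hδ
  have hδ0 : 0 < δ := lt_min hε one_pos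
  have hδ1 : δ ≤ 1 := min_le_right _ _
  have hδA : (1 - δ) • v + δ • (v + u) ∈ convexHull ℝ (A : Set ℍ) := by
    have h1 : δ / ε ≤ 1 := (div_le_one hε).2 (min_le_left _ _)
    have := convex_convexHull ℝ (A : Set ℍ) hvA hεA (sub_nonneg.2 h1) (by positivity)
      (sub_add_cancel 1 (δ / ε))
    have e : (1 - δ) • v + δ • (v + u) = (1 - δ / ε) • v + (δ / ε) • (v + ε • u) := by
      rw [smul_add (δ / ε), smul_smul, div_mul_cancel₀ _ hε.ne']
      module
    rwa [e]
  refine hA.vert_of_mem_hull hs hs' hvu ?_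
  have := hA.mem_hull_of_combination hs hs' Finset.univ ![1 - δ, δ] ![v, v + u]
    (by intro i _; fin_cases i; exacts [sub_nonneg.2 hδ1, hδ0.le])
    (by rw [Fin.sum_univ_two]; exact sub_add_cancel 1 δ)
    (by intro i _; fin_cases i; exacts [vert_subset_vor hs' hv, vert_subset_vor hs' hvu])
    (by rw [Fin.sum_univ_two]; exact hδA) (Finset.mem_univ 1) hδ0
  exact this

open Classical in
/-- Short cliques span cells of the complex. -/
theorem mem_K_of_card_le {s : ℍ} {A : Finset ℍ} (hs : s ∈ D4) (hA : Clique s A)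
    (h : A.card ≤ 2) : convexHull ℝ (A : Set ℍ) ∈ K := by
  refine mem_K_iff.2 ⟨s, hs, A, hA, rfl, fun x hx hM => ?_⟩
  obtain ⟨t, ht, e, he, rfl⟩ := hA.eq_tri_of_onMirror hs hx hM
  rw [card_tri ht he he] at h
  omega

theorem hasDirection_hull {A : Finset ℍ} {v u : ℍ} (hv : v ∈ A) (hu : v + u ∈ A) :
    HasDirection (convexHull ℝ (A : Set ℍ)) v u :=
  ⟨subset_convexHull ℝ _ hv, 1, one_pos, by rw [one_smul]; exact subset_convexHull ℝ _ hu⟩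

/-- The directions of the edges at a vertex. -/
theorem edge_direction_iff {v : ℍ} (hv : {v} ∈ K) (u : ℍ) :
    (‖u‖ = 1 ∧ ∃ e ∈ K, cellDim e = 1 ∧ HasDirection e v u) ↔ u ∈ units ∧ v + u ∉ D4 := by
  classical
  obtain ⟨hvh, hvD, s', hs', hvs'⟩ := vertex_of_singleton_mem_K hv
  constructor
  · rintro ⟨hu, F, hF, hd, hvF, ε, hε, hεF⟩
    obtain ⟨s, hs, A, hA, rfl, -⟩ := mem_K_iff.1 hF
    have hvA := hA.vert_of_mem_hull hs hs' hvs' hvF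
    have hc := hA.cellDim_add_one
    rw [hd] at hc
    obtain ⟨b, hb⟩ := Finset.card_eq_one.1 (show (A.erase v).card = 1 by
      rw [Finset.card_erase_of_mem hvA]; omega)
    have hbA : b ∈ A.erase v := by rw [hb]; simp
    have hbv := Finset.ne_of_mem_erase hbA
    have hbA := Finset.mem_of_mem_erase hbA
    have hAeq : A = {v, b} := by rw [← Finset.insert_erase hvA, hb]
    have hn := hA.normSq_sub b hbA v hvA hbv
    have hub : u = b - v := by
      rw [hAeq] at hεF
      push_cast at hεF
      rw [convexHull_pair, segment_eq_image'] at hεF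
      obtain ⟨τ, ⟨hτ, -⟩, h⟩ := hεF
      have h := add_left_cancel h
      have h2 := congrArg norm h
      rw [norm_smul, norm_smul, (normSq_eq_one_iff _).1 hn, hu, Real.norm_of_nonneg hτ,
        Real.norm_of_nonneg hε.le, mul_one, mul_one] at h2
      rw [h2] at h
      exact (smul_right_injective ℍ hε.ne' h).symm
    subst hub
    have hbu := hA.mem_units b hbA
    have e : b - v = (b - s) - (v - s) := by abel
    refine ⟨⟨e ▸ hurwitz.sub_mem hbu.1 (hA.mem_units v hvA).1, hn⟩, ?_⟩
    rw [add_sub_cancel]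
    exact fun h => notMem_D4_of_mem_units hbu (D4.sub_mem h hs)
  · rintro ⟨hu, hvu⟩
    refine ⟨(normSq_eq_one_iff u).1 hu.2, ?_⟩
    obtain ⟨s, hs, hA⟩ := exists_edge hvh hvD hu hvu
    have hne : v ≠ v + u := by
      intro h
      have h0 : u = 0 := by simpa using h
      have := hu.2
      rw [h0, map_zero] at this
      norm_num at this
    have hcard : ({v, v + u} : Finset ℍ).card = 2 := Finset.card_pair hne
    refine ⟨_, mem_K_of_card_le hs hA hcard.le, ?_, hasDirection_hull (by simp) (by simp)⟩
    have := hA.cellDim_add_one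
    omega

theorem link_vertex {v : ℍ} (hv : {v} ∈ K) (u : LinkVertex K v) : u.1 ∈ units ∧ v + u.1 ∉ D4 :=
  (edge_direction_iff hv u.1).1 u.2

/-- The corners at a vertex. -/
theorem link_adj_iff {v : ℍ} (hv : {v} ∈ K) (u w : LinkVertex K v) :
    (link K v).Adj u w ↔ normSq (u.1 - w.1) = 1 ∧ star u.1 * w.1 ∉ Cω := by
  classical
  obtain ⟨hvh, hvD, -⟩ := vertex_of_singleton_mem_K hv
  obtain ⟨hu, hvu⟩ := link_vertex hv u
  obtain ⟨hw, hvw⟩ := link_vertex hv w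
  have ne : ∀ u ∈ units, v ≠ v + u := by
    intro u hu h
    have h0 : u = 0 := by simpa using h
    have := hu.2
    rw [h0, map_zero] at this
    norm_num at this
  constructor
  · rintro ⟨hne, F, hF, hd, h1, h2⟩
    have hne : u.1 ≠ w.1 := fun h => hne (Subtype.ext h)
    obtain ⟨s, hs, A, hA, rfl, hM⟩ := mem_K_iff.1 hF
    obtain ⟨s₁, hs₁, hA₁⟩ := exists_edge hvh hvD hu hvu
    obtain ⟨s₂, hs₂, hA₂⟩ := exists_edge hvh hvD hw hvw
    have hvA := hA.vert_of_mem_hull hs hs₁ (hA₁.subset_vert (x := v) (by simp)) h1.1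
    have huA := hA.mem_of_hasDirection hs hs₁ (hA₁.subset_vert (by simp))
      (hA₁.subset_vert (by simp)) h1
    have hwA := hA.mem_of_hasDirection hs hs₂ (hA₂.subset_vert (by simp))
      (hA₂.subset_vert (by simp)) h2
    have huw : v + u.1 ≠ v + w.1 := fun h => hne (add_left_cancel h)
    have hn := hA.normSq_sub _ huA _ hwA huw
    rw [add_sub_add_left_eq_sub] at hn
    refine ⟨hn, fun hC => ?_⟩
    obtain ⟨p, hp, hpM⟩ := exists_onMirror_of_sides hs hA hvA huA hwA (ne _ hu) (ne _ hw) huw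
      (by rwa [add_sub_cancel_left, add_sub_cancel_left])
    exact hM p hp hpM
  · rintro ⟨hn, hC⟩
    have hne : u.1 ≠ w.1 := by
      intro h
      rw [h, sub_self, map_zero] at hn
      norm_num at hn
    have huw : v + u.1 ≠ v + w.1 := fun h => hne (add_left_cancel h)
    obtain ⟨s, hs, hA⟩ := exists_corner hvh hvD hu hw hvu hvw hn
    refine ⟨fun h => hne (congrArg Subtype.val h), convexHull ℝ _,
      mem_K_iff.2 ⟨s, hs, _, hA, rfl, fun x hx hM => ?_⟩, ?_, hasDirection_hull (by simp) (by simp),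
      hasDirection_hull (by simp) (by simp)⟩
    · obtain ⟨t, ht, e, he, htri⟩ := hA.eq_tri_of_onMirror hs hx hM
      apply hC
      have := tri_sides (x := v) (y := v + u.1) (z := v + w.1) (s := s) ht he (by
        have := congrArg (fun A : Finset ℍ => (A : Set ℍ)) htri
        simpa [tri] using this) (ne _ hu) (ne _ hw) huw
      rwa [add_sub_cancel_left, add_sub_cancel_left] at this
    · have h1 := hA.cellDim_add_one
      have h2 : ({v, v + u.1, v + w.1} : Finset ℍ).card = 3 := by
        rw [Finset.card_eq_three]
        exact ⟨_, _, _, ne _ hu, ne _ hw, huw, rfl⟩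
      omega

theorem linkLength_eq {v : ℍ} (hv : {v} ∈ K) {u w : LinkVertex K v} (h : (link K v).Adj u w) :
    linkLength K v u w = Real.pi / 3 := by
  obtain ⟨hn, -⟩ := (link_adj_iff hv u w).1 h
  have hu := (link_vertex hv u).1
  have hw := (link_vertex hv w).1
  rw [normSq_sub_eq, hu.2, hw.2] at hn
  have hi : inner ℝ u.1 w.1 = 1 / 2 := by linarith
  rw [linkLength, InnerProductGeometry.angle, hi, u.2.1, w.2.1, mul_one, div_one,
    ← Real.cos_pi_div_three, Real.arccos_cos] <;> linarith [Real.pi_pos]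

/-! ### The Möbius–Kantor graph -/

instance : DecidableRel moebiusKantor.Adj := fun a b => by
  unfold moebiusKantor
  rw [SimpleGraph.fromRel_adj]
  infer_instance

/-- A labelling of the vertices of the Möbius–Kantor graph by signs. -/
def mkSigns : ZMod 8 ⊕ ZMod 8 → ℤ × ℤ × ℤ × ℤ :=
  Sum.elim
    (![(1, 1, 1, 1), (1, 1, 1, -1), (1, 1, -1, -1), (-1, 1, -1, -1), (-1, -1, -1, -1),
      (-1, -1, -1, 1), (-1, -1, 1, 1), (1, -1, 1, 1)] : Fin 8 → ℤ × ℤ × ℤ × ℤ)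
    (![(1, 1, -1, 1), (-1, 1, 1, -1), (1, -1, -1, -1), (-1, 1, -1, 1), (-1, -1, 1, -1),
      (1, -1, -1, 1), (-1, 1, 1, 1), (1, -1, 1, -1)] : Fin 8 → ℤ × ℤ × ℤ × ℤ)

/-- The combinatorial form of the adjacency of edge directions. -/
def SignAdj (p q : ℤ × ℤ × ℤ × ℤ) : Prop :=
  (p.1 - q.1) ^ 2 + (p.2.1 - q.2.1) ^ 2 + (p.2.2.1 - q.2.2.1) ^ 2 + (p.2.2.2 - q.2.2.2) ^ 2 = 4 ∧
  ¬ (p.1 * q.2.1 - p.2.1 * q.1 - p.2.2.1 * q.2.2.2 + p.2.2.2 * q.2.2.1 =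
      p.1 * q.2.2.1 + p.2.1 * q.2.2.2 - p.2.2.1 * q.1 - p.2.2.2 * q.2.1 ∧
    p.1 * q.2.2.1 + p.2.1 * q.2.2.2 - p.2.2.1 * q.1 - p.2.2.2 * q.2.1 =
      p.1 * q.2.2.2 - p.2.1 * q.2.2.1 + p.2.2.1 * q.2.1 - p.2.2.2 * q.1)

instance : DecidableRel SignAdj := fun p q => by
  unfold SignAdj
  infer_instance

theorem signAdj_mkSigns (m n : ZMod 8 ⊕ ZMod 8) :
    SignAdj (mkSigns m) (mkSigns n) ↔ moebiusKantor.Adj m n := by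
  revert m n
  decide +kernel

theorem mkSigns_injective : Function.Injective mkSigns := by
  decide +kernel

theorem exists_mkSigns : ∀ a ∈ ({1, -1} : Finset ℤ), ∀ b ∈ ({1, -1} : Finset ℤ),
    ∀ c ∈ ({1, -1} : Finset ℤ), ∀ d ∈ ({1, -1} : Finset ℤ), ∃ n, mkSigns n = (a, b, c, d) := by
  decide +kernel

theorem mkSigns_sign : ∀ n, (mkSigns n).1 ∈ ({1, -1} : Finset ℤ) ∧
    (mkSigns n).2.1 ∈ ({1, -1} : Finset ℤ) ∧ (mkSigns n).2.2.1 ∈ ({1, -1} : Finset ℤ) ∧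
    (mkSigns n).2.2.2 ∈ ({1, -1} : Finset ℤ) := by
  decide +kernel

/-- The bipartition of the Möbius–Kantor graph. -/
def mkColor : ZMod 8 ⊕ ZMod 8 → Bool :=
  Sum.elim (fun n : Fin 8 => decide (n.val % 2 = 0)) (fun n : Fin 8 => decide (n.val % 2 = 1))

theorem mkColor_ne : ∀ m n, moebiusKantor.Adj m n → mkColor m ≠ mkColor n := by
  decide +kernel

theorem moebiusKantor_four : ∀ a b c d, moebiusKantor.Adj a b → moebiusKantor.Adj b c →
    a ≠ c → moebiusKantor.Adj a d → moebiusKantor.Adj d c → b = d := by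
  decide +kernel

/-- Bipartiteness makes the length even, and length 4 would give two vertices with two common
neighbours. -/
theorem six_le_length {a : ZMod 8 ⊕ ZMod 8} (w : moebiusKantor.Walk a a) (hw : w.IsCycle) :
    6 ≤ w.length := by
  have h3 := hw.three_le_length
  have heven : Even w.length := by
    rw [(SimpleGraph.Coloring.mk mkColor fun {m n} h => mkColor_ne m n h).even_length_iff_congr w]
  by_contra hlt
  have h4 : w.length = 4 := by
    obtain ⟨k, hk⟩ := heven
    omega
  clear heven h3 hlt
  match w, hw, h4 with
  | .cons (v := b) h1 (.cons (v := c) h2 (.cons (v := d) h3 (.cons h4 .nil))), hw, _ =>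
    have hn := hw.support_nodup
    simp at hn
    have := moebiusKantor_four a b c d h1 h2 (by tauto) h4.symm h3.symm
    tauto

theorem girth_moebiusKantor : moebiusKantor.girth = 6 := by
  have h : ∀ m n, moebiusKantor.Adj m n ↔ SignAdj (mkSigns m) (mkSigns n) := fun m n =>
    (signAdj_mkSigns m n).symm
  have a1 : moebiusKantor.Adj (.inl 0) (.inr 0) := by decide +kernel
  have a2 : moebiusKantor.Adj (.inr 0) (.inr 3) := by decide +kernel
  have a3 : moebiusKantor.Adj (.inr 3) (.inl 3) := by decide +kernel
  have a4 : moebiusKantor.Adj (.inl 3) (.inl 2) := by decide +kernel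
  have a5 : moebiusKantor.Adj (.inl 2) (.inl 1) := by decide +kernel
  have a6 : moebiusKantor.Adj (.inl 1) (.inl 0) := by decide +kernel
  have hc : (SimpleGraph.Walk.cons a1 (.cons a2 (.cons a3 (.cons a4 (.cons a5
      (.cons a6 .nil)))))).IsCycle := by
    rw [SimpleGraph.Walk.isCycle_def, SimpleGraph.Walk.isTrail_def]
    refine ⟨?_, by simp, ?_⟩
    · simp only [SimpleGraph.Walk.edges_cons, SimpleGraph.Walk.edges_nil]
      decide +kernel
    · simp only [SimpleGraph.Walk.support_cons, SimpleGraph.Walk.support_nil, List.tail_cons]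
      decide +kernel
  refine le_antisymm (SimpleGraph.girth_le_length hc) ?_
  have hac : ¬ moebiusKantor.IsAcyclic := fun h => h _ hc
  obtain ⟨a, w, hw, e⟩ := SimpleGraph.exists_girth_eq_length.2 hac
  rw [e]
  exact six_le_length w hw

/-! ### The links -/

/-- The half-integral unit with the given signs. -/
def halfUnit (p : ℤ × ℤ × ℤ × ℤ) : ℍ := mkq (p.1 / 2) (p.2.1 / 2) (p.2.2.1 / 2) (p.2.2.2 / 2)

theorem halfUnit_injective : Function.Injective halfUnit := by
  intro p q h
  have h1 := congrArg QuaternionAlgebra.re h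
  have h2 := congrArg QuaternionAlgebra.imI h
  have h3 := congrArg QuaternionAlgebra.imJ h
  have h4 := congrArg QuaternionAlgebra.imK h
  simp only [halfUnit, re_mkq, imI_mkq, imJ_mkq, imK_mkq] at h1 h2 h3 h4
  refine Prod.ext ?_ (Prod.ext ?_ (Prod.ext ?_ ?_))
  · exact_mod_cast (by linarith : (p.1 : ℝ) = q.1)
  · exact_mod_cast (by linarith : (p.2.1 : ℝ) = q.2.1)
  · exact_mod_cast (by linarith : (p.2.2.1 : ℝ) = q.2.2.1)
  · exact_mod_cast (by linarith : (p.2.2.2 : ℝ) = q.2.2.2)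

/-- Clearing the denominator 4: the two conditions of `SignAdj` are |p - q|² = 4 and the failure of
p̄q to have equal imaginary coordinates. -/
theorem signAdj_iff (p q : ℤ × ℤ × ℤ × ℤ) : SignAdj p q ↔
    normSq (halfUnit p - halfUnit q) = 1 ∧ star (halfUnit p) * halfUnit q ∉ Cω := by
  rw [SignAdj, mem_Cω, normSq_coord]
  simp only [halfUnit, re_sub, imI_sub, imJ_sub, imK_sub, imI_mul, imJ_mul, imK_mul, re_star,
    imI_star, imJ_star, imK_star, re_mkq, imI_mkq, imJ_mkq, imK_mkq]
  refine and_congr ?_ (not_congr (and_congr ?_ ?_))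
  · rw [← Int.cast_inj (α := ℝ)]
    push_cast
    constructor <;> intro h <;> linarith
  · rw [← Int.cast_inj (α := ℝ)]
    push_cast
    constructor <;> intro h <;> linarith
  · rw [← Int.cast_inj (α := ℝ)]
    push_cast
    constructor <;> intro h <;> linarith

/-- A half-integral unit keeps a half-integral real part after adding 1. Conversely, in
`exists_halfUnit`, the eight integral units are all congruent to 1 modulo `D4` and so drop out. -/
theorem halfUnit_mkSigns_mem (n : ZMod 8 ⊕ ZMod 8) :
    halfUnit (mkSigns n) ∈ units ∧ 1 + halfUnit (mkSigns n) ∉ D4 := by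
  obtain ⟨h1, h2, h3, h4⟩ := mkSigns_sign n
  have sg : ∀ a ∈ ({1, -1} : Finset ℤ), (a : ℝ) = 1 ∨ (a : ℝ) = -1 := by
    intro a ha
    simp only [Finset.mem_insert, Finset.mem_singleton] at ha
    rcases ha with rfl | rfl <;> simp
  refine ⟨mkq_half_mem_units (sg _ h1) (sg _ h2) (sg _ h3) (sg _ h4), ?_⟩
  rintro ⟨a, b, c, d, h, -⟩
  have := congrArg QuaternionAlgebra.re h
  simp only [halfUnit, re_add, re_one, re_mkq] at this
  rcases sg _ h1 with h1 | h1 <;> rw [h1] at this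
  · have : (2 * a : ℝ) = 3 := by linarith
    have : 2 * a = 3 := by exact_mod_cast this
    omega
  · have : (2 * a : ℝ) = 1 := by linarith
    have : 2 * a = 1 := by exact_mod_cast this
    omega

theorem exists_halfUnit {u : ℍ} (hu : u ∈ units) (h : 1 + u ∉ D4) :
    ∃ n, halfUnit (mkSigns n) = u := by
  rcases units_cases hu with ⟨e, he, q, hq, rfl⟩ | ⟨a, b, c, d, ha, hb, hc, hd, rfl⟩
  · exfalso
    apply h
    simp only [Q4, Set.mem_insert_iff, Set.mem_singleton_iff] at hq
    rcases he with rfl | rfl <;> rcases hq with rfl | rfl | rfl | rfl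
    · exact ⟨2, 0, 0, 0, by ext <;> norm_num, by decide⟩
    · exact ⟨1, 1, 0, 0, by ext <;> norm_num, by decide⟩
    · exact ⟨1, 0, 1, 0, by ext <;> norm_num, by decide⟩
    · exact ⟨1, 0, 0, 1, by ext <;> norm_num, by decide⟩
    · exact ⟨0, 0, 0, 0, by ext <;> norm_num, by decide⟩
    · exact ⟨1, -1, 0, 0, by ext <;> norm_num, by decide⟩
    · exact ⟨1, 0, -1, 0, by ext <;> norm_num, by decide⟩
    · exact ⟨1, 0, 0, -1, by ext <;> norm_num, by decide⟩
  · have sg : ∀ a : ℝ, (a = 1 ∨ a = -1) → ∃ n ∈ ({1, -1} : Finset ℤ), a = n := by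
      rintro a (rfl | rfl)
      · exact ⟨1, by simp, by simp⟩
      · exact ⟨-1, by simp, by simp⟩
    obtain ⟨a, ka, rfl⟩ := sg a ha
    obtain ⟨b, kb, rfl⟩ := sg b hb
    obtain ⟨c, kc, rfl⟩ := sg c hc
    obtain ⟨d, kd, rfl⟩ := sg d hd
    obtain ⟨n, hn⟩ := exists_mkSigns a ka b kb c kc d kd
    exact ⟨n, by rw [hn]; rfl⟩

/-- Every class of vertices modulo `D4` contains a cube root of unity. -/
theorem exists_cubeRoot {v : ℍ} (hv : v ∈ hurwitz) (hvD : v ∉ D4) :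
    ∃ g ∈ cubeRoots, v - g ∈ D4 := by
  by_contra! h
  have h1 := h 1 (by simp [cubeRoots])
  have h2 := h ω (by simp [cubeRoots])
  have h3 := h (star ω) (by simp [cubeRoots])
  have hω := ω_mem_units
  have hω' := units_star hω
  have e1 : ω + 1 = -star ω := by ext <;> norm_num [ω_eq]
  have e2 : star ω + 1 = -ω := by ext <;> norm_num [ω_eq]
  have e3 : star ω + ω = -1 := by ext <;> norm_num [ω_eq]
  have d1 := notMem_D4_of_mem_units one_mem_units
  have d2 := notMem_D4_of_mem_units hω
  have d3 := notMem_D4_of_mem_units hω'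
  refine h3 (sub_mem_D4_of_classes hv hω'.1 hurwitz.one_mem hω.1 hvD d3 d1 d2 ?_ h1 h2 ?_ ?_)
  · rw [sub_mem_D4_iff hω.1, add_comm, e1]
    exact notMem_D4_of_mem_units (neg_mem_units hω')
  · rw [sub_mem_D4_iff hurwitz.one_mem, e2]
    exact notMem_D4_of_mem_units (neg_mem_units hω)
  · rw [sub_mem_D4_iff hω.1, e3]
    exact notMem_D4_of_mem_units (neg_mem_units one_mem_units)

theorem conj_mem_Cω_iff {g c : ℍ} (hg : g ∈ cubeRoots) : star g * (c * g) ∈ Cω ↔ c ∈ Cω := by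
  rw [mem_Cω, mem_Cω]
  simp only [cubeRoots, Set.mem_insert_iff, Set.mem_singleton_iff] at hg
  rcases hg with rfl | rfl | rfl
  · simp
  · simp [ω_eq]
    constructor <;> rintro ⟨h1, h2⟩ <;> constructor <;> linarith
  · simp [ω_eq]
    constructor <;> rintro ⟨h1, h2⟩ <;> constructor <;> linarith

/-- With g the cube root of unity congruent to v, right multiplication by g carries the directions
for the class of 1 to those at v. It preserves distances, and it preserves complex lines because g
lies in the commutative field `Cω`. -/
theorem link_iso_moebiusKantor {v : ℍ} (hv : {v} ∈ K) :
    Nonempty (link K v ≃g moebiusKantor) := by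
  obtain ⟨hvh, hvD, -⟩ := vertex_of_singleton_mem_K hv
  obtain ⟨g, hg, hvg⟩ := exists_cubeRoot hvh hvD
  obtain ⟨gh, gn, -⟩ := cubeRoots_facts hg
  have hgu : g ∈ units := ⟨gh, gn⟩
  have shift : ∀ u ∈ hurwitz, v + u * g ∉ D4 ↔ 1 + u ∉ D4 := by
    intro u hu
    have e : v + u * g = (v - g) + (1 + u) * g := by noncomm_ring
    rw [e, D4.add_mem_cancel_left hvg]
    refine not_congr ⟨fun h => ?_, fun h => mul_mem_D4_right gh h⟩
    have := mul_mem_D4_right (star_mem_hurwitz gh) h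
    rwa [mul_assoc, self_mul_star_of_unit gn, mul_one] at this
  let φ : ZMod 8 ⊕ ZMod 8 → LinkVertex K v := fun n =>
    ⟨halfUnit (mkSigns n) * g, (edge_direction_iff hv _).2
      ⟨units_mul (halfUnit_mkSigns_mem n).1 hgu,
        (shift _ (halfUnit_mkSigns_mem n).1.1).2 (halfUnit_mkSigns_mem n).2⟩⟩
  have hinj : Function.Injective φ := by
    intro m n h
    have h1 : halfUnit (mkSigns m) * g = halfUnit (mkSigns n) * g := congrArg Subtype.val h
    have h2 := congrArg (· * star g) h1
    simp only [mul_assoc, self_mul_star_of_unit gn, mul_one] at h2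
    exact mkSigns_injective (halfUnit_injective h2)
  have hsurj : Function.Surjective φ := by
    intro u
    obtain ⟨hu, hvu⟩ := link_vertex hv u
    have hug : u.1 * star g * g = u.1 := by
      rw [mul_assoc, star_mul_self_of_unit gn, mul_one]
    have hu' := units_mul hu (units_star hgu)
    rw [← hug, shift _ hu'.1] at hvu
    obtain ⟨n, hn⟩ := exists_halfUnit hu' hvu
    exact ⟨n, Subtype.ext (by change halfUnit (mkSigns n) * g = _; rw [hn, hug])⟩
  have hbij : Function.Bijective φ := ⟨hinj, hsurj⟩
  refine ⟨(RelIso.mk (Equiv.ofBijective φ hbij) ?_ : moebiusKantor ≃g link K v).symm⟩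
  intro m n
  change (link K v).Adj (φ m) (φ n) ↔ _
  rw [← signAdj_mkSigns, signAdj_iff, link_adj_iff hv]
  change normSq (halfUnit (mkSigns m) * g - halfUnit (mkSigns n) * g) = 1 ∧
    star (halfUnit (mkSigns m) * g) * (halfUnit (mkSigns n) * g) ∉ Cω ↔ _
  rw [← sub_mul, map_mul, gn, mul_one, star_mul, mul_assoc, ← mul_assoc _ _ g, conj_mem_Cω_iff hg]

theorem girth_link {v : ℍ} (hv : {v} ∈ K) : (link K v).girth = 6 := by
  obtain ⟨f⟩ := link_iso_moebiusKantor hv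
  rw [f.girth_eq, girth_moebiusKantor]

theorem isNonPositivelyCurved_K : IsNonPositivelyCurved K := by
  intro v hv u c hc
  have h6 : 6 ≤ c.length := girth_link hv ▸ SimpleGraph.girth_le_length hc
  have e : (c.darts.map fun d => linkLength K v d.fst d.snd) =
      c.darts.map fun _ => Real.pi / 3 :=
    List.map_congr_left fun d _ => linkLength_eq hv d.adj
  rw [e, List.map_const', List.sum_replicate, SimpleGraph.Walk.length_darts, nsmul_eq_mul]
  have : (6 : ℝ) ≤ c.length := by exact_mod_cast h6
  nlinarith [Real.pi_pos]

end ElegantComplex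

end

theorem theoremA :
    ElegantComplex.DeformationRetractsOnto
        (ElegantComplex.hyperplaneComplement ElegantComplex.reflG4) (⋃₀ ElegantComplex.K) ∧
      ElegantComplex.IsPolyhedralComplex ElegantComplex.K ∧
      ElegantComplex.IsTwoDimensional ElegantComplex.K ∧
      (∀ F ∈ ElegantComplex.K,
        ElegantComplex.cellDim F = 2 → ElegantComplex.IsEquilateralTriangle F) ∧
      (∀ v : Quaternion ℝ, {v} ∈ ElegantComplex.K →
        Nonempty (ElegantComplex.link ElegantComplex.K v ≃g ElegantComplex.moebiusKantor) ∧
        (ElegantComplex.link ElegantComplex.K v).girth = 6 ∧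
        ∀ u w, (ElegantComplex.link ElegantComplex.K v).Adj u w →
          ElegantComplex.linkLength ElegantComplex.K v u w = Real.pi / 3) ∧
      ElegantComplex.IsNonPositivelyCurved ElegantComplex.K :=
  ⟨ElegantComplex.deformationRetractsOnto_K, ElegantComplex.isPolyhedralComplex_K,
    ElegantComplex.isTwoDimensional_K,
    fun _ hF h2 => ElegantComplex.isEquilateralTriangle_of_mem_K hF h2,
    fun _ hv => ⟨ElegantComplex.link_iso_moebiusKantor hv, ElegantComplex.girth_link hv,
      fun _ _ h => ElegantComplex.linkLength_eq hv h⟩,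
    ElegantComplex.isNonPositivelyCurved_K⟩
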